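/- Let $G$ be a (real, finite-dimensional) Lie group, $H\subseteq G$ a closed subgroup, with Lie algebras $\mathfrak h\subseteq\mathfrak g$. Suppose that $G/H$ is reductive: there is a vector space decomposition $\mathfrak g=\mathfrak h\oplus\mathfrak m$ with $\mathrm{Ad}(H)\mathfrak m\subseteq\mathfrak m$. Fix such a decomposition and write $[X,Y]_{\mathfrak m}$ for the $\mathfrak m$-component of $[X,Y]$. Identify $\mathfrak m\cong T_{eH}(G/H)$ through the differential of the projection $G\to G/H$. Let $\langle\cdot,\cdot\rangle$ be a $G$-invariant Riemannian metric on $G/H$ with Levi-Civita connection $\nabla$. Let $\nabla^0$ be the canonical connection of second kind, i.e. the $G$-invariant affine connection on $G/H$ with $(\nabla^0_{X^\#}Y^\#)|_{eH}+[X,Y]_{\mathfrak m}=0$ for all $X,Y\in\mathfrak m$, where $X^\#$ is the vector field on $G/H$ with flow $(t,aH)\mapsto \exp(tX)aH$. For a connection with curvature $R(X,Y)Z=\nabla_X\nabla_YZ-\nabla_Y\nabla_XZ-\nabla_{[X,Y]}Z$ let $\mathrm{Ric}(Y,Z)=\mathrm{tr}(X\mapsto R(X,Y)Z)$. Write $R,\mathrm{Ric}$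 for $\nabla$ and $R^0,\mathrm{Ric}^0$ for $\nabla^0$, and put $R^d=R-R^0$ and $\mathrm{Ric}^d=\mathrm{Ric}-\mathrm{Ric}^0$. Suppose that $\mathrm{Ric}^d$ is a Codazzi tensor field, i.e. it is symmetric and $(\nabla_X\mathrm{Ric}^d)(Y,Z)=(\nabla_Y\mathrm{Ric}^d)(X,Z)$ for all vector fields $X,Y,Z$, and that $\nabla\mathrm{Ric}^d\neq0$. Let $\lambda_1<\dots<\lambda_r$ be the distinct eigenvalues of $\mathrm{Ric}^d$ at $eH$ with respect to $\langle\cdot,\cdot\rangle$, with eigenspaces $\mathfrak m_1,\dots,\mathfrak m_r\subseteq\mathfrak m$. For $Y,Z\in\mathfrak m_i$ the endomorphism $X\mapsto R^d(X,Y)Z$ maps $\mathfrak m_i$ into itself; let $\mathrm{Ric}^d_i(Y,Z)$ be the trace of its restriction to $\mathfrak m_i$, and let $\mathrm s^d_i$ be the trace of $\mathrm{Ric}^d_i$ with respect to $\langle\cdot,\cdot\rangle|_{\mathfrak m_i\times\mathfrak m_i}$. If $\mathrm s^d_i\geq0$ for $1\leq i\leq r-1$, then $\mathrm s^d_r\neq0$.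 In particular (without any assumption on the signs of the $\mathrm s^d_i$), not all the eigenspaces $\mathfrak m_1,\dots,\mathfrak m_r$ are abelian subalgebras of $(\mathfrak m,[\cdot,\cdot]_{\mathfrak m})$, i.e. it is impossible that $[X,Y]_{\mathfrak m}=0$ for all $X,Y\in\mathfrak m_i$ and all $i$. -/

import Mathlib

open Bundle Module
open scoped Manifold ContDiff Topology

noncomputable section

namespace ReductiveHomogeneous

section Tangent

variable {F : Type*} [NormedAddCommGroup F] [NormedSpace ℝ F] [FiniteDimensional ℝ F]
  {M : Type*} [TopologicalSpace M] [ChartedSpace F M]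

instance instFiniteDimensionalTangentSpace (x : M) :
    FiniteDimensional ℝ (TangentSpace 𝓘(ℝ, F) x) :=
  inferInstanceAs (FiniteDimensional ℝ F)

end Tangent

/-! ## Affine connections, curvature and Codazzi tensors on a manifold -/

section Curvature

variable {F : Type*} [NormedAddCommGroup F] [NormedSpace ℝ F] [FiniteDimensional ℝ F]
  {M : Type*} [TopologicalSpace M] [ChartedSpace F M] [IsManifold 𝓘(ℝ, F) ∞ M]

/-- The vector field `R(X,Y)Z = ∇_X ∇_Y Z - ∇_Y ∇_X Z - ∇_[X,Y] Z`. Recall that `cov Z x v` is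
`(∇_v Z)(x)`. -/
def curvatureField (cov : CovariantDerivative 𝓘(ℝ, F) F (TangentSpace 𝓘(ℝ, F) : M → Type _))
    (X Y Z : (x : M) → TangentSpace 𝓘(ℝ, F) x) (x : M) : TangentSpace 𝓘(ℝ, F) x :=
  cov (fun y => cov Z y (Y y)) x (X x) - cov (fun y => cov Z y (X y)) x (Y x)
    - cov Z x (VectorField.mlieBracket 𝓘(ℝ, F) X Y x)

/-- The curvature tensor `(u, v, w) ↦ R(u,v)w` at the point `x`: the trilinear map whose components
in a basis of `T_xM` are computed from the local frame (smooth near `x`) that extends this basis. -/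
def curvature (cov : CovariantDerivative 𝓘(ℝ, F) F (TangentSpace 𝓘(ℝ, F) : M → Type _)) (x : M) :
    TangentSpace 𝓘(ℝ, F) x →ₗ[ℝ] TangentSpace 𝓘(ℝ, F) x →ₗ[ℝ] TangentSpace 𝓘(ℝ, F) x →ₗ[ℝ]
      TangentSpace 𝓘(ℝ, F) x :=
  let b := finBasis ℝ (TangentSpace 𝓘(ℝ, F) x)
  b.constr ℝ fun i => b.constr ℝ fun j => b.constr ℝ fun k =>
    curvatureField cov (FiberBundle.extend F (b i)) (FiberBundle.extend F (b j))
      (FiberBundle.extend F (b k)) x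

/-- The Ricci contraction `Ric(v,w) = tr(u ↦ R(u,v)w)`. -/
def ricciOf {V : Type*} [AddCommGroup V] [Module ℝ V] (R : V →ₗ[ℝ] V →ₗ[ℝ] V →ₗ[ℝ] V) :
    V →ₗ[ℝ] V →ₗ[ℝ] ℝ :=
  LinearMap.mk₂ ℝ (fun v w => LinearMap.trace ℝ V ((R.flip v).flip w))
    (fun v v' w => by rw [← map_add]; congr 1; ext u; simp)
    (fun c v w => by rw [← map_smul]; congr 1; ext u; simp)
    (fun v w w' => by rw [← map_add]; congr 1; ext u; simp)
    (fun c v w => by rw [← map_smul]; congr 1; ext u; simp)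

/-- The difference Ricci tensor `Ric^d = Ric - Ric⁰` of two connections. -/
def differenceRicci
    (cov cov0 : CovariantDerivative 𝓘(ℝ, F) F (TangentSpace 𝓘(ℝ, F) : M → Type _)) (x : M) :
    TangentSpace 𝓘(ℝ, F) x →ₗ[ℝ] TangentSpace 𝓘(ℝ, F) x →ₗ[ℝ] ℝ :=
  ricciOf (curvature cov x) - ricciOf (curvature cov0 x)

/-- `(∇_X A)(Y, Z) = X(A(Y,Z)) - A(∇_X Y, Z) - A(Y, ∇_X Z)` for a twice-covariant tensor field. -/
def covDeriv (cov : CovariantDerivative 𝓘(ℝ, F) F (TangentSpace 𝓘(ℝ, F) : M → Type _))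
    (A : (x : M) → TangentSpace 𝓘(ℝ, F) x →ₗ[ℝ] TangentSpace 𝓘(ℝ, F) x →ₗ[ℝ] ℝ)
    (X Y Z : (x : M) → TangentSpace 𝓘(ℝ, F) x) (x : M) : ℝ :=
  mvfderiv 𝓘(ℝ, F) (fun y => A y (Y y) (Z y)) x (X x)
    - A x (cov Y x (X x)) (Z x) - A x (Y x) (cov Z x (X x))

/-- Smooth vector fields on `M`. -/
def IsSmoothField (X : (x : M) → TangentSpace 𝓘(ℝ, F) x) : Prop :=
  ContMDiff 𝓘(ℝ, F) 𝓘(ℝ, F).tangent ∞ fun x => (⟨x, X x⟩ : TangentBundle 𝓘(ℝ, F) M)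

/-- The Levi-Civita connection of a Riemannian metric: torsionfree, and compatible with the metric,
`X⟨Y, Z⟩ = ⟨∇_X Y, Z⟩ + ⟨Y, ∇_X Z⟩`. -/
structure IsLeviCivita [RiemannianBundle (fun x : M => TangentSpace 𝓘(ℝ, F) x)]
    (cov : CovariantDerivative 𝓘(ℝ, F) F (TangentSpace 𝓘(ℝ, F) : M → Type _)) : Prop where
  torsion_eq_zero : cov.torsion = 0
  metric : ∀ X Y Z : (x : M) → TangentSpace 𝓘(ℝ, F) x,
    IsSmoothField X → IsSmoothField Y → IsSmoothField Z → ∀ x,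
      mvfderiv 𝓘(ℝ, F) (fun y => (inner ℝ (Y y) (Z y) : ℝ)) x (X x) =
        inner ℝ (cov Y x (X x)) (Z x) + inner ℝ (Y x) (cov Z x (X x))

/-- A Codazzi tensor field for a torsionfree connection: a smooth symmetric twice-covariant tensor
field `A` with `(∇_X A)(Y, Z) = (∇_Y A)(X, Z)` for all smooth vector fields. -/
structure IsCodazzi (cov : CovariantDerivative 𝓘(ℝ, F) F (TangentSpace 𝓘(ℝ, F) : M → Type _))
    (A : (x : M) → TangentSpace 𝓘(ℝ, F) x →ₗ[ℝ] TangentSpace 𝓘(ℝ, F) x →ₗ[ℝ] ℝ) : Prop where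
  smooth : ∀ Y Z : (x : M) → TangentSpace 𝓘(ℝ, F) x, IsSmoothField Y → IsSmoothField Z →
    ContMDiff 𝓘(ℝ, F) 𝓘(ℝ, ℝ) ∞ fun x => A x (Y x) (Z x)
  symm : ∀ (x : M) (u v : TangentSpace 𝓘(ℝ, F) x), A x u v = A x v u
  codazzi : ∀ X Y Z : (x : M) → TangentSpace 𝓘(ℝ, F) x,
    IsSmoothField X → IsSmoothField Y → IsSmoothField Z →
      ∀ x, covDeriv cov A X Y Z x = covDeriv cov A Y X Z x

/-- `∇A = 0`. -/
def IsParallel (cov : CovariantDerivative 𝓘(ℝ, F) F (TangentSpace 𝓘(ℝ, F) : M → Type _))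
    (A : (x : M) → TangentSpace 𝓘(ℝ, F) x →ₗ[ℝ] TangentSpace 𝓘(ℝ, F) x →ₗ[ℝ] ℝ) : Prop :=
  ∀ X Y Z : (x : M) → TangentSpace 𝓘(ℝ, F) x,
    IsSmoothField X → IsSmoothField Y → IsSmoothField Z → ∀ x, covDeriv cov A X Y Z x = 0

end Curvature

/-! ## Eigenspaces and partial traces on a Euclidean vector space -/

section Euclidean

variable {V : Type*} [NormedAddCommGroup V] [InnerProductSpace ℝ V] [FiniteDimensional ℝ V]

/-- The eigenspace `{u | A(u, v) = c ⟨u, v⟩ for all v}` of a bilinear form with respect to the inner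
product. -/
def eigenspace (A : V →ₗ[ℝ] V →ₗ[ℝ] ℝ) (c : ℝ) : Submodule ℝ V :=
  LinearMap.ker (A - c • innerₗ V)

/-- The restriction of a curvature-like tensor `R` to a subspace `W`, followed by the orthogonal
projection onto `W` (which does nothing when `R` maps `W × W × W` into `W`). -/
def restrictTo (R : V →ₗ[ℝ] V →ₗ[ℝ] V →ₗ[ℝ] V) (W : Submodule ℝ V) :
    W →ₗ[ℝ] W →ₗ[ℝ] W →ₗ[ℝ] W :=
  LinearMap.mk₂ ℝ
    (fun u v => W.orthogonalProjectionOnto.toLinearMap ∘ₗ R u v ∘ₗ W.subtype)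
    (fun u u' v => by ext w; simp) (fun c u v => by ext w; simp)
    (fun u v v' => by ext w; simp) (fun c u v => by ext w; simp)

/-- The trace of a bilinear form with respect to the inner product. -/
def metricTrace (B : V →ₗ[ℝ] V →ₗ[ℝ] ℝ) : ℝ :=
  ∑ a, B (stdOrthonormalBasis ℝ V a) (stdOrthonormalBasis ℝ V a)

/-- The scalar curvature of the restriction of a curvature-like tensor to a subspace `W`: the metric
trace over `W` of `(v, w) ↦ tr(W ∋ u ↦ R(u,v)w)`. -/
def scalarOn (R : V →ₗ[ℝ] V →ₗ[ℝ] V →ₗ[ℝ] V) (W : Submodule ℝ V) : ℝ :=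
  metricTrace (ricciOf (restrictTo R W))

end Euclidean

/-! ## Reductive homogeneous spaces -/

section Homogeneous

variable {E : Type*} [NormedAddCommGroup E] [NormedSpace ℝ E] [FiniteDimensional ℝ E]
  {G : Type*} [TopologicalSpace G] [ChartedSpace E G] [Group G]

/-- The adjoint action of `g : G` on the Lie algebra, i.e. the differential of `a ↦ g a g⁻¹`
at `1`. -/
def Ad (g : G) (X : GroupLieAlgebra 𝓘(ℝ, E) G) : GroupLieAlgebra 𝓘(ℝ, E) G :=
  mfderiv 𝓘(ℝ, E) 𝓘(ℝ, E) (fun a : G => g * a * g⁻¹) 1 X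

/-- `X` is tangent to the subgroup `H` at `1`: it is the velocity at `0` of a smooth curve in `G`
that starts at `1` and stays in `H`. For a closed subgroup these vectors are the Lie algebra
of `H`. -/
def IsTangentTo (H : Subgroup G) (X : GroupLieAlgebra 𝓘(ℝ, E) G) : Prop :=
  ∃ γ : ℝ → G, ContMDiff 𝓘(ℝ, ℝ) 𝓘(ℝ, E) ∞ γ ∧ γ 0 = 1 ∧ (∀ t, γ t ∈ H) ∧
    (mfderiv 𝓘(ℝ, ℝ) 𝓘(ℝ, E) γ 0 (1 : ℝ) : E) = X

variable (E) in
/-- A reductive decomposition `𝔤 = 𝔥 ⊕ 𝔪`, where `𝔥` is the Lie algebra of `H` and `𝔪` is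
`Ad(H)`-invariant. -/
structure ReductiveDecomposition (H : Subgroup G) where
  /-- The Lie algebra of `H`. -/
  𝔥 : Submodule ℝ (GroupLieAlgebra 𝓘(ℝ, E) G)
  /-- The reductive complement. -/
  𝔪 : Submodule ℝ (GroupLieAlgebra 𝓘(ℝ, E) G)
  mem_𝔥 : ∀ X, X ∈ 𝔥 ↔ IsTangentTo H X
  isCompl : IsCompl 𝔥 𝔪
  ad_mem : ∀ h ∈ H, ∀ X ∈ 𝔪, Ad h X ∈ 𝔪

/-- `[X, Y]_𝔪`, the projection onto `𝔪` along `𝔥` of the bracket of `𝔤`. -/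
def ReductiveDecomposition.bracket {H : Subgroup G} (D : ReductiveDecomposition E H)
    (X Y : GroupLieAlgebra 𝓘(ℝ, E) G) : GroupLieAlgebra 𝓘(ℝ, E) G :=
  D.𝔪.projection D.𝔥 D.isCompl.symm ⁅X, Y⁆

variable {F : Type*} [NormedAddCommGroup F] [NormedSpace ℝ F] [FiniteDimensional ℝ F]
  {H : Subgroup G} [ChartedSpace F (G ⧸ H)] [IsManifold 𝓘(ℝ, F) ∞ (G ⧸ H)]

variable (E F H) in
/-- The smooth structure of `G ⧸ H` makes `π : G → G/H` a smooth principal `H`-bundle, i.e. `π` is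
smooth and has smooth local sections around every point. There is only one such structure. -/
structure IsPrincipalQuotient : Prop where
  contMDiff_mk : ContMDiff 𝓘(ℝ, E) 𝓘(ℝ, F) ∞ (fun g : G => (g : G ⧸ H))
  exists_section : ∀ x : G ⧸ H, ∃ U : Set (G ⧸ H), IsOpen U ∧ x ∈ U ∧ ∃ s : G ⧸ H → G,
    ContMDiffOn 𝓘(ℝ, F) 𝓘(ℝ, E) ∞ s U ∧ ∀ y ∈ U, (s y : G ⧸ H) = y

variable (F H) in
/-- The tangent space of `G/H` at the base point `eH`. -/
abbrev BaseTangent : Type _ := TangentSpace 𝓘(ℝ, F) ((1 : G) : G ⧸ H)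

variable (E F H) in
/-- The differential `dπ_e : 𝔤 → T_{eH}(G/H)`. -/
def dProj : GroupLieAlgebra 𝓘(ℝ, E) G →L[ℝ] BaseTangent F H :=
  mfderiv 𝓘(ℝ, E) 𝓘(ℝ, F) (fun g : G => (g : G ⧸ H)) 1

/-- The action field `X^#` on `G/H`: its value at `x` is the differential at `1` of `g ↦ g x`,
applied to `X`. -/
def actionField (X : GroupLieAlgebra 𝓘(ℝ, E) G) (x : G ⧸ H) : TangentSpace 𝓘(ℝ, F) x :=
  (mfderiv 𝓘(ℝ, E) 𝓘(ℝ, F) (fun g : G => g • x) 1 X : F)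

/-- The Riemannian metric of `G/H` is invariant under the left translations `τ_g`. -/
def IsInvariantMetric (F : Type*) [NormedAddCommGroup F] [NormedSpace ℝ F] (H : Subgroup G)
    [ChartedSpace F (G ⧸ H)]
    [RiemannianBundle (fun x : G ⧸ H => TangentSpace 𝓘(ℝ, F) x)] : Prop :=
  ∀ (g : G) (x : G ⧸ H) (u v : TangentSpace 𝓘(ℝ, F) x),
    inner ℝ (mfderiv 𝓘(ℝ, F) 𝓘(ℝ, F) (fun y : G ⧸ H => g • y) x u)
      (mfderiv 𝓘(ℝ, F) 𝓘(ℝ, F) (fun y : G ⧸ H => g • y) x v) = inner ℝ u v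

/-- A connection is `G`-invariant if `dτ_g (∇_u (τ_g^* Z)) = ∇_{dτ_g u} Z` for all smooth `Z`. -/
def IsInvariantConnection
    (cov : CovariantDerivative 𝓘(ℝ, F) F (TangentSpace 𝓘(ℝ, F) : G ⧸ H → Type _)) : Prop :=
  ∀ (g : G) (Z : (x : G ⧸ H) → TangentSpace 𝓘(ℝ, F) x), IsSmoothField Z →
    ∀ (x : G ⧸ H) (u : TangentSpace 𝓘(ℝ, F) x),
      mfderiv 𝓘(ℝ, F) 𝓘(ℝ, F) (fun y : G ⧸ H => g • y) x
        (cov (VectorField.mpullback 𝓘(ℝ, F) 𝓘(ℝ, F) (fun y : G ⧸ H => g • y) Z) x u) =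
      cov Z (g • x) (mfderiv 𝓘(ℝ, F) 𝓘(ℝ, F) (fun y : G ⧸ H => g • y) x u)

/-- The canonical connection of second kind: the `G`-invariant connection whose multiplication
`α(X, Y) = (∇_{X^#} Y^#)_{eH} + [X, Y]_𝔪` on `𝔪 ≅ T_{eH}(G/H)` vanishes. -/
structure IsCanonicalConnection (D : ReductiveDecomposition E H)
    (cov : CovariantDerivative 𝓘(ℝ, F) F (TangentSpace 𝓘(ℝ, F) : G ⧸ H → Type _)) : Prop where
  invariant : IsInvariantConnection cov
  mul_eq_zero : ∀ X ∈ D.𝔪, ∀ Y ∈ D.𝔪,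
    cov (actionField Y) ((1 : G) : G ⧸ H) (actionField X ((1 : G) : G ⧸ H))
      + dProj E F H (D.bracket X Y) = 0

/-- The eigenspace of `Ric^d` in `T_{eH}(G/H)` for the eigenvalue `c`. -/
def ricciEigenspace [RiemannianBundle (fun x : G ⧸ H => TangentSpace 𝓘(ℝ, F) x)]
    (cov cov0 : CovariantDerivative 𝓘(ℝ, F) F (TangentSpace 𝓘(ℝ, F) : G ⧸ H → Type _)) (c : ℝ) :
    Submodule ℝ (BaseTangent F H) :=
  eigenspace (differenceRicci cov cov0 ((1 : G) : G ⧸ H)) c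

/-- The same eigenspace as a subspace of `𝔪`, under the isomorphism `dπ_e : 𝔪 ≅ T_{eH}(G/H)`. -/
def ricciEigenspaceIn [RiemannianBundle (fun x : G ⧸ H => TangentSpace 𝓘(ℝ, F) x)]
    (D : ReductiveDecomposition E H)
    (cov cov0 : CovariantDerivative 𝓘(ℝ, F) F (TangentSpace 𝓘(ℝ, F) : G ⧸ H → Type _)) (c : ℝ) :
    Submodule ℝ (GroupLieAlgebra 𝓘(ℝ, E) G) :=
  D.𝔪 ⊓ (ricciEigenspace cov cov0 c).comap (dProj E F H).toLinearMap

/-- The difference scalar curvature `s^d_i` of the leaf through `eH` of the eigendistribution of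
`Ric^d`: it is computed from the restriction of `R^d = R - R⁰` to the eigenspace for the
eigenvalue `c`, which is the tangent space of the leaf. -/
def leafScalar [RiemannianBundle (fun x : G ⧸ H => TangentSpace 𝓘(ℝ, F) x)]
    (cov cov0 : CovariantDerivative 𝓘(ℝ, F) F (TangentSpace 𝓘(ℝ, F) : G ⧸ H → Type _)) (c : ℝ) :
    ℝ :=
  scalarOn (curvature cov ((1 : G) : G ⧸ H) - curvature cov0 ((1 : G) : G ⧸ H))
    (ricciEigenspace cov cov0 c)

end Homogeneous

end ReductiveHomogeneous

end

/-! Everything reduces to linear algebra on `T_{eH}(G/H)`. Let `α = ∇ - ∇⁰` (`differenceMul`). Both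
connections are metric, so each `α_u` is skew. Since `∇` is torsionfree, `α_u v - α_v u` is minus
the torsion of `∇⁰`, which at `eH` is `[u, v]_𝔪`. A skew multiplication is determined by its
torsion, so `α` is `G`-invariant. The connection `∇⁰` is a Lie bracket with suitable action fields
at each point, hence `G`-invariant tensors are `∇⁰`-parallel. Therefore `R^d(u,v) = [α_u, α_v] -
α_{α_u v - α_v u}`, and `∇Ric^d` is the algebraic action of `α` on the invariant form `Ric^d`.

Take an orthonormal eigenbasis `e_a` of `Ric^d` with eigenvalues `μ_a`. The Codazzi equation makes
`c_{abd} = (μ_d - μ_b)⟨α_{e_a} e_b, e_d⟩` totally symmetric, and it vanishes when two of the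
eigenvalues agree. For `μ_a ≠ μ_b` this gives `⟨R^d(e_a,e_b)e_b, e_a⟩ = 2 ∑_d c_{abd}² / ((μ_d -
μ_a)(μ_d - μ_b))` (`IsCodazziPair.sectional_eq`).

Two consequences follow. Summed over all `a, b` these terms cancel cyclically, so `tr Ric^d = ∑_i
s^d_i` (`sum_offDiagonal_eq_zero`). Summed over `a` for `μ_b` maximal they are nonpositive, so `dim
𝔪_r · λ_r ≤ s^d_r` (`sum_maximal_nonpos`). If all `s^d_i ≥ 0` and `s^d_r = 0`, then every eigenvalue
is nonpositive while the trace is nonnegative. Thus `Ric^d = 0` at `eH`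
(`ricciOf_eq_zero_of_scalarOn`), hence everywhere by invariance, contradicting `∇Ric^d ≠ 0`.

If all eigenspaces are abelian, then `α` is both symmetric and skew on each of them, and maps `𝔪_i ×
𝔪_i` orthogonally to the others. So `α` vanishes there and all `s^d_i` are zero
(`scalarOn_eq_zero_of_torsion`), which the first part excludes. -/

set_option linter.unusedSectionVars false

noncomputable section

namespace ReductiveHomogeneous

/-! ### Partial traces and eigenbases in a Euclidean space -/

section EuclideanAlgebra

variable {V : Type*} [NormedAddCommGroup V] [InnerProductSpace ℝ V] [FiniteDimensional ℝ V]
  {ι κ : Type*} [Fintype ι] [Fintype κ]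

local notation "⟪" x ", " y "⟫" => inner ℝ x y

/-- Parseval: `∑ a, ⟪b k, e a⟫⟪b l, e a⟫` is the Kronecker delta. This allows all traces over
subspaces to be computed in one eigenbasis of the whole space. -/
lemma sum_apply_self_eq_sum_projection (W : Submodule ℝ V) (b : OrthonormalBasis κ ℝ W)
    (e : OrthonormalBasis ι ℝ V) (Q : W →ₗ[ℝ] W →ₗ[ℝ] ℝ) :
    ∑ k, Q (b k) (b k) =
      ∑ a, Q (W.orthogonalProjectionOnto (e a)) (W.orthogonalProjectionOnto (e a)) := by
  classical
  have hP (a : ι) : W.orthogonalProjectionOnto (e a) = ∑ k, ⟪(b k : V), e a⟫ • b k := by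
    conv_lhs => rw [← b.sum_repr (W.orthogonalProjectionOnto (e a))]
    refine Finset.sum_congr rfl fun k _ => ?_
    rw [b.repr_apply_apply]
    simp
  simp only [hP, map_sum, LinearMap.sum_apply, map_smul, LinearMap.smul_apply, smul_eq_mul]
  rw [Finset.sum_comm]
  refine Finset.sum_congr rfl fun k _ => ?_
  simp only [Finset.mul_sum]
  rw [Finset.sum_comm]
  have h (l : κ) : ∑ a, ⟪(b k : V), e a⟫ * (⟪(b l : V), e a⟫ * Q (b l) (b k)) =
      (if l = k then 1 else 0) * Q (b l) (b k) := by
    have h1 := e.sum_inner_mul_inner (b l : V) (b k : V)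
    have h2 : ⟪(b l : V), (b k : V)⟫ = if l = k then 1 else 0 := by
      rw [← Submodule.coe_inner]
      exact (orthonormal_iff_ite.mp b.orthonormal) l k
    rw [← h2, ← h1, Finset.sum_mul]
    refine Finset.sum_congr rfl fun a _ => ?_
    rw [real_inner_comm (e a) (b k : V)]; ring
  simp [h]

lemma trace_eq_sum_inner_projection (W : Submodule ℝ V) (e : OrthonormalBasis ι ℝ V)
    (f : W →ₗ[ℝ] W) :
    LinearMap.trace ℝ W f =
      ∑ a, ⟪W.orthogonalProjectionOnto (e a), f (W.orthogonalProjectionOnto (e a))⟫ := by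
  rw [LinearMap.trace_eq_sum_inner f (stdOrthonormalBasis ℝ W)]
  exact sum_apply_self_eq_sum_projection W (stdOrthonormalBasis ℝ W) e ((innerₗ W).compl₂ f)

lemma ricciOf_apply {U : Type*} [AddCommGroup U] [Module ℝ U]
    (R : U →ₗ[ℝ] U →ₗ[ℝ] U →ₗ[ℝ] U) (v w : U) :
    ricciOf R v w = LinearMap.trace ℝ U ((R.flip v).flip w) := rfl

omit [FiniteDimensional ℝ V] in
lemma ricciOf_eq_sum (e : OrthonormalBasis ι ℝ V) (R : V →ₗ[ℝ] V →ₗ[ℝ] V →ₗ[ℝ] V) (v w : V) :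
    ricciOf R v w = ∑ a, ⟪R (e a) v w, e a⟫ := by
  rw [ricciOf_apply, LinearMap.trace_eq_sum_inner _ e]
  exact Finset.sum_congr rfl fun a _ => real_inner_comm _ _

lemma restrictTo_apply (R : V →ₗ[ℝ] V →ₗ[ℝ] V →ₗ[ℝ] V) (W : Submodule ℝ V) (u v w : W) :
    restrictTo R W u v w = W.orthogonalProjectionOnto (R u v w) := rfl

-- For a basis adapted to `W ⊕ Wᗮ` the projection keeps or kills each basis vector, so the scalar
-- curvature is a plain sum of sectional terms.
open scoped Classical in
lemma scalarOn_eq_sum (e : OrthonormalBasis ι ℝ V) (R : V →ₗ[ℝ] V →ₗ[ℝ] V →ₗ[ℝ] V)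
    (W : Submodule ℝ V) (S : ι → Prop) (hS : ∀ a, S a → e a ∈ W) (hS' : ∀ a, ¬ S a → e a ∈ Wᗮ) :
    scalarOn R W = ∑ b, ∑ a, if S a ∧ S b then ⟪R (e a) (e b) (e b), e a⟫ else 0 := by
  have hP (a : ι) : (W.orthogonalProjectionOnto (e a) : V) = if S a then e a else 0 := by
    split_ifs with h
    · exact Submodule.starProjection_eq_self_iff.mpr (hS a h)
    · rw [Submodule.orthogonalProjectionOnto_apply_of_mem_orthogonal (hS' a h)]; rfl
  rw [scalarOn, metricTrace, sum_apply_self_eq_sum_projection W _ e]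
  refine Finset.sum_congr rfl fun b _ => ?_
  rw [ricciOf_apply, trace_eq_sum_inner_projection W e]
  refine Finset.sum_congr rfl fun a _ => ?_
  rw [LinearMap.flip_apply, LinearMap.flip_apply, restrictTo_apply,
    Submodule.inner_orthogonalProjectionOnto_eq_of_mem_left, hP a, hP b, real_inner_comm]
  by_cases ha : S a <;> by_cases hb : S b <;> simp [ha, hb]


omit [FiniteDimensional ℝ V] in
lemma mem_eigenspace_iff {A : V →ₗ[ℝ] V →ₗ[ℝ] ℝ} {c : ℝ} {u : V} :
    u ∈ eigenspace A c ↔ ∀ v, A u v = c * ⟪u, v⟫ := by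
  rw [eigenspace, LinearMap.mem_ker, LinearMap.ext_iff]
  refine forall_congr' fun v => ?_
  simp [sub_eq_zero]

/-- A symmetric bilinear form has an orthonormal basis of eigenvectors. -/
lemma exists_orthonormalBasis_eigenvectors (A : V →ₗ[ℝ] V →ₗ[ℝ] ℝ) (hA : ∀ u v, A u v = A v u) :
    ∃ (e : OrthonormalBasis (Fin (finrank ℝ V)) ℝ V) (μ : Fin (finrank ℝ V) → ℝ),
      ∀ a v, A (e a) v = μ a * ⟪e a, v⟫ := by
  let T : V →ₗ[ℝ] V :=
    (InnerProductSpace.toDual ℝ V).symm.toLinearEquiv.toLinearMap ∘ₗ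
      LinearMap.toContinuousLinearMap.toLinearMap ∘ₗ A
  have hT (u v : V) : ⟪T u, v⟫ = A u v := by
    simp [T, InnerProductSpace.toDual_symm_apply]
  have hs : T.IsSymmetric := fun u v => by
    rw [hT, real_inner_comm, hT, hA]
  refine ⟨hs.eigenvectorBasis rfl, hs.eigenvalues rfl, fun a v => ?_⟩
  rw [← hT, hs.apply_eigenvectorBasis rfl a, RCLike.ofReal_real_eq_id, id, real_inner_smul_left]

end EuclideanAlgebra

/-! ### Sums of squares weighted by eigenvalue differences -/

section Combinatorics

variable {ι : Type*} [Fintype ι] {μ : ι → ℝ} {c : ι → ι → ι → ℝ}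

/-- The sum over all pairs of indices with distinct eigenvalues cancels in cyclic triples. -/
lemma sum_offDiagonal_eq_zero (h₁ : ∀ a b d, c a b d = c b a d) (h₂ : ∀ a b d, c a b d = c a d b)
    (h₀ : ∀ a b d, μ a = μ b → c a b d = 0) :
    ∑ b, ∑ a, ∑ d, c a b d ^ 2 / ((μ d - μ a) * (μ d - μ b)) = 0 := by
  set f : ι → ι → ι → ℝ := fun b a d => c a b d ^ 2 / ((μ d - μ a) * (μ d - μ b)) with hf
  have e1 : ∑ b, ∑ a, ∑ d, f b a d = ∑ b, ∑ a, ∑ d, f d a b := by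
    rw [Finset.sum_comm]
    conv_rhs => rw [Finset.sum_comm]
    exact Finset.sum_congr rfl fun a _ => Finset.sum_comm
  have e2 : ∑ b, ∑ a, ∑ d, f b a d = ∑ b, ∑ a, ∑ d, f b d a :=
    Finset.sum_congr rfl fun b _ => Finset.sum_comm
  -- Each of the three indices plays the distinguished role once, and `1/((z-x)(z-y)) +
  -- 1/((y-x)(y-z)) + 1/((x-y)(x-z)) = 0`. When two eigenvalues agree, the common numerator
  -- vanishes, which also covers the divisions by zero.
  have key (a b d : ι) : f b a d + f d a b + f b d a = 0 := by
    have hb : c d b a = c a b d := by rw [h₁, h₂, h₁]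
    have hc : c a d b = c a b d := (h₂ _ _ _).symm
    simp only [hf, hb, hc]
    by_cases hab : μ a = μ b
    · simp [h₀ _ _ _ hab]
    by_cases hda : μ d = μ a
    · have : c a b d = 0 := by rw [h₂, h₀ a d b hda.symm]
      simp [this]
    by_cases hdb : μ d = μ b
    · have : c a b d = 0 := by rw [h₂, h₁, h₂, h₀ d b a hdb]
      simp [this]
    have := sub_ne_zero.mpr hab
    have := sub_ne_zero.mpr hda
    have := sub_ne_zero.mpr hdb
    have := sub_ne_zero.mpr (Ne.symm hab)
    have := sub_ne_zero.mpr (Ne.symm hda)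
    have := sub_ne_zero.mpr (Ne.symm hdb)
    field_simp
    ring
  have : ∑ b, ∑ a, ∑ d, (f b a d + f d a b + f b d a) = 0 := by simp [key]
  simp only [Finset.sum_add_distrib] at this
  linarith

/-- At a maximal eigenvalue the sum over the other pairs is nonpositive. -/
lemma sum_maximal_nonpos (h₁ : ∀ a b d, c a b d = c b a d) (h₂ : ∀ a b d, c a b d = c a d b)
    (h₀ : ∀ a b d, μ a = μ b → c a b d = 0) {b : ι} (hb : ∀ a, μ a ≤ μ b) :
    ∑ a, ∑ d, c a b d ^ 2 / ((μ d - μ a) * (μ d - μ b)) ≤ 0 := by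
  set f : ι → ι → ℝ := fun a d => c a b d ^ 2 / ((μ d - μ a) * (μ d - μ b)) with hf
  have e : ∑ a, ∑ d, f a d = ∑ a, ∑ d, f d a := Finset.sum_comm
  -- Symmetrizing in `a` and `d` merges the two fractions into `-c²/((μ a - μ b)(μ d - μ b))`, whose
  -- denominator is a product of two negative numbers.
  have key (a d : ι) : f a d + f d a ≤ 0 := by
    have hb' : c d b a = c a b d := by rw [h₁, h₂, h₁]
    simp only [hf, hb']
    by_cases hab : μ a = μ b
    · simp [h₀ _ _ _ hab]
    by_cases hdb : μ d = μ b
    · have : c a b d = 0 := by rw [h₂, h₁, h₂, h₀ d b a hdb]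
      simp [this]
    by_cases hda : μ d = μ a
    · have : c a b d = 0 := by rw [h₂, h₀ a d b hda.symm]
      simp [this]
    have p := sub_neg.mpr (lt_of_le_of_ne (hb a) hab)
    have q := sub_neg.mpr (lt_of_le_of_ne (hb d) hdb)
    have h3 := sub_ne_zero.mpr hda
    have h4 := sub_ne_zero.mpr (Ne.symm hda)
    have : c a b d ^ 2 / ((μ d - μ a) * (μ d - μ b)) + c a b d ^ 2 / ((μ a - μ d) * (μ a - μ b)) =
        - (c a b d ^ 2 / ((μ a - μ b) * (μ d - μ b))) := by
      have := p.ne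
      have := q.ne
      field_simp
      ring
    rw [this, neg_nonpos]
    exact div_nonneg (sq_nonneg _) (mul_pos_of_neg_of_neg p q).le
  have : ∑ a, ∑ d, (f a d + f d a) ≤ 0 :=
    Finset.sum_nonpos fun a _ => Finset.sum_nonpos fun d _ => key a d
  simp only [Finset.sum_add_distrib] at this
  linarith

end Combinatorics

/-! ### Curvature of a skew multiplication with a Codazzi form -/

section AlgebraicCurvature

variable {V : Type*} [NormedAddCommGroup V] [InnerProductSpace ℝ V]

local notation "⟪" x ", " y "⟫" => inner ℝ x y

/-- The curvature-like tensor of a bilinear multiplication `α`: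
`R(u,v) = [α_u, α_v] - α_[u,v]` with `[u,v] = α_u v - α_v u`. -/
def IsCurvatureOf (R : V →ₗ[ℝ] V →ₗ[ℝ] V →ₗ[ℝ] V) (α : V →ₗ[ℝ] V →ₗ[ℝ] V) : Prop :=
  ∀ u v w, R u v w = α u (α v w) - α v (α u w) - α (α u v - α v u) w

/-- `α` is skew-symmetric and the covariant derivative `A(α_u v, w) + A(v, α_u w)` of the
symmetric form `A` is totally symmetric. -/
structure IsCodazziPair (α : V →ₗ[ℝ] V →ₗ[ℝ] V) (A : V →ₗ[ℝ] V →ₗ[ℝ] ℝ) : Prop where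
  skew : ∀ u v w, ⟪α u v, w⟫ = -⟪v, α u w⟫
  symm : ∀ u v, A u v = A v u
  codazzi : ∀ u v w, A (α u v) w + A v (α u w) = A (α v u) w + A u (α v w)

variable {α : V →ₗ[ℝ] V →ₗ[ℝ] V} {A : V →ₗ[ℝ] V →ₗ[ℝ] ℝ}
  {R : V →ₗ[ℝ] V →ₗ[ℝ] V →ₗ[ℝ] V}

namespace IsCodazziPair

/-- On eigenvectors the form `A` becomes a multiple of the inner product, and skewness of `α` moves
every term onto `w`. With `coeff_swap_right` this is the total symmetry of `c`. -/
lemma eigen_symm (h : IsCodazziPair α A) {u v w : V} {a b d : ℝ}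
    (hu : u ∈ eigenspace A a) (hv : v ∈ eigenspace A b) (hw : w ∈ eigenspace A d) :
    (d - b) * ⟪α u v, w⟫ = (d - a) * ⟪α v u, w⟫ := by
  have := h.codazzi u v w
  rw [h.symm (α u v) w, h.symm (α v u) w, mem_eigenspace_iff.mp hw, mem_eigenspace_iff.mp hw,
    mem_eigenspace_iff.mp hu, mem_eigenspace_iff.mp hv, real_inner_comm _ w,
    real_inner_comm _ w] at this
  linear_combination this - b * h.skew u v w + a * h.skew v u w

/-- Eigenspaces are totally geodesic: `α` maps pairs of vectors of one eigenspace orthogonally to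
the other eigenspaces. -/
lemma inner_eq_zero (h : IsCodazziPair α A) {u v w : V} {a d : ℝ}
    (hu : u ∈ eigenspace A a) (hv : v ∈ eigenspace A a) (hw : w ∈ eigenspace A d) (had : a ≠ d) :
    ⟪α u v, w⟫ = 0 := by
  have h1 := h.eigen_symm hu hw hv
  have h2 := h.eigen_symm hw hu hv
  have h3 := h.skew u v w
  rw [sub_self, zero_mul] at h2
  have h4 : (a - d) * ⟪α u w, v⟫ = 0 := by linarith
  have h5 := (mul_eq_zero.mp h4).resolve_left (sub_ne_zero.mpr had)
  rw [h3, real_inner_comm, h5, neg_zero]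

variable {ι : Type*} [Fintype ι] {e : OrthonormalBasis ι ℝ V} {μ : ι → ℝ}

lemma coeff_swap_right (h : IsCodazziPair α A) (a b d : ι) :
    (μ d - μ b) * ⟪α (e a) (e b), e d⟫ = (μ b - μ d) * ⟪α (e a) (e d), e b⟫ := by
  rw [h.skew (e a) (e b) (e d), real_inner_comm]; ring

/-- In terms of the totally symmetric `c`, the coefficients of `α` are `c/(μ d - μ b)`, `c/(μ d - μ
a)` and `c/(μ a - μ b)`. The product of the first two arises once from `α_b α_a` and once more from
the torsion term, whence the factor 2. -/
lemma sectional_eq (h : IsCodazziPair α A) (hR : IsCurvatureOf R α)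
    (he : ∀ a, e a ∈ eigenspace A (μ a)) {a b : ι} (hab : μ a ≠ μ b) :
    ⟪R (e a) (e b) (e b), e a⟫ = 2 * ∑ d, ((μ d - μ b) * ⟪α (e a) (e b), e d⟫) ^ 2 /
      ((μ d - μ a) * (μ d - μ b)) := by
  have ex (x y : V) : ⟪x, y⟫ = ∑ d, ⟪x, e d⟫ * ⟪y, e d⟫ := by
    rw [← e.sum_inner_mul_inner x y]
    exact Finset.sum_congr rfl fun d _ => by rw [real_inner_comm y (e d)]
  -- By skewness this is `-⟪α_b b, α_a a⟫`, a product of vectors in two distinct, hence orthogonal,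
  -- eigenspaces.
  have t1 : ⟪α (e a) (α (e b) (e b)), e a⟫ = 0 := by
    rw [h.skew, ex, neg_eq_zero]
    refine Finset.sum_eq_zero fun d _ => ?_
    by_cases hd : μ b = μ d
    · rw [h.inner_eq_zero (he a) (he a) (he d) (hd ▸ hab), mul_zero]
    · rw [h.inner_eq_zero (he b) (he b) (he d) hd, zero_mul]
  have t2 : ⟪α (e b) (α (e a) (e b)), e a⟫ =
      -∑ d, ⟪α (e a) (e b), e d⟫ * ⟪α (e b) (e a), e d⟫ := by
    rw [h.skew, ex]
  have t3 : ⟪α (α (e a) (e b) - α (e b) (e a)) (e b), e a⟫ =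
      ∑ d, (⟪α (e a) (e b), e d⟫ - ⟪α (e b) (e a), e d⟫) * ⟪α (e d) (e b), e a⟫ := by
    conv_lhs => rw [← e.sum_repr' (α (e a) (e b) - α (e b) (e a))]
    rw [map_sum, LinearMap.sum_apply, sum_inner]
    refine Finset.sum_congr rfl fun d _ => ?_
    rw [map_smul, LinearMap.smul_apply, real_inner_smul_left, real_inner_comm, inner_sub_left]
  rw [hR, inner_sub_left, inner_sub_left, t1, t2, t3, zero_sub, neg_neg, ← Finset.sum_sub_distrib,
    Finset.mul_sum]
  refine Finset.sum_congr rfl fun d _ => ?_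
  have p := h.eigen_symm (he a) (he b) (he d)
  have q : (μ a - μ b) * ⟪α (e d) (e b), e a⟫ = (μ d - μ b) * ⟪α (e a) (e b), e d⟫ := by
    rw [h.eigen_symm (he d) (he b) (he a), p, ← h.coeff_swap_right b a d]
  have hab' := sub_ne_zero.mpr hab
  -- When `μ d` equals `μ b` or `μ a`, the right-hand term is 0 by the convention for division by 0.
  -- The left-hand term also vanishes, because enough coefficients of `α` do.
  by_cases hdb : μ d = μ b
  · have hda : μ d - μ a ≠ 0 := by rw [hdb]; exact sub_ne_zero.mpr hab.symm
    rw [hdb, sub_self, zero_mul] at p q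
    have p' := (mul_eq_zero.mp p.symm).resolve_left (hdb ▸ hda)
    have q' := (mul_eq_zero.mp q).resolve_left hab'
    rw [p', q', hdb]; simp
  by_cases hda : μ d = μ a
  · rw [hda, sub_self, zero_mul] at p
    have p' := (mul_eq_zero.mp p).resolve_left hab'
    rw [p', mul_zero] at q
    have q' := (mul_eq_zero.mp q).resolve_left hab'
    rw [p', q']; simp
  have hda' := sub_ne_zero.mpr hda
  have hdb' := sub_ne_zero.mpr hdb
  generalize ⟪α (e a) (e b), e d⟫ = x at *
  generalize hy : ⟪α (e b) (e a), e d⟫ = y at *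
  generalize hz : ⟪α (e d) (e b), e a⟫ = z at *
  have hy' : y = (μ d - μ b) * x / (μ d - μ a) := by field_simp; linarith
  have hz' : z = (μ d - μ b) * x / (μ a - μ b) := by field_simp; linarith
  rw [hy', hz']
  field_simp
  ring

end IsCodazziPair

variable [FiniteDimensional ℝ V]

/-- If all the partial scalar curvatures are nonnegative, and the last one vanishes, then the
Ricci form is zero. -/
theorem ricciOf_eq_zero_of_scalarOn (h : IsCodazziPair α (ricciOf R)) (hR : IsCurvatureOf R α)
    {r : ℕ} {lam : Fin r → ℝ} (hlam : StrictMono lam)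
    (hspec : ∀ c : ℝ, c ∈ Set.range lam ↔ eigenspace (ricciOf R) c ≠ ⊥)
    (hs : ∀ i : Fin r, 0 ≤ scalarOn R (eigenspace (ricciOf R) (lam i)))
    {m : Fin r} (hm : ∀ i, i ≤ m) (hlast : scalarOn R (eigenspace (ricciOf R) (lam m)) = 0) :
    ricciOf R = 0 := by
  classical
  obtain ⟨e, μ, he⟩ := exists_orthonormalBasis_eigenvectors (ricciOf R) h.symm
  have hmem (a) : e a ∈ eigenspace (ricciOf R) (μ a) := mem_eigenspace_iff.mpr (he a)
  have hne (a) : e a ≠ 0 := e.orthonormal.ne_zero a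
  set K : Fin (finrank ℝ V) → Fin (finrank ℝ V) → ℝ :=
    fun a b => ⟪R (e a) (e b) (e b), e a⟫ with hK
  have hμK (b) : ∑ a, K a b = μ b := by
    have := ricciOf_eq_sum e R (e b) (e b)
    rw [he, real_inner_self_eq_norm_sq, e.orthonormal.1] at this
    simpa using this.symm
  have hscal (c : ℝ) : scalarOn R (eigenspace (ricciOf R) c) =
      ∑ b, ∑ a, if μ a = c ∧ μ b = c then K a b else 0 := by
    have := scalarOn_eq_sum e R (eigenspace (ricciOf R) c) (fun a => μ a = c)
      (fun a ha => ha ▸ hmem a) (fun a ha => by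
        rw [Submodule.mem_orthogonal]
        intro u hu
        have h1 := mem_eigenspace_iff.mp hu (e a)
        rw [h.symm, he, real_inner_comm] at h1
        have h2 : (μ a - c) * ⟪u, e a⟫ = 0 := by linarith
        exact (mul_eq_zero.mp h2).resolve_left (sub_ne_zero.mpr ha))
    convert this
  have hrange (b) : ∃ i, lam i = μ b := by
    have := (hspec (μ b)).mpr fun hbot => hne b (by simpa [hbot] using hmem b)
    simpa using this
  -- the off-diagonal part of `K`
  set cc : Fin (finrank ℝ V) → Fin (finrank ℝ V) → Fin (finrank ℝ V) → ℝ :=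
    fun a b d => (μ d - μ b) * ⟪α (e a) (e b), e d⟫ with hcc
  have hcc₂ (a b d) : cc a b d = cc a d b := h.coeff_swap_right a b d
  have hcc₁ (a b d) : cc a b d = cc b a d := h.eigen_symm (hmem a) (hmem b) (hmem d)
  -- Symmetry lets the factor `μ d - μ b` be exchanged for the difference of any two of the
  -- eigenvalues.
  have hcc₀ (a b d) (hab : μ a = μ b) : cc a b d = 0 := by
    rw [hcc₂, hcc₁, hcc₂]
    simp [hcc, hab]
  have hoff (b) : ∑ a, (if μ a = μ b then 0 else K a b) =
      2 * ∑ a, ∑ d, cc a b d ^ 2 / ((μ d - μ a) * (μ d - μ b)) := by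
    rw [Finset.mul_sum]
    refine Finset.sum_congr rfl fun a _ => ?_
    split_ifs with hab
    · simp [hcc₀ _ _ _ hab]
    · exact h.sectional_eq hR hmem hab
  have hsplit (b) : μ b = (∑ a, if μ a = μ b then K a b else 0) +
      ∑ a, (if μ a = μ b then 0 else K a b) := by
    rw [← hμK b, ← Finset.sum_add_distrib]
    exact Finset.sum_congr rfl fun a _ => by rw [hμK b]; split_ifs <;> simp
  -- the trace of `Ric` is nonnegative
  have htr : 0 ≤ ∑ b, μ b := by
    have h1 : ∑ b, μ b = ∑ b, ∑ a, if μ a = μ b then K a b else 0 := by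
      have h3 : ∑ b, μ b = ∑ b, ((∑ a, if μ a = μ b then K a b else 0) +
          ∑ a, (if μ a = μ b then 0 else K a b)) := Finset.sum_congr rfl fun b _ => hsplit b
      rw [h3, Finset.sum_add_distrib]
      simp only [hoff]
      rw [← Finset.mul_sum, sum_offDiagonal_eq_zero hcc₁ hcc₂ hcc₀]
      simp
    -- Pairs with equal eigenvalues are grouped by that eigenvalue; injectivity of `lam` ensures
    -- that each pair is counted once.
    have h2 : ∑ b, ∑ a, (if μ a = μ b then K a b else 0) =
        ∑ i, scalarOn R (eigenspace (ricciOf R) (lam i)) := by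
      simp only [hscal]
      conv_rhs => rw [Finset.sum_comm]
      refine Finset.sum_congr rfl fun b _ => ?_
      conv_rhs => rw [Finset.sum_comm]
      refine Finset.sum_congr rfl fun a _ => ?_
      obtain ⟨i, hi⟩ := hrange b
      rw [Finset.sum_eq_single i]
      · simp [hi]
      · intro j _ hj
        rw [if_neg]
        rintro ⟨_, h2⟩
        exact hj (hlam.injective (by rw [← h2, hi]))
      · simp
    rw [h1, h2]
    exact Finset.sum_nonneg fun i _ => hs i
  -- the largest eigenvalue is nonpositive
  set l : ℝ := lam m with hl
  have hmax (a) : μ a ≤ l := by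
    obtain ⟨i, hi⟩ := hrange a
    rw [← hi]
    exact hlam.monotone (hm i)
  -- If no basis vector had eigenvalue `l`, every vector of the eigenspace of `l` would be
  -- orthogonal to the whole basis.
  obtain ⟨b₀, hb₀⟩ : ∃ b, μ b = l := by
    by_contra hcon
    push Not at hcon
    refine (hspec l).mp ⟨_, rfl⟩ ((Submodule.eq_bot_iff _).mpr fun u hu => ?_)
    refine InnerProductSpace.ext_inner_left_basis e.toBasis fun a => ?_
    have h1 := mem_eigenspace_iff.mp hu (e a)
    rw [h.symm, he, real_inner_comm] at h1
    have h2 : (μ a - l) * ⟪u, e a⟫ = 0 := by linarith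
    have := (mul_eq_zero.mp h2).resolve_left (sub_ne_zero.mpr (hcon a))
    simp [real_inner_comm, this]
  have hlsum : ∑ b, (if μ b = l then μ b else 0) ≤ 0 := by
    -- At a maximal eigenvalue the contribution of the other eigenspaces to `μ b` is nonpositive, so
    -- only the partial Ricci term bounds it from above.
    have h1 (b) : (if μ b = l then μ b else 0) ≤
        ∑ a, if μ a = l ∧ μ b = l then K a b else 0 := by
      split_ifs with hb
      · have := hsplit b
        have h2 := sum_maximal_nonpos hcc₁ hcc₂ hcc₀ (b := b) (fun a => hb ▸ hmax a)
        rw [hoff b] at this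
        simp only [hb, and_true] at this h2 ⊢
        linarith
      · simp [hb]
    calc _ ≤ ∑ b, ∑ a, (if μ a = l ∧ μ b = l then K a b else 0) :=
          Finset.sum_le_sum fun b _ => h1 b
      _ = 0 := by rw [← hscal, hlast]
  have hl0 : l ≤ 0 := by
    by_contra hpos
    push Not at hpos
    have : 0 < ∑ b, (if μ b = l then μ b else 0) :=
      Finset.sum_pos' (fun b _ => by split_ifs with hb <;> [exact hb ▸ hpos.le; exact le_rfl])
        ⟨b₀, Finset.mem_univ _, by simp [hb₀, hpos]⟩
    linarith
  -- Nonpositive numbers with nonnegative sum are all zero.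
  have hμ0 (a) : μ a = 0 := by
    have hle (b) : μ b ≤ 0 := (hmax b).trans hl0
    have hsum : ∑ b, μ b = 0 := le_antisymm (Finset.sum_nonpos fun b _ => hle b) htr
    exact (Finset.sum_eq_zero_iff_of_nonpos fun b _ => hle b).mp hsum a (Finset.mem_univ _)
  refine e.toBasis.ext fun a => LinearMap.ext fun v => ?_
  simp [he, hμ0]

/-- If the torsion `α_u v - α_v u` vanishes on an eigenspace of `A`, then so does the partial scalar
curvature. -/
theorem scalarOn_eq_zero_of_torsion {A : V →ₗ[ℝ] V →ₗ[ℝ] ℝ} (h : IsCodazziPair α A)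
    (hR : IsCurvatureOf R α) {c : ℝ}
    (hc : ∀ u ∈ eigenspace A c, ∀ v ∈ eigenspace A c, α u v = α v u) :
    scalarOn R (eigenspace A c) = 0 := by
  classical
  obtain ⟨e, μ, he⟩ := exists_orthonormalBasis_eigenvectors A h.symm
  have hmem (a) : e a ∈ eigenspace A (μ a) := mem_eigenspace_iff.mpr (he a)
  have hperp (a) (ha : μ a ≠ c) (u) (hu : u ∈ eigenspace A c) : ⟪u, e a⟫ = 0 := by
    have h1 := mem_eigenspace_iff.mp hu (e a)
    rw [h.symm, he, real_inner_comm] at h1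
    have h2 : (μ a - c) * ⟪u, e a⟫ = 0 := by linarith
    exact (mul_eq_zero.mp h2).resolve_left (sub_ne_zero.mpr ha)
  -- Within the eigenspace, `⟪α u v, w⟫` is symmetric in the first two arguments and skew in the
  -- last two, hence zero. Components along the other eigenspaces vanish because eigenspaces are
  -- totally geodesic.
  have hzero (u) (hu : u ∈ eigenspace A c) (v) (hv : v ∈ eigenspace A c) : α u v = 0 := by
    refine InnerProductSpace.ext_inner_left_basis e.toBasis fun a => ?_
    rw [inner_zero_right, OrthonormalBasis.coe_toBasis, real_inner_comm]
    by_cases ha : c = μ a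
    · have hw : e a ∈ eigenspace A c := ha ▸ hmem a
      generalize e a = w at hw
      have s1 := h.skew u v w
      have s2 := h.skew v w u
      have s3 := h.skew w u v
      rw [hc u hu w hw] at s1
      rw [hc v hv u hu] at s2
      rw [hc w hw v hv] at s3
      rw [real_inner_comm] at s1 s2 s3
      have := real_inner_comm v (α w u)
      have := real_inner_comm w (α u v)
      have := real_inner_comm u (α v w)
      linarith
    · exact h.inner_eq_zero hu hv (hmem a) ha
  rw [scalarOn_eq_sum e R _ (fun a => μ a = c) (fun a ha => ha ▸ hmem a)
    (fun a ha => (Submodule.mem_orthogonal _ _).mpr fun u hu => hperp a ha u hu)]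
  refine Finset.sum_eq_zero fun b _ => Finset.sum_eq_zero fun a _ => ?_
  split_ifs with hab
  · have ha : e a ∈ eigenspace A c := hab.1 ▸ hmem a
    have hb : e b ∈ eigenspace A c := hab.2 ▸ hmem b
    rw [hR, hzero _ hb _ hb, hzero _ ha _ hb, hzero _ hb _ ha]
    simp
  · rfl

end AlgebraicCurvature

/-! ### Vector fields acting on functions, computed in charts -/

section ManifoldCalculus

variable {E : Type*} [NormedAddCommGroup E] [NormedSpace ℝ E]
  {F : Type*} [NormedAddCommGroup F] [NormedSpace ℝ F]
  {M : Type*} [TopologicalSpace M] [ChartedSpace E M]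
  {N : Type*} [TopologicalSpace N] [ChartedSpace F N]
  {W : Type*} [NormedAddCommGroup W] [NormedSpace ℝ W]

lemma inverse_apply_of_eq_id {L : E →L[ℝ] E} (h : L = ContinuousLinearMap.id ℝ E) (v : E) :
    L.inverse v = v := by
  rw [h, ContinuousLinearMap.inverse_id, ContinuousLinearMap.id_apply]

lemma mvfderiv_eq_fderiv {f : M → W} {x : M} (hf : MDifferentiableAt 𝓘(ℝ, E) 𝓘(ℝ, W) f x)
    (v : TangentSpace 𝓘(ℝ, E) x) :
    mvfderiv 𝓘(ℝ, E) f x v =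
      fderiv ℝ (f ∘ (extChartAt 𝓘(ℝ, E) x).symm) (extChartAt 𝓘(ℝ, E) x x) v := by
  have := hf.mvfderiv
  rw [ModelWithCorners.range_eq_univ, fderivWithin_univ] at this
  exact congrArg (fun L : E →L[ℝ] W => L v) this

lemma mvfderiv_comp_apply' {f : N → M} {g : M → W} (x : N)
    (hg : MDifferentiableAt 𝓘(ℝ, E) 𝓘(ℝ, W) g (f x))
    (hf : MDifferentiableAt 𝓘(ℝ, F) 𝓘(ℝ, E) f x) (v : TangentSpace 𝓘(ℝ, F) x) :
    mvfderiv 𝓘(ℝ, F) (fun y => g (f y)) x v =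
      mvfderiv 𝓘(ℝ, E) g (f x) (mfderiv 𝓘(ℝ, F) 𝓘(ℝ, E) f x v) :=
  mfderiv_comp_apply x hg hf v

lemma mvfderiv_congr {f g : M → W} {x : M} (h : f =ᶠ[𝓝 x] g) :
    mvfderiv 𝓘(ℝ, E) f x = mvfderiv 𝓘(ℝ, E) g x := by
  ext v
  exact congrArg (fun L : E →L[ℝ] W => L v) h.mfderiv_eq

lemma contDiffAt_comp_extChartAt_symm [IsManifold 𝓘(ℝ, E) ∞ M] {f : M → W} {x : M} {n : ℕ∞}
    (hf : ContMDiffAt 𝓘(ℝ, E) 𝓘(ℝ, W) n f x) :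
    ContDiffAt ℝ n (f ∘ (extChartAt 𝓘(ℝ, E) x).symm) (extChartAt 𝓘(ℝ, E) x x) := by
  rw [← contMDiffAt_iff_contDiffAt]
  have h1 := contMDiffWithinAt_extChartAt_symm_range (I := 𝓘(ℝ, E)) (n := n) x
    (mem_extChartAt_target x)
  rw [ModelWithCorners.range_eq_univ, contMDiffWithinAt_univ] at h1
  refine ContMDiffAt.comp _ ?_ h1
  rwa [extChartAt_to_inv]

/-- The local coordinate expression of `df(V)`. -/
lemma mvfderiv_vectorField_comp_symm [CompleteSpace E] [IsManifold 𝓘(ℝ, E) ∞ M] {f : M → W} {x : M}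
    (hf : ContMDiffAt 𝓘(ℝ, E) 𝓘(ℝ, W) 2 f x) (V : (y : M) → TangentSpace 𝓘(ℝ, E) y) :
    (fun y => mvfderiv 𝓘(ℝ, E) f y (V y)) ∘ (extChartAt 𝓘(ℝ, E) x).symm
      =ᶠ[𝓝 (extChartAt 𝓘(ℝ, E) x x)]
    fun z => fderiv ℝ (f ∘ (extChartAt 𝓘(ℝ, E) x).symm) z
      (VectorField.mpullbackWithin 𝓘(ℝ, E) 𝓘(ℝ, E) (extChartAt 𝓘(ℝ, E) x).symm V
        (Set.range 𝓘(ℝ, E)) z) := by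
  have h1 : ∀ᶠ y in 𝓝 x, MDifferentiableAt 𝓘(ℝ, E) 𝓘(ℝ, W) f y :=
    ((contMDiffAt_iff_contMDiffAt_nhds (by simp)).mp hf).mono fun y hy =>
      hy.mdifferentiableAt (by simp)
  have h2 : ∀ᶠ z in 𝓝 (extChartAt 𝓘(ℝ, E) x x),
      MDifferentiableAt 𝓘(ℝ, E) 𝓘(ℝ, W) f ((extChartAt 𝓘(ℝ, E) x).symm z) :=
    (continuousAt_extChartAt_symm x).eventually (by rwa [extChartAt_to_inv])
  filter_upwards [h2, extChartAt_target_mem_nhds (I := 𝓘(ℝ, E)) x] with z hz hzt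
  have hsymm : MDifferentiableAt 𝓘(ℝ, E) 𝓘(ℝ, E) (extChartAt 𝓘(ℝ, E) x).symm z := by
    have := mdifferentiableWithinAt_extChartAt_symm (I := 𝓘(ℝ, E)) hzt
    rwa [ModelWithCorners.range_eq_univ, mdifferentiableWithinAt_univ] at this
  have hinv := isInvertible_mfderivWithin_extChartAt_symm (I := 𝓘(ℝ, E)) hzt
  have hc := mvfderiv_comp_apply' z hz hsymm
    (VectorField.mpullbackWithin 𝓘(ℝ, E) 𝓘(ℝ, E) (extChartAt 𝓘(ℝ, E) x).symm V
        (Set.range 𝓘(ℝ, E)) z)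
  have hV : mfderiv 𝓘(ℝ, E) 𝓘(ℝ, E) (extChartAt 𝓘(ℝ, E) x).symm z
      (VectorField.mpullbackWithin 𝓘(ℝ, E) 𝓘(ℝ, E) (extChartAt 𝓘(ℝ, E) x).symm V
        (Set.range 𝓘(ℝ, E)) z) = V ((extChartAt 𝓘(ℝ, E) x).symm z) := by
    rw [VectorField.mpullbackWithin_apply, ← mfderivWithin_univ, ← ModelWithCorners.range_eq_univ
      𝓘(ℝ, E)]
    exact hinv.self_apply_inverse _
  rw [hV] at hc
  rw [Function.comp_apply, ← hc, mvfderiv]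
  simp only [ContinuousLinearMap.comp_apply]
  rw [mfderiv_eq_fderiv]
  rfl

lemma mpullbackWithin_extChartAt_symm_self [IsManifold 𝓘(ℝ, E) ∞ M]
    (V : (y : M) → TangentSpace 𝓘(ℝ, E) y) (x : M) :
    VectorField.mpullbackWithin 𝓘(ℝ, E) 𝓘(ℝ, E) (extChartAt 𝓘(ℝ, E) x).symm V
        (Set.range 𝓘(ℝ, E)) (extChartAt 𝓘(ℝ, E) x x) = (V x : E) := by
  have h (y : M) (hy : y = x) : (V y : E) = V x := by rw [hy]
  exact (mfderivWithin_extChartAt_symm_inverse_apply (I := 𝓘(ℝ, E)) (x := x)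
    (V ((extChartAt 𝓘(ℝ, E) x).symm (extChartAt 𝓘(ℝ, E) x x)) : E)).trans
      (h _ (extChartAt_to_inv x))

lemma mdifferentiableAt_iff_comp_extChartAt_symm [IsManifold 𝓘(ℝ, E) ∞ M] {f : M → W} {x : M} :
    MDifferentiableAt 𝓘(ℝ, E) 𝓘(ℝ, W) f x ↔
      DifferentiableAt ℝ (f ∘ (extChartAt 𝓘(ℝ, E) x).symm) (extChartAt 𝓘(ℝ, E) x x) := by
  constructor
  · intro hf
    have := hf.differentiableWithinAt_writtenInExtChartAt
    rwa [ModelWithCorners.range_eq_univ, differentiableWithinAt_univ] at this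
  · intro h
    have h1 : MDifferentiableAt 𝓘(ℝ, E) 𝓘(ℝ, W)
        (f ∘ (extChartAt 𝓘(ℝ, E) x).symm ∘ extChartAt 𝓘(ℝ, E) x) x :=
      h.mdifferentiableAt.comp x (mdifferentiableAt_extChartAt (mem_chart_source _ x))
    refine h1.congr_of_eventuallyEq ?_
    filter_upwards [extChartAt_source_mem_nhds (I := 𝓘(ℝ, E)) x] with y hy
    simp only [Function.comp_apply]
    rw [(extChartAt 𝓘(ℝ, E) x).left_inv hy]

variable [CompleteSpace E] [IsManifold 𝓘(ℝ, E) ∞ M]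

lemma differentiableAt_mpullbackWithin_symm {V : (y : M) → TangentSpace 𝓘(ℝ, E) y} {x : M}
    (hV : MDifferentiableAt 𝓘(ℝ, E) 𝓘(ℝ, E).tangent
      (fun y => (⟨y, V y⟩ : TangentBundle 𝓘(ℝ, E) M)) x) :
    DifferentiableAt ℝ (fun z => (VectorField.mpullbackWithin 𝓘(ℝ, E) 𝓘(ℝ, E)
      (extChartAt 𝓘(ℝ, E) x).symm V (Set.range 𝓘(ℝ, E)) z : E)) (extChartAt 𝓘(ℝ, E) x x) := by
  have : IsManifold 𝓘(ℝ, E) 2 M := .of_le (n := ∞) (by norm_cast)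
  have h := hV.mdifferentiableWithinAt (s := Set.univ)
    |>.differentiableWithinAt_mpullbackWithin_vectorField
  exact h.differentiableAt (by simp)

/-- `df(V)` is differentiable, if `f` and `V` are smooth enough. -/
lemma mdifferentiableAt_mvfderiv_vectorField {f : M → W} {x : M}
    (hf : ContMDiffAt 𝓘(ℝ, E) 𝓘(ℝ, W) 2 f x) {V : (y : M) → TangentSpace 𝓘(ℝ, E) y}
    (hV : MDifferentiableAt 𝓘(ℝ, E) 𝓘(ℝ, E).tangent
      (fun y => (⟨y, V y⟩ : TangentBundle 𝓘(ℝ, E) M)) x) :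
    MDifferentiableAt 𝓘(ℝ, E) 𝓘(ℝ, W) (fun y => mvfderiv 𝓘(ℝ, E) f y (V y)) x := by
  rw [mdifferentiableAt_iff_comp_extChartAt_symm]
  refine DifferentiableAt.congr_of_eventuallyEq ?_ (mvfderiv_vectorField_comp_symm hf V)
  have h1 : DifferentiableAt ℝ (fderiv ℝ (f ∘ (extChartAt 𝓘(ℝ, E) x).symm))
      (extChartAt 𝓘(ℝ, E) x x) :=
    ((contDiffAt_comp_extChartAt_symm (n := 2) hf).fderiv_right (m := 1) le_rfl).differentiableAt
      one_ne_zero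
  exact h1.clm_apply (differentiableAt_mpullbackWithin_symm hV)

/-- The Lie bracket of vector fields acts on functions as the commutator. -/
lemma mvfderiv_mlieBracket {f : M → W} {x : M}
    (hf : ContMDiffAt 𝓘(ℝ, E) 𝓘(ℝ, W) 2 f x) {U V : (y : M) → TangentSpace 𝓘(ℝ, E) y}
    (hU : MDifferentiableAt 𝓘(ℝ, E) 𝓘(ℝ, E).tangent
      (fun y => (⟨y, U y⟩ : TangentBundle 𝓘(ℝ, E) M)) x)
    (hV : MDifferentiableAt 𝓘(ℝ, E) 𝓘(ℝ, E).tangent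
      (fun y => (⟨y, V y⟩ : TangentBundle 𝓘(ℝ, E) M)) x) :
    mvfderiv 𝓘(ℝ, E) f x (VectorField.mlieBracket 𝓘(ℝ, E) U V x) =
      mvfderiv 𝓘(ℝ, E) (fun y => mvfderiv 𝓘(ℝ, E) f y (V y)) x (U x) -
        mvfderiv 𝓘(ℝ, E) (fun y => mvfderiv 𝓘(ℝ, E) f y (U y)) x (V x) := by
  set f' := f ∘ (extChartAt 𝓘(ℝ, E) x).symm with hf'
  set p := extChartAt 𝓘(ℝ, E) x x with hp
  set U' : E → E := fun z => VectorField.mpullbackWithin 𝓘(ℝ, E) 𝓘(ℝ, E)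
      (extChartAt 𝓘(ℝ, E) x).symm U (Set.range 𝓘(ℝ, E)) z with hU'
  set V' : E → E := fun z => VectorField.mpullbackWithin 𝓘(ℝ, E) 𝓘(ℝ, E)
      (extChartAt 𝓘(ℝ, E) x).symm V (Set.range 𝓘(ℝ, E)) z with hV'
  have hUd : DifferentiableAt ℝ U' p := differentiableAt_mpullbackWithin_symm hU
  have hVd : DifferentiableAt ℝ V' p := differentiableAt_mpullbackWithin_symm hV
  have hUx : U' p = U x := mpullbackWithin_extChartAt_symm_self U x
  have hVx : V' p = V x := mpullbackWithin_extChartAt_symm_self V x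
  have hf2 : ContDiffAt ℝ 2 f' p := contDiffAt_comp_extChartAt_symm (n := 2) hf
  have hf1 : DifferentiableAt ℝ (fderiv ℝ f') p :=
    (hf2.fderiv_right (m := 1) le_rfl).differentiableAt one_ne_zero
  -- The derivative of the preferred chart at its own centre is the identity of the model fibre, so
  -- the pull-back in the definition of the bracket disappears.
  have hbr : (VectorField.mlieBracket 𝓘(ℝ, E) U V x : E) =
      fderiv ℝ V' p (U' p) - fderiv ℝ U' p (V' p) := by
    have h : (VectorField.mlieBracket 𝓘(ℝ, E) U V x : E) =
        VectorField.lieBracketWithin (E := E) ℝ U' V'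
          ((extChartAt 𝓘(ℝ, E) x).symm ⁻¹' Set.univ ∩ Set.range 𝓘(ℝ, E)) p :=
      inverse_apply_of_eq_id (E := E) mfderiv_extChartAt_self _
    rw [h, VectorField.lieBracketWithin, Set.preimage_univ, Set.univ_inter,
      ModelWithCorners.range_eq_univ, fderivWithin_univ, fderivWithin_univ]
  -- In the chart, `v(Zf) = D²f(v, Z) + Df(DZ v)`. The Hessian terms cancel in the commutator by
  -- symmetry.
  have hd {Z : (y : M) → TangentSpace 𝓘(ℝ, E) y} {Z' : E → E} (hZd : DifferentiableAt ℝ Z' p)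
      (hZ : MDifferentiableAt 𝓘(ℝ, E) 𝓘(ℝ, E).tangent
        (fun y => (⟨y, Z y⟩ : TangentBundle 𝓘(ℝ, E) M)) x)
      (h : (fun y => mvfderiv 𝓘(ℝ, E) f y (Z y)) ∘ (extChartAt 𝓘(ℝ, E) x).symm =ᶠ[𝓝 p]
        fun z => fderiv ℝ f' z (Z' z)) (v : TangentSpace 𝓘(ℝ, E) x) :
      mvfderiv 𝓘(ℝ, E) (fun y => mvfderiv 𝓘(ℝ, E) f y (Z y)) x v =
        fderiv ℝ (fderiv ℝ f') p v (Z' p) + fderiv ℝ f' p (fderiv ℝ Z' p v) := by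
    rw [mvfderiv_eq_fderiv (mdifferentiableAt_mvfderiv_vectorField hf hZ), h.fderiv_eq,
      fderiv_clm_apply hf1 hZd]
    exact add_comm _ _
  rw [mvfderiv_eq_fderiv (hf.mdifferentiableAt (by simp)), hbr,
    hd hVd hV (mvfderiv_vectorField_comp_symm hf V), hd hUd hU (mvfderiv_vectorField_comp_symm hf U),
    map_sub, ← hUx, ← hVx]
  have hsymm : fderiv ℝ (fderiv ℝ f') p (U' p) (V' p) = fderiv ℝ (fderiv ℝ f') p (V' p) (U' p) :=
    (hf2.isSymmSndFDerivAt (by simp)).eq _ _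
  rw [hsymm]
  abel

end ManifoldCalculus

/-! ### Mixed derivatives of functions on a product -/

section MixedDerivatives

variable {E : Type*} [NormedAddCommGroup E] [NormedSpace ℝ E]
  {F : Type*} [NormedAddCommGroup F] [NormedSpace ℝ F]
  {M : Type*} [TopologicalSpace M] [ChartedSpace E M] [IsManifold 𝓘(ℝ, E) ∞ M]
  {N : Type*} [TopologicalSpace N] [ChartedSpace F N] [IsManifold 𝓘(ℝ, F) ∞ N]
  {W : Type*} [NormedAddCommGroup W] [NormedSpace ℝ W]
  {Φ : M → N → W} {x : M} {y : N}

/-- The partial differential of `Φ` in the second variable, as a function of the first. -/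
def partialSnd (Φ : M → N → W) (y : N) (a : M) : F →L[ℝ] W :=
  mvfderiv 𝓘(ℝ, F) (fun b => Φ a b) y

/-- The partial differential of `Φ` in the first variable, as a function of the second. -/
def partialFst (Φ : M → N → W) (x : M) (b : N) : E →L[ℝ] W :=
  mvfderiv 𝓘(ℝ, E) (fun a => Φ a b) x

lemma contDiffAt_comp_extChartAt_symm_prod
    (hΦ : ContMDiffAt (𝓘(ℝ, E).prod 𝓘(ℝ, F)) 𝓘(ℝ, W) 2 (fun p : M × N => Φ p.1 p.2) (x, y)) :
    ContDiffAt ℝ 2 (fun z : E × F => Φ ((extChartAt 𝓘(ℝ, E) x).symm z.1)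
      ((extChartAt 𝓘(ℝ, F) y).symm z.2)) (extChartAt 𝓘(ℝ, E) x x, extChartAt 𝓘(ℝ, F) y y) := by
  rw [← contMDiffAt_iff_contDiffAt]
  have h1 : ContMDiffAt 𝓘(ℝ, E) 𝓘(ℝ, E) 2 (extChartAt 𝓘(ℝ, E) x).symm
      (extChartAt 𝓘(ℝ, E) x x) := by
    have := contMDiffWithinAt_extChartAt_symm_range (I := 𝓘(ℝ, E)) (n := 2) x
      (mem_extChartAt_target x)
    rwa [ModelWithCorners.range_eq_univ, contMDiffWithinAt_univ] at this
  have h2 : ContMDiffAt 𝓘(ℝ, F) 𝓘(ℝ, F) 2 (extChartAt 𝓘(ℝ, F) y).symm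
      (extChartAt 𝓘(ℝ, F) y y) := by
    have := contMDiffWithinAt_extChartAt_symm_range (I := 𝓘(ℝ, F)) (n := 2) y
      (mem_extChartAt_target y)
    rwa [ModelWithCorners.range_eq_univ, contMDiffWithinAt_univ] at this
  have h3 : ContMDiffAt 𝓘(ℝ, E × F) 𝓘(ℝ, E) 2
      (fun z : E × F => (extChartAt 𝓘(ℝ, E) x).symm z.1)
      (extChartAt 𝓘(ℝ, E) x x, extChartAt 𝓘(ℝ, F) y y) :=
    h1.comp (extChartAt 𝓘(ℝ, E) x x, extChartAt 𝓘(ℝ, F) y y) contDiffAt_fst.contMDiffAt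
  have h4 : ContMDiffAt 𝓘(ℝ, E × F) 𝓘(ℝ, F) 2
      (fun z : E × F => (extChartAt 𝓘(ℝ, F) y).symm z.2)
      (extChartAt 𝓘(ℝ, E) x x, extChartAt 𝓘(ℝ, F) y y) :=
    h2.comp (extChartAt 𝓘(ℝ, E) x x, extChartAt 𝓘(ℝ, F) y y) contDiffAt_snd.contMDiffAt
  refine ContMDiffAt.comp (g := fun p : M × N => Φ p.1 p.2) _ ?_ (h3.prodMk h4)
  rwa [extChartAt_to_inv, extChartAt_to_inv]

/-- In product charts the partial differential is the total derivative restricted to one factor.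
Differentiability in the other variable and the symmetry of mixed derivatives are then inherited
from the total second derivative. -/
lemma partialSnd_comp_symm
    (hΦ : ContMDiffAt (𝓘(ℝ, E).prod 𝓘(ℝ, F)) 𝓘(ℝ, W) 2 (fun p : M × N => Φ p.1 p.2) (x, y)) :
    partialSnd (F := F) Φ y ∘ (extChartAt 𝓘(ℝ, E) x).symm
      =ᶠ[𝓝 (extChartAt 𝓘(ℝ, E) x x)]
    fun p => (fderiv ℝ (fun z : E × F => Φ ((extChartAt 𝓘(ℝ, E) x).symm z.1)
      ((extChartAt 𝓘(ℝ, F) y).symm z.2)) (p, extChartAt 𝓘(ℝ, F) y y)).comp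
        (ContinuousLinearMap.inr ℝ E F) := by
  have h1 := (contDiffAt_comp_extChartAt_symm_prod hΦ).eventually (by simp)
  have hc : ContinuousAt (fun p : E => (p, extChartAt 𝓘(ℝ, F) y y)) (extChartAt 𝓘(ℝ, E) x x) := by
    fun_prop
  filter_upwards [hc.eventually h1] with p hp
  have hd := hp.differentiableAt (by simp)
  have hi : HasFDerivAt (fun q : F => (p, q)) (ContinuousLinearMap.inr ℝ E F)
    (extChartAt 𝓘(ℝ, F) y y) := hasFDerivAt_prodMk_right p _
  have hcomp := hd.hasFDerivAt.comp (extChartAt 𝓘(ℝ, F) y y) hi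
  have hm : MDifferentiableAt 𝓘(ℝ, F) 𝓘(ℝ, W)
      (fun b => Φ ((extChartAt 𝓘(ℝ, E) x).symm p) b) y :=
    mdifferentiableAt_iff_comp_extChartAt_symm.mpr hcomp.differentiableAt
  ext v
  exact (mvfderiv_eq_fderiv hm v).trans (congrArg (fun L : F →L[ℝ] W => L v) hcomp.fderiv)

lemma partialFst_comp_symm
    (hΦ : ContMDiffAt (𝓘(ℝ, E).prod 𝓘(ℝ, F)) 𝓘(ℝ, W) 2 (fun p : M × N => Φ p.1 p.2) (x, y)) :
    partialFst (E := E) Φ x ∘ (extChartAt 𝓘(ℝ, F) y).symm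
      =ᶠ[𝓝 (extChartAt 𝓘(ℝ, F) y y)]
    fun q => (fderiv ℝ (fun z : E × F => Φ ((extChartAt 𝓘(ℝ, E) x).symm z.1)
      ((extChartAt 𝓘(ℝ, F) y).symm z.2)) (extChartAt 𝓘(ℝ, E) x x, q)).comp
        (ContinuousLinearMap.inl ℝ E F) := by
  have h1 := (contDiffAt_comp_extChartAt_symm_prod hΦ).eventually (by simp)
  have hc : ContinuousAt (fun q : F => (extChartAt 𝓘(ℝ, E) x x, q)) (extChartAt 𝓘(ℝ, F) y y) := by
    fun_prop
  filter_upwards [hc.eventually h1] with q hq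
  have hd := hq.differentiableAt (by simp)
  have hi : HasFDerivAt (fun p : E => (p, q)) (ContinuousLinearMap.inl ℝ E F)
    (extChartAt 𝓘(ℝ, E) x x) := hasFDerivAt_prodMk_left _ q
  have hcomp := hd.hasFDerivAt.comp (extChartAt 𝓘(ℝ, E) x x) hi
  have hm : MDifferentiableAt 𝓘(ℝ, E) 𝓘(ℝ, W)
      (fun a => Φ a ((extChartAt 𝓘(ℝ, F) y).symm q)) x :=
    mdifferentiableAt_iff_comp_extChartAt_symm.mpr hcomp.differentiableAt
  ext v
  exact (mvfderiv_eq_fderiv hm v).trans (congrArg (fun L : E →L[ℝ] W => L v) hcomp.fderiv)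

/-- The partial derivative of a function of two variables is differentiable in the other. -/
lemma mdifferentiableAt_partialSnd
    (hΦ : ContMDiffAt (𝓘(ℝ, E).prod 𝓘(ℝ, F)) 𝓘(ℝ, W) 2 (fun p : M × N => Φ p.1 p.2) (x, y)) :
    MDifferentiableAt 𝓘(ℝ, E) 𝓘(ℝ, F →L[ℝ] W)
      (partialSnd (F := F) Φ y) x := by
  rw [mdifferentiableAt_iff_comp_extChartAt_symm]
  refine DifferentiableAt.congr_of_eventuallyEq ?_ (partialSnd_comp_symm hΦ)
  have h1 : DifferentiableAt ℝ (fderiv ℝ (fun z : E × F => Φ ((extChartAt 𝓘(ℝ, E) x).symm z.1)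
      ((extChartAt 𝓘(ℝ, F) y).symm z.2))) (extChartAt 𝓘(ℝ, E) x x, extChartAt 𝓘(ℝ, F) y y) :=
    ((contDiffAt_comp_extChartAt_symm_prod hΦ).fderiv_right (m := 1) le_rfl).differentiableAt
      one_ne_zero
  have h2 : DifferentiableAt ℝ (fun p : E => (p, extChartAt 𝓘(ℝ, F) y y))
      (extChartAt 𝓘(ℝ, E) x x) := by fun_prop
  exact (DifferentiableAt.comp (extChartAt 𝓘(ℝ, E) x x) h1 h2).clm_comp
    (differentiableAt_const _)

/-- The partial derivative of a function of two variables is differentiable in the other. -/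
lemma mdifferentiableAt_partialFst
    (hΦ : ContMDiffAt (𝓘(ℝ, E).prod 𝓘(ℝ, F)) 𝓘(ℝ, W) 2 (fun p : M × N => Φ p.1 p.2) (x, y)) :
    MDifferentiableAt 𝓘(ℝ, F) 𝓘(ℝ, E →L[ℝ] W)
      (partialFst (E := E) Φ x) y := by
  rw [mdifferentiableAt_iff_comp_extChartAt_symm]
  refine DifferentiableAt.congr_of_eventuallyEq ?_ (partialFst_comp_symm hΦ)
  have h1 : DifferentiableAt ℝ (fderiv ℝ (fun z : E × F => Φ ((extChartAt 𝓘(ℝ, E) x).symm z.1)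
      ((extChartAt 𝓘(ℝ, F) y).symm z.2))) (extChartAt 𝓘(ℝ, E) x x, extChartAt 𝓘(ℝ, F) y y) :=
    ((contDiffAt_comp_extChartAt_symm_prod hΦ).fderiv_right (m := 1) le_rfl).differentiableAt
      one_ne_zero
  have h2 : DifferentiableAt ℝ (fun q : F => (extChartAt 𝓘(ℝ, E) x x, q))
      (extChartAt 𝓘(ℝ, F) y y) := by fun_prop
  exact (DifferentiableAt.comp (extChartAt 𝓘(ℝ, F) y y) h1 h2).clm_comp
    (differentiableAt_const _)

lemma mvfderiv_clm_apply_const {f : M → F →L[ℝ] W}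
    (hf : MDifferentiableAt 𝓘(ℝ, E) 𝓘(ℝ, F →L[ℝ] W) f x) (v : F) (u : TangentSpace 𝓘(ℝ, E) x) :
    mvfderiv 𝓘(ℝ, E) (fun a => f a v) x u = mvfderiv 𝓘(ℝ, E) f x u v := by
  have hd := mdifferentiableAt_iff_comp_extChartAt_symm.mp hf
  have hd' := hd.clm_apply (differentiableAt_const v)
  have hm : MDifferentiableAt 𝓘(ℝ, E) 𝓘(ℝ, W) (fun a => f a v) x :=
    mdifferentiableAt_iff_comp_extChartAt_symm.mpr hd'
  rw [mvfderiv_eq_fderiv hm, mvfderiv_eq_fderiv hf]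
  have := (hd.hasFDerivAt.clm_apply (hasFDerivAt_const v _)).fderiv
  refine (congrArg (fun L : E →L[ℝ] W => L u) this).trans ?_
  simp only [ContinuousLinearMap.comp_zero, zero_add]
  rfl

/-- Mixed second derivatives commute. -/
lemma mvfderiv_mvfderiv_comm
    (hΦ : ContMDiffAt (𝓘(ℝ, E).prod 𝓘(ℝ, F)) 𝓘(ℝ, W) 2 (fun p : M × N => Φ p.1 p.2) (x, y))
    (u : E) (v : F) :
    mvfderiv 𝓘(ℝ, E) (fun a => partialSnd (F := F) Φ y a v) x u =
      mvfderiv 𝓘(ℝ, F) (fun b => partialFst (E := E) Φ x b u) y v := by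
  set Ψ : E × F → W := fun z => Φ ((extChartAt 𝓘(ℝ, E) x).symm z.1)
      ((extChartAt 𝓘(ℝ, F) y).symm z.2) with hΨ
  set p := extChartAt 𝓘(ℝ, E) x x
  set q := extChartAt 𝓘(ℝ, F) y y
  have hC : ContDiffAt ℝ 2 Ψ (p, q) := contDiffAt_comp_extChartAt_symm_prod hΦ
  have h1 : DifferentiableAt ℝ (fderiv ℝ Ψ) (p, q) :=
    (hC.fderiv_right (m := 1) le_rfl).differentiableAt one_ne_zero
  have e1 := (mvfderiv_clm_apply_const (mdifferentiableAt_partialSnd hΦ) v u).trans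
    (congrArg (fun w : F →L[ℝ] W => w v) (mvfderiv_eq_fderiv (mdifferentiableAt_partialSnd hΦ) u))
  have e2 := (mvfderiv_clm_apply_const (mdifferentiableAt_partialFst hΦ) u v).trans
    (congrArg (fun w : E →L[ℝ] W => w u) (mvfderiv_eq_fderiv (mdifferentiableAt_partialFst hΦ) v))
  rw [(partialSnd_comp_symm hΦ).fderiv_eq] at e1
  rw [(partialFst_comp_symm hΦ).fderiv_eq] at e2
  have d1 : HasFDerivAt (fun p' : E => (fderiv ℝ Ψ (p', q)).comp (ContinuousLinearMap.inr ℝ E F))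
      _ p :=
    (h1.hasFDerivAt.comp p (hasFDerivAt_prodMk_left p q)).clm_comp (hasFDerivAt_const _ p)
  have d2 : HasFDerivAt (fun q' : F => (fderiv ℝ Ψ (p, q')).comp (ContinuousLinearMap.inl ℝ E F))
      _ q :=
    (h1.hasFDerivAt.comp q (hasFDerivAt_prodMk_right p q)).clm_comp (hasFDerivAt_const _ q)
  have hsymm := (hC.isSymmSndFDerivAt (by simp)).eq ((u, 0) : E × F) ((0, v) : E × F)
  refine e1.trans ((Eq.trans ?_ (hsymm.trans ?_)).trans e2.symm)
  · refine (congrArg (fun L : E →L[ℝ] F →L[ℝ] W => L u v) d1.fderiv).trans ?_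
    simp
  · refine Eq.symm ((congrArg (fun L : F →L[ℝ] E →L[ℝ] W => L v u) d2.fderiv).trans ?_)
    simp

/-- The product rule for the application of a family of linear maps to a family of vectors. -/
lemma mvfderiv_clm_apply' {f : M → F →L[ℝ] W} {g : M → F}
    (hf : MDifferentiableAt 𝓘(ℝ, E) 𝓘(ℝ, F →L[ℝ] W) f x)
    (hg : MDifferentiableAt 𝓘(ℝ, E) 𝓘(ℝ, F) g x) (u : TangentSpace 𝓘(ℝ, E) x) :
    mvfderiv 𝓘(ℝ, E) (fun a => f a (g a)) x u =
      mvfderiv 𝓘(ℝ, E) f x u (g x) + f x (mvfderiv 𝓘(ℝ, E) g x u) := by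
  have hfd := mdifferentiableAt_iff_comp_extChartAt_symm.mp hf
  have hgd := mdifferentiableAt_iff_comp_extChartAt_symm.mp hg
  have hd' := hfd.clm_apply hgd
  have hm : MDifferentiableAt 𝓘(ℝ, E) 𝓘(ℝ, W) (fun a => f a (g a)) x :=
    mdifferentiableAt_iff_comp_extChartAt_symm.mpr hd'
  rw [mvfderiv_eq_fderiv hm, mvfderiv_eq_fderiv hf, mvfderiv_eq_fderiv hg]
  refine (congrArg (fun L : E →L[ℝ] W => L u) (fderiv_clm_apply hfd hgd)).trans ?_
  have hx : (extChartAt 𝓘(ℝ, E) x).symm (extChartAt 𝓘(ℝ, E) x x) = x := extChartAt_to_inv x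
  simp only [Function.comp_apply, hx]
  exact add_comm _ _

end MixedDerivatives

/-! ### The action of `G` on `G/H` and the projection `𝔤 → T_{eH}(G/H)` -/

section Action

variable {E : Type*} [NormedAddCommGroup E] [NormedSpace ℝ E] [FiniteDimensional ℝ E]
  {G : Type*} [TopologicalSpace G] [ChartedSpace E G] [Group G] [LieGroup 𝓘(ℝ, E) ∞ G]
  {F : Type*} [NormedAddCommGroup F] [NormedSpace ℝ F] [FiniteDimensional ℝ F]
  {H : Subgroup G} [ChartedSpace F (G ⧸ H)] [IsManifold 𝓘(ℝ, F) ∞ (G ⧸ H)]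

variable (H) in
/-- The base point `eH` of `G/H`. -/
abbrev basePoint : G ⧸ H := ((1 : G) : G ⧸ H)

lemma smul_basePoint (g : G) : g • basePoint H = (g : G ⧸ H) := by
  simp [basePoint]

lemma exists_smul_basePoint (x : G ⧸ H) : ∃ g : G, g • basePoint H = x := by
  obtain ⟨g, rfl⟩ := QuotientGroup.mk_surjective x
  exact ⟨g, smul_basePoint g⟩

/-- The action of `G` on `G/H` is smooth. -/
lemma IsPrincipalQuotient.contMDiffSMul (h : IsPrincipalQuotient E F H) :
    ContMDiffSMul 𝓘(ℝ, E) 𝓘(ℝ, F) ∞ G (G ⧸ H) where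
  contMDiff_smul := by
    rintro ⟨g, x⟩
    obtain ⟨U, hU, hxU, s, hs, hsec⟩ := h.exists_section x
    have hsx : ContMDiffAt 𝓘(ℝ, F) 𝓘(ℝ, E) ∞ s x := (hs x hxU).contMDiffAt (hU.mem_nhds hxU)
    -- With a local section `s`, the action is locally `(g, y) ↦ π(g · s(y))`.
    have h1 : ContMDiffAt (𝓘(ℝ, E).prod 𝓘(ℝ, F)) 𝓘(ℝ, E) ∞
        (fun p : G × (G ⧸ H) => p.1 * s p.2) (g, x) :=
      contMDiffAt_fst.mul (ContMDiffAt.comp (g, x) (g := s) hsx contMDiffAt_snd)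
    have h2 : ContMDiffAt (𝓘(ℝ, E).prod 𝓘(ℝ, F)) 𝓘(ℝ, F) ∞
        (fun p : G × (G ⧸ H) => ((p.1 * s p.2 : G) : G ⧸ H)) (g, x) :=
      ContMDiffAt.comp (g, x) (g := fun a : G => (a : G ⧸ H)) (h.contMDiff_mk _) h1
    refine h2.congr_of_eventuallyEq ?_
    filter_upwards [continuous_snd.continuousAt.preimage_mem_nhds (hU.mem_nhds hxU)] with p hp
    conv_lhs => rw [← hsec p.2 hp]
    rfl

lemma dProj_eq_actionField (X : GroupLieAlgebra 𝓘(ℝ, E) G) :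
    (dProj E F H X : F) = actionField (F := F) X (basePoint H) := by
  have h : (fun g : G => g • basePoint H) = fun g : G => (g : G ⧸ H) :=
    funext fun g => smul_basePoint g
  rw [actionField, dProj, h]
  rfl

lemma exists_section_basePoint (h : IsPrincipalQuotient E F H) :
    ∃ s : G ⧸ H → G, ContMDiffAt 𝓘(ℝ, F) 𝓘(ℝ, E) ∞ s (basePoint H) ∧ s (basePoint H) = 1 ∧
      ∀ᶠ y in 𝓝 (basePoint H), ((s y : G) : G ⧸ H) = y := by
  obtain ⟨U, hU, hxU, s, hs, hsec⟩ := h.exists_section (basePoint H)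
  -- Since `s(eH)` lies in `H`, right multiplication by its inverse normalizes the section without
  -- changing cosets.
  refine ⟨fun y => s y * (s (basePoint H))⁻¹,
    ((hs _ hxU).contMDiffAt (hU.mem_nhds hxU)).mul contMDiffAt_const, mul_inv_cancel _, ?_⟩
  filter_upwards [hU.mem_nhds hxU] with y hy
  conv_rhs => rw [← hsec y hy]
  have := hsec _ hxU
  rw [QuotientGroup.eq] at this ⊢
  simpa using this

lemma dProj_surjective (h : IsPrincipalQuotient E F H) : Function.Surjective (dProj E F H) := by
  obtain ⟨s, hs, hs1, hsec⟩ := exists_section_basePoint h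
  intro v
  have h1 : MDifferentiableAt 𝓘(ℝ, E) 𝓘(ℝ, F) (fun g : G => (g : G ⧸ H)) (s (basePoint H)) :=
    (h.contMDiff_mk _).mdifferentiableAt (by simp)
  have h2 := mfderiv_comp_apply (basePoint H) h1 (hs.mdifferentiableAt (by simp)) v
  have h3 : ((fun g : G => (g : G ⧸ H)) ∘ s) =ᶠ[𝓝 (basePoint H)] id := hsec
  have h4 : (mfderiv 𝓘(ℝ, F) 𝓘(ℝ, F) ((fun g : G => (g : G ⧸ H)) ∘ s) (basePoint H) v : F) = v := by
    rw [h3.mfderiv_eq, mfderiv_id]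
    rfl
  -- The equality `s(eH) = 1` is only propositional. Since every tangent space unfolds to the same
  -- model space, values can be compared there after substitution.
  have h5 (a : G) (ha : a = 1) (w : E) :
      (mfderiv 𝓘(ℝ, E) 𝓘(ℝ, F) (fun g : G => (g : G ⧸ H)) a w : F) = dProj E F H w := by
    subst ha; rfl
  exact ⟨(mfderiv 𝓘(ℝ, F) 𝓘(ℝ, E) s (basePoint H) v : E), ((h5 _ hs1 _).symm.trans h2.symm).trans h4⟩

lemma dProj_eq_zero_of_isTangentTo (h : IsPrincipalQuotient E F H)
    {X : GroupLieAlgebra 𝓘(ℝ, E) G} (hX : IsTangentTo H X) : dProj E F H X = 0 := by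
  obtain ⟨γ, hγ, hγ0, hγH, rfl⟩ := hX
  have h1 : MDifferentiableAt 𝓘(ℝ, E) 𝓘(ℝ, F) (fun g : G => (g : G ⧸ H)) (γ 0) :=
    (h.contMDiff_mk _).mdifferentiableAt (by simp)
  have h2 := mfderiv_comp_apply (0 : ℝ) h1 (hγ.contMDiffAt.mdifferentiableAt (by simp)) (1 : ℝ)
  have h3 : ((fun g : G => (g : G ⧸ H)) ∘ γ) = fun _ => basePoint H := by
    funext t
    exact (QuotientGroup.eq.mpr (by simpa using hγH t)).symm
  have h4 : (mfderiv 𝓘(ℝ, ℝ) 𝓘(ℝ, F) ((fun g : G => (g : G ⧸ H)) ∘ γ) 0 (1 : ℝ) : F) = 0 := by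
    rw [h3, mfderiv_const]
    rfl
  have h5 (a : G) (ha : a = 1) (w : E) :
      (mfderiv 𝓘(ℝ, E) 𝓘(ℝ, F) (fun g : G => (g : G ⧸ H)) a w : F) = dProj E F H w := by
    subst ha; rfl
  exact ((h5 _ hγ0 _).symm.trans h2.symm).trans h4

namespace ReductiveDecomposition

variable (D : ReductiveDecomposition E H)

/-- The discarded component lies in `𝔥`, whose vectors are velocities of curves in `H`; the
projection is constant along these. -/
lemma dProj_projection (h : IsPrincipalQuotient E F H) (X : GroupLieAlgebra 𝓘(ℝ, E) G) :
    dProj E F H (D.𝔪.projection D.𝔥 D.isCompl.symm X) = dProj E F H X := by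
  have h1 : X - D.𝔪.projection D.𝔥 D.isCompl.symm X ∈ D.𝔥 :=
    Submodule.sub_projection_mem D.isCompl.symm X
  have h2 := dProj_eq_zero_of_isTangentTo h ((D.mem_𝔥 _).mp h1)
  rw [map_sub, sub_eq_zero] at h2
  exact h2.symm

lemma dProj_bracket (h : IsPrincipalQuotient E F H) (X Y : GroupLieAlgebra 𝓘(ℝ, E) G) :
    dProj E F H (D.bracket X Y) = dProj E F H ⁅X, Y⁆ :=
  D.dProj_projection h _

lemma exists_mem_dProj_eq (h : IsPrincipalQuotient E F H) (v : BaseTangent F H) :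
    ∃ X ∈ D.𝔪, dProj E F H X = v := by
  obtain ⟨X, rfl⟩ := dProj_surjective h v
  exact ⟨_, Submodule.projection_apply_mem _ _, D.dProj_projection h X⟩

end ReductiveDecomposition

end Action

/-! ### Left translations and smoothness of action fields -/

section Translations

variable {E : Type*} [NormedAddCommGroup E] [NormedSpace ℝ E] [FiniteDimensional ℝ E]
  {G : Type*} [TopologicalSpace G] [ChartedSpace E G] [Group G] [LieGroup 𝓘(ℝ, E) ∞ G]
  {F : Type*} [NormedAddCommGroup F] [NormedSpace ℝ F] [FiniteDimensional ℝ F]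
  {H : Subgroup G} [ChartedSpace F (G ⧸ H)] [IsManifold 𝓘(ℝ, F) ∞ (G ⧸ H)]

/-- The vector field `Z` is differentiable at `x`. -/
abbrev IsDiffFieldAt {F : Type*} [NormedAddCommGroup F] [NormedSpace ℝ F]
    {M : Type*} [TopologicalSpace M] [ChartedSpace F M] [IsManifold 𝓘(ℝ, F) ∞ M]
    (Z : (x : M) → TangentSpace 𝓘(ℝ, F) x) (x : M) : Prop :=
  MDifferentiableAt 𝓘(ℝ, F) 𝓘(ℝ, F).tangent (fun y => (⟨y, Z y⟩ : TangentBundle 𝓘(ℝ, F) M)) x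

lemma IsSmoothField.isDiffFieldAt {M : Type*} [TopologicalSpace M] [ChartedSpace F M]
    [IsManifold 𝓘(ℝ, F) ∞ M] {Z : (x : M) → TangentSpace 𝓘(ℝ, F) x} (h : IsSmoothField Z)
    (x : M) : IsDiffFieldAt Z x :=
  (h x).mdifferentiableAt (by simp)

/-- The differential of the left translation `τ_g` of `G/H`. -/
def dTranslate (F : Type*) [NormedAddCommGroup F] [NormedSpace ℝ F] {H : Subgroup G}
    [ChartedSpace F (G ⧸ H)] (g : G) (x : G ⧸ H) : F →L[ℝ] F :=
  mfderiv 𝓘(ℝ, F) 𝓘(ℝ, F) (fun y : G ⧸ H => g • y) x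

/-- The value at `x` of the pull-back of the vector field `Z` by `τ_g`, as a function of `g`. -/
def pulled (Z : (x : G ⧸ H) → TangentSpace 𝓘(ℝ, F) x) (x : G ⧸ H) (g : G) : F :=
  (dTranslate F g x).inverse (Z (g • x))

lemma isDiffFieldAt_mulInvariantVectorField (X : GroupLieAlgebra 𝓘(ℝ, E) G) (g : G) :
    MDifferentiableAt 𝓘(ℝ, E) 𝓘(ℝ, E).tangent
      (fun g => (⟨g, mulInvariantVectorField X g⟩ : TangentBundle 𝓘(ℝ, E) G)) g :=
  have : LieGroup 𝓘(ℝ, E) (minSmoothness ℝ 3) G :=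
    .of_le (n := ∞) (by rw [minSmoothness_of_isRCLikeNormedField]; norm_cast)
  mdifferentiableAt_mulInvariantVectorField (I := 𝓘(ℝ, E)) X

variable (E) in
lemma contMDiff_translate [ContMDiffSMul 𝓘(ℝ, E) 𝓘(ℝ, F) ∞ G (G ⧸ H)] (g : G) :
    ContMDiff 𝓘(ℝ, F) 𝓘(ℝ, F) ∞ (fun y : G ⧸ H => g • y) :=
  (contMDiff_const (I' := 𝓘(ℝ, E)) (c := g)).smul contMDiff_id

lemma contMDiff_orbit [ContMDiffSMul 𝓘(ℝ, E) 𝓘(ℝ, F) ∞ G (G ⧸ H)] (x : G ⧸ H) :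
    ContMDiff 𝓘(ℝ, E) 𝓘(ℝ, F) ∞ (fun g : G => g • x) :=
  contMDiff_id.smul contMDiff_const

lemma dTranslate_one (x : G ⧸ H) : dTranslate F (1 : G) x = ContinuousLinearMap.id ℝ F := by
  have h : (fun y : G ⧸ H => (1 : G) • y) = id := funext fun y => one_smul G y
  ext v
  rw [dTranslate, h]
  exact congrArg (fun L : F →L[ℝ] F => L v) mfderiv_id

variable (E) in
lemma dTranslate_mul [ContMDiffSMul 𝓘(ℝ, E) 𝓘(ℝ, F) ∞ G (G ⧸ H)] (g h : G) (x : G ⧸ H) :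
    dTranslate F (g * h) x = (dTranslate F g (h • x)).comp (dTranslate F h x) := by
  have hc : (fun y : G ⧸ H => (g * h) • y) = (fun y => g • y) ∘ fun y => h • y :=
    funext fun y => mul_smul g h y
  ext v
  rw [dTranslate, hc]
  exact mfderiv_comp_apply x ((contMDiff_translate E g _).mdifferentiableAt (by simp))
    ((contMDiff_translate E h _).mdifferentiableAt (by simp)) v

variable (E) in
lemma isInvertible_dTranslate [ContMDiffSMul 𝓘(ℝ, E) 𝓘(ℝ, F) ∞ G (G ⧸ H)] (g : G) (x : G ⧸ H) : (dTranslate F g x).IsInvertible := by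
  have h1 := dTranslate_mul (F := F) E g⁻¹ g x
  have h2 := dTranslate_mul (F := F) E g g⁻¹ (g • x)
  rw [inv_mul_cancel, dTranslate_one] at h1
  rw [mul_inv_cancel, dTranslate_one, inv_smul_smul] at h2
  exact ContinuousLinearMap.IsInvertible.of_inverse h2.symm h1.symm

variable (E) in
lemma dTranslate_pulled [ContMDiffSMul 𝓘(ℝ, E) 𝓘(ℝ, F) ∞ G (G ⧸ H)] (Z : (x : G ⧸ H) → TangentSpace 𝓘(ℝ, F) x) (x : G ⧸ H) (g : G) :
    dTranslate F g x (pulled Z x g) = Z (g • x) :=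
  (isInvertible_dTranslate E g x).self_apply_inverse _

lemma pulled_one (Z : (x : G ⧸ H) → TangentSpace 𝓘(ℝ, F) x) (x : G ⧸ H) :
    pulled Z x (1 : G) = Z x := by
  have h (y : G ⧸ H) (hy : y = x) : (Z y : F) = Z x := by rw [hy]
  exact (inverse_apply_of_eq_id (dTranslate_one x) _).trans (h _ (one_smul G x))

/-- The value at `x` is the differential of the action map at `(1, x)` applied to `(X, 0)`, so the
field is a composite of smooth maps of tangent bundles. -/
lemma isSmoothField_actionField [ContMDiffSMul 𝓘(ℝ, E) 𝓘(ℝ, F) ∞ G (G ⧸ H)] (X : GroupLieAlgebra 𝓘(ℝ, E) G) :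
    IsSmoothField (actionField (F := F) (H := H) X) := by
  let fv : G ⧸ H → TangentBundle 𝓘(ℝ, E) G := fun _ => TotalSpace.mk' E 1 X
  let fz : G ⧸ H → TangentBundle 𝓘(ℝ, F) (G ⧸ H) := fun x => TotalSpace.mk' F x 0
  have sfv : ContMDiff 𝓘(ℝ, F) 𝓘(ℝ, E).tangent ∞ fv := contMDiff_const
  have sfz : ContMDiff 𝓘(ℝ, F) 𝓘(ℝ, F).tangent ∞ fz := contMDiff_zeroSection _ _
  let F₁ : G ⧸ H → TangentBundle 𝓘(ℝ, E) G × TangentBundle 𝓘(ℝ, F) (G ⧸ H) :=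
    fun x => (fv x, fz x)
  have S₁ : ContMDiff 𝓘(ℝ, F) (𝓘(ℝ, E).tangent.prod 𝓘(ℝ, F).tangent) ∞ F₁ := sfv.prodMk sfz
  let F₂ := (equivTangentBundleProd 𝓘(ℝ, E) G 𝓘(ℝ, F) (G ⧸ H)).symm
  have S₂ : ContMDiff (𝓘(ℝ, E).tangent.prod 𝓘(ℝ, F).tangent) (𝓘(ℝ, E).prod 𝓘(ℝ, F)).tangent ∞ F₂ :=
    contMDiff_equivTangentBundleProd_symm
  have hs : ContMDiff (𝓘(ℝ, E).prod 𝓘(ℝ, F)) 𝓘(ℝ, F) ∞ (fun p : G × (G ⧸ H) => p.1 • p.2) :=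
    ContMDiffSMul.contMDiff_smul
  let F₃ := tangentMap (𝓘(ℝ, E).prod 𝓘(ℝ, F)) 𝓘(ℝ, F) (fun p : G × (G ⧸ H) => p.1 • p.2)
  have S₃ : ContMDiff (𝓘(ℝ, E).prod 𝓘(ℝ, F)).tangent 𝓘(ℝ, F).tangent ∞ F₃ :=
    hs.contMDiff_tangentMap le_rfl
  have S := (S₃.comp S₂).comp S₁
  have hval (x : G ⧸ H) : ((F₃ ∘ F₂) ∘ F₁) x = TotalSpace.mk' F ((1 : G) • x)
      (mfderiv 𝓘(ℝ, E) 𝓘(ℝ, F) (fun g : G => g • x) 1 X : F) := by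
    simp only [Function.comp_apply, tangentMap, F₃, F₂, F₁, fv, fz]
    rw [mfderiv_prod_eq_add_apply (hs.mdifferentiableAt (by simp))]
    refine TotalSpace.ext rfl (heq_of_eq ?_)
    exact (congrArg₂ (fun a b : F => a + b) rfl (map_zero _)).trans (add_zero _)
  have heq (x y : G ⧸ H) (h : y = x) (v : F) : (TotalSpace.mk' F y v : TangentBundle 𝓘(ℝ, F) (G ⧸ H))
      = TotalSpace.mk' F x v := by rw [h]
  have : (fun x => (⟨x, actionField (F := F) (H := H) X x⟩ : TangentBundle 𝓘(ℝ, F) (G ⧸ H)))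
      = (F₃ ∘ F₂) ∘ F₁ := funext fun x => ((hval x).trans (heq x _ (one_smul G x) _)).symm
  rw [IsSmoothField, this]
  exact S

end Translations

/-! ### Lie derivatives along action fields -/

section LieDerivative

variable {E : Type*} [NormedAddCommGroup E] [NormedSpace ℝ E] [FiniteDimensional ℝ E]
  {G : Type*} [TopologicalSpace G] [ChartedSpace E G] [Group G] [LieGroup 𝓘(ℝ, E) ∞ G]
  {F : Type*} [NormedAddCommGroup F] [NormedSpace ℝ F] [FiniteDimensional ℝ F]
  {H : Subgroup G} [ChartedSpace F (G ⧸ H)] [IsManifold 𝓘(ℝ, F) ∞ (G ⧸ H)]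

/-- The differential of the chart around `x`, at the point `y`. -/
def dChart (F : Type*) [NormedAddCommGroup F] [NormedSpace ℝ F]
    {M : Type*} [TopologicalSpace M] [ChartedSpace F M] (x y : M) : F →L[ℝ] F :=
  mvfderiv 𝓘(ℝ, F) (extChartAt 𝓘(ℝ, F) x) y

lemma isInvertible_dChart {M : Type*} [TopologicalSpace M] [ChartedSpace F M]
    [IsManifold 𝓘(ℝ, F) ∞ M] {x y : M} (hy : y ∈ (extChartAt 𝓘(ℝ, F) x).source) :
    (dChart F x y).IsInvertible :=
  isInvertible_mfderiv_extChartAt (I := 𝓘(ℝ, F)) hy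

lemma isInvertible_dChart_self {M : Type*} [TopologicalSpace M] [ChartedSpace F M]
    [IsManifold 𝓘(ℝ, F) ∞ M] (x : M) : (dChart F x x).IsInvertible :=
  isInvertible_dChart (mem_extChartAt_source x)

lemma dChart_injective {M : Type*} [TopologicalSpace M] [ChartedSpace F M]
    [IsManifold 𝓘(ℝ, F) ∞ M] (x : M) : Function.Injective (dChart F x x) :=
  (isInvertible_dChart_self x).injective

/-- The action of `G` in a chart of `G/H` around `x`. -/
def chartAction (F : Type*) [NormedAddCommGroup F] [NormedSpace ℝ F] {H : Subgroup G}
    [ChartedSpace F (G ⧸ H)] (x : G ⧸ H) (g : G) (y : G ⧸ H) : F :=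
  extChartAt 𝓘(ℝ, F) x (g • y)

lemma contMDiffAt_chartAction [ContMDiffSMul 𝓘(ℝ, E) 𝓘(ℝ, F) ∞ G (G ⧸ H)] {x y : G ⧸ H} {g : G}
    (hy : g • y ∈ (extChartAt 𝓘(ℝ, F) x).source) :
    ContMDiffAt (𝓘(ℝ, E).prod 𝓘(ℝ, F)) 𝓘(ℝ, F) 2
      (fun p : G × (G ⧸ H) => chartAction F x p.1 p.2) (g, y) := by
  have h1 : ContMDiffAt (𝓘(ℝ, E).prod 𝓘(ℝ, F)) 𝓘(ℝ, F) 2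
      (fun p : G × (G ⧸ H) => p.1 • p.2) (g, y) :=
    (ContMDiffSMul.contMDiff_smul (n := ∞) (g, y)).of_le (by norm_cast)
  have h2 : ContMDiffAt 𝓘(ℝ, F) 𝓘(ℝ, F) 2 (extChartAt 𝓘(ℝ, F) x) (g • y) := by
    have : IsManifold 𝓘(ℝ, F) 2 (G ⧸ H) := .of_le (n := ∞) (by norm_cast)
    exact contMDiffAt_extChartAt' (by rwa [extChartAt_source] at hy)
  exact ContMDiffAt.comp (g, y) (g := extChartAt 𝓘(ℝ, F) x) h2 h1

lemma mdifferentiableAt_chart {M : Type*} [TopologicalSpace M] [ChartedSpace F M]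
    [IsManifold 𝓘(ℝ, F) ∞ M] {x y : M} (hy : y ∈ (extChartAt 𝓘(ℝ, F) x).source) :
    MDifferentiableAt 𝓘(ℝ, F) 𝓘(ℝ, F) (extChartAt 𝓘(ℝ, F) x) y :=
  mdifferentiableAt_extChartAt (by rwa [extChartAt_source] at hy)

variable (E) in
lemma partialSnd_chartAction [ContMDiffSMul 𝓘(ℝ, E) 𝓘(ℝ, F) ∞ G (G ⧸ H)] {x y : G ⧸ H} {g : G}
    (hy : g • y ∈ (extChartAt 𝓘(ℝ, F) x).source) :
    partialSnd (F := F) (chartAction F x) y g = (dChart F x (g • y)).comp (dTranslate F g y) := by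
  ext v
  exact mvfderiv_comp_apply' y (mdifferentiableAt_chart hy)
    ((contMDiff_translate E g _).mdifferentiableAt (by simp)) v

lemma partialFst_chartAction [ContMDiffSMul 𝓘(ℝ, E) 𝓘(ℝ, F) ∞ G (G ⧸ H)] {x y : G ⧸ H}
    (hy : y ∈ (extChartAt 𝓘(ℝ, F) x).source) (X : GroupLieAlgebra 𝓘(ℝ, E) G) :
    partialFst (E := E) (chartAction F x) 1 y X = dChart F x y (actionField (F := F) X y) := by
  have h := mvfderiv_comp_apply' (g := extChartAt 𝓘(ℝ, F) x) (f := fun g : G => g • y) (1 : G)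
    (mdifferentiableAt_chart (by rwa [one_smul]))
    ((contMDiff_orbit (F := F) y _).mdifferentiableAt (by simp)) X
  have h1 (z : G ⧸ H) (hz : z = y) (v : F) : dChart F x z v = dChart F x y v := by rw [hz]
  exact h.trans (h1 _ (one_smul G y) _)

variable (E) in
lemma eventually_smul_mem_source [ContMDiffSMul 𝓘(ℝ, E) 𝓘(ℝ, F) ∞ G (G ⧸ H)] (x : G ⧸ H) :
    ∀ᶠ g : G in 𝓝 1, g • x ∈ (extChartAt 𝓘(ℝ, F) x).source := by
  have h : ContinuousAt (fun g : G => g • x) 1 :=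
    ((contMDiff_orbit (F := F) (E := E) x).continuous).continuousAt
  refine h.preimage_mem_nhds ?_
  rw [one_smul]
  exact extChartAt_source_mem_nhds (I := 𝓘(ℝ, F)) x

-- Tangent spaces at varying points are identified with `F` through point-dependent charts, so
-- `dTranslate F g x` need not vary continuously with `g`. Composing with one fixed chart makes the
-- family differentiable.
variable (E) in
lemma pulled_eventuallyEq [ContMDiffSMul 𝓘(ℝ, E) 𝓘(ℝ, F) ∞ G (G ⧸ H)] (Z : (x : G ⧸ H) → TangentSpace 𝓘(ℝ, F) x) (x : G ⧸ H) :
    pulled Z x =ᶠ[𝓝 (1 : G)] fun g => (partialSnd (F := F) (chartAction F x) x g).inverse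
      (dChart F x (g • x) (Z (g • x))) := by
  filter_upwards [eventually_smul_mem_source (F := F) E x] with g hg
  have h := isInvertible_dTranslate (F := F) E g x
  rw [partialSnd_chartAction E hg]
  refine (((isInvertible_dChart hg).comp h).inverse_apply_eq.mpr ?_).symm
  exact congrArg (dChart F x (g • x)) (dTranslate_pulled E Z x g).symm

lemma mdifferentiableAt_dChart_field {M : Type*} [TopologicalSpace M] [ChartedSpace F M]
    [IsManifold 𝓘(ℝ, F) ∞ M] {Z : (x : M) → TangentSpace 𝓘(ℝ, F) x} {x : M}
    (hZ : IsDiffFieldAt Z x) :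
    MDifferentiableAt 𝓘(ℝ, F) 𝓘(ℝ, F) (fun y => dChart F x y (Z y)) x := by
  have : IsManifold 𝓘(ℝ, F) 2 M := .of_le (n := ∞) (by norm_cast)
  exact mdifferentiableAt_mvfderiv_vectorField contMDiffAt_extChartAt hZ

lemma mdifferentiableAt_dChart_orbit [ContMDiffSMul 𝓘(ℝ, E) 𝓘(ℝ, F) ∞ G (G ⧸ H)] {Z : (x : G ⧸ H) → TangentSpace 𝓘(ℝ, F) x} {x : G ⧸ H}
    (hZ : IsDiffFieldAt Z x) :
    MDifferentiableAt 𝓘(ℝ, E) 𝓘(ℝ, F) (fun g : G => dChart F x (g • x) (Z (g • x))) 1 := by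
  refine MDifferentiableAt.comp (1 : G) (g := fun y => dChart F x y (Z y)) ?_
    ((contMDiff_orbit (F := F) x _).mdifferentiableAt (by simp))
  rw [one_smul]
  exact mdifferentiableAt_dChart_field hZ

variable (E) in
lemma mdifferentiableAt_pulled [ContMDiffSMul 𝓘(ℝ, E) 𝓘(ℝ, F) ∞ G (G ⧸ H)] {Z : (x : G ⧸ H) → TangentSpace 𝓘(ℝ, F) x} {x : G ⧸ H}
    (hZ : IsDiffFieldAt Z x) :
    MDifferentiableAt 𝓘(ℝ, E) 𝓘(ℝ, F) (pulled Z x) (1 : G) := by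
  refine MDifferentiableAt.congr_of_eventuallyEq ?_ (pulled_eventuallyEq E Z x)
  have hx : (1 : G) • x ∈ (extChartAt 𝓘(ℝ, F) x).source := by
    rw [one_smul]; exact mem_extChartAt_source x
  have h1 : MDifferentiableAt 𝓘(ℝ, E) 𝓘(ℝ, F →L[ℝ] F)
      (partialSnd (F := F) (chartAction F x) x) (1 : G) :=
    mdifferentiableAt_partialSnd (contMDiffAt_chartAction hx)
  have hinv : (partialSnd (F := F) (chartAction F x) x (1 : G)).IsInvertible := by
    rw [partialSnd_chartAction E hx]
    exact (isInvertible_dChart hx).comp (isInvertible_dTranslate E _ x)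
  have h2 : MDifferentiableAt 𝓘(ℝ, E) 𝓘(ℝ, F →L[ℝ] F)
      (fun g : G => (partialSnd (F := F) (chartAction F x) x g).inverse) (1 : G) :=
    MDifferentiableAt.comp (1 : G)
      ((hinv.contDiffAt_map_inverse (n := 1)).differentiableAt one_ne_zero).mdifferentiableAt h1
  exact h2.clm_apply (mdifferentiableAt_dChart_orbit hZ)

/-- The Lie derivative of a vector field along an action field is its Lie bracket with the action
field. -/
lemma mvfderiv_pulled [ContMDiffSMul 𝓘(ℝ, E) 𝓘(ℝ, F) ∞ G (G ⧸ H)] {Z : (x : G ⧸ H) → TangentSpace 𝓘(ℝ, F) x} {x : G ⧸ H}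
    (hZ : IsDiffFieldAt Z x) (X : GroupLieAlgebra 𝓘(ℝ, E) G) :
    mvfderiv 𝓘(ℝ, E) (pulled Z x) (1 : G) X =
      (VectorField.mlieBracket 𝓘(ℝ, F) (actionField X) Z x : F) := by
  have : IsManifold 𝓘(ℝ, F) 2 (G ⧸ H) := .of_le (n := ∞) (by norm_cast)
  have hx : (1 : G) • x ∈ (extChartAt 𝓘(ℝ, F) x).source := by
    rw [one_smul]; exact mem_extChartAt_source x
  have hΘ := contMDiffAt_chartAction (E := E) hx
  have h1 : MDifferentiableAt 𝓘(ℝ, E) 𝓘(ℝ, F →L[ℝ] F)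
      (partialSnd (F := F) (chartAction F x) x) (1 : G) := mdifferentiableAt_partialSnd hΘ
  -- The identity `dτ_g(pulled g) = Z(g x)` is differentiated in the chart. The left side of the
  -- product rule becomes `X^#(Z)`; the derivative of `dτ_g` becomes `Z(X^#)` by symmetry of mixed
  -- derivatives. The remaining term is therefore the bracket.
  have hprod := mvfderiv_clm_apply' h1 (mdifferentiableAt_pulled E hZ) X
  have hev : (fun g : G => partialSnd (F := F) (chartAction F x) x g (pulled Z x g)) =ᶠ[𝓝 1]
      fun g => dChart F x (g • x) (Z (g • x)) := by
    filter_upwards [eventually_smul_mem_source (F := F) E x] with g hg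
    rw [partialSnd_chartAction E hg]
    exact congrArg (dChart F x (g • x)) (dTranslate_pulled E Z x g)
  have hleft : mvfderiv 𝓘(ℝ, E)
      (fun g : G => partialSnd (F := F) (chartAction F x) x g (pulled Z x g)) 1 X =
      mvfderiv 𝓘(ℝ, F) (fun y => dChart F x y (Z y)) x (actionField X x) := by
    rw [mvfderiv_congr hev]
    have hd := mdifferentiableAt_dChart_field hZ
    have hc := mvfderiv_comp_apply' (g := fun y => dChart F x y (Z y)) (f := fun g : G => g • x)
      (1 : G) (by rwa [one_smul]) ((contMDiff_orbit (F := F) x _).mdifferentiableAt (by simp)) X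
    have h1 (z : G ⧸ H) (hz : z = x) (v : F) :
      mvfderiv 𝓘(ℝ, F) (fun y => dChart F x y (Z y)) z v =
        mvfderiv 𝓘(ℝ, F) (fun y => dChart F x y (Z y)) x v := by rw [hz]
    exact hc.trans (h1 _ (one_smul G x) _)
  have hmid : mvfderiv 𝓘(ℝ, E) (partialSnd (F := F) (chartAction F x) x) (1 : G) X
      (pulled Z x 1) =
      mvfderiv 𝓘(ℝ, F) (fun y => dChart F x y (actionField (F := F) X y)) x (Z x) := by
    have hev2 : (fun y => partialFst (E := E) (chartAction F x) 1 y X) =ᶠ[𝓝 x]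
        fun y => dChart F x y (actionField (F := F) X y) := by
      filter_upwards [extChartAt_source_mem_nhds (I := 𝓘(ℝ, F)) x] with y hy
      exact partialFst_chartAction hy X
    rw [pulled_one, ← mvfderiv_congr hev2]
    exact (mvfderiv_clm_apply_const h1 (Z x : F) X).symm.trans (mvfderiv_mvfderiv_comm hΘ X (Z x))
  have hright : partialSnd (F := F) (chartAction F x) x (1 : G)
      (mvfderiv 𝓘(ℝ, E) (pulled Z x) (1 : G) X) =
      dChart F x x (mvfderiv 𝓘(ℝ, E) (pulled Z x) (1 : G) X) := by
    rw [partialSnd_chartAction E hx, dTranslate_one, one_smul]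
    rfl
  have hbr := mvfderiv_mlieBracket (f := extChartAt 𝓘(ℝ, F) x) (x := x) contMDiffAt_extChartAt
    ((isSmoothField_actionField (F := F) (H := H) X).isDiffFieldAt x) hZ
  refine dChart_injective x ?_
  rw [hleft, hmid, hright] at hprod
  refine (eq_sub_of_add_eq' hprod.symm).trans hbr.symm

end LieDerivative

/-! ### Brackets of action fields and the adjoint action -/

section ActionFields

variable {E : Type*} [NormedAddCommGroup E] [NormedSpace ℝ E] [FiniteDimensional ℝ E]
  {G : Type*} [TopologicalSpace G] [ChartedSpace E G] [Group G] [LieGroup 𝓘(ℝ, E) ∞ G]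
  {F : Type*} [NormedAddCommGroup F] [NormedSpace ℝ F] [FiniteDimensional ℝ F]
  {H : Subgroup G} [ChartedSpace F (G ⧸ H)] [IsManifold 𝓘(ℝ, F) ∞ (G ⧸ H)]
  [ContMDiffSMul 𝓘(ℝ, E) 𝓘(ℝ, F) ∞ G (G ⧸ H)]

lemma mvfderiv_comp_orbit {W : Type*} [NormedAddCommGroup W] [NormedSpace ℝ W] {ψ : G ⧸ H → W}
    {x : G ⧸ H} (hψ : MDifferentiableAt 𝓘(ℝ, F) 𝓘(ℝ, W) ψ x) (X : GroupLieAlgebra 𝓘(ℝ, E) G) :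
    mvfderiv 𝓘(ℝ, E) (fun g : G => ψ (g • x)) 1 X = mvfderiv 𝓘(ℝ, F) ψ x (actionField X x) := by
  have hc := mvfderiv_comp_apply' (g := ψ) (f := fun g : G => g • x)
    (1 : G) (by rwa [one_smul]) ((contMDiff_orbit (F := F) x _).mdifferentiableAt (by simp)) X
  have h1 (z : G ⧸ H) (hz : z = x) (v : F) :
    mvfderiv 𝓘(ℝ, F) ψ z v = mvfderiv 𝓘(ℝ, F) ψ x v := by rw [hz]
  exact hc.trans (h1 _ (one_smul G x) _)

/-- At the base point, the bracket of action fields is minus the bracket of the Lie algebra. -/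
lemma mlieBracket_actionField (X Y : GroupLieAlgebra 𝓘(ℝ, E) G) :
    (VectorField.mlieBracket 𝓘(ℝ, F) (actionField X) (actionField Y) (basePoint H) : F) =
      - actionField (F := F) ⁅X, Y⁆ (basePoint H) := by
  have : IsManifold 𝓘(ℝ, F) 2 (G ⧸ H) := .of_le (n := ∞) (by norm_cast)
  set o : G ⧸ H := basePoint H
  have ho := mem_extChartAt_source (I := 𝓘(ℝ, F)) o
  let P : G → F := fun a => chartAction F o a o
  have hP {a : G} (ha : a • o ∈ (extChartAt 𝓘(ℝ, F) o).source) :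
      ContMDiffAt 𝓘(ℝ, E) 𝓘(ℝ, F) 2 P a := by
    have h1 : ContMDiffAt 𝓘(ℝ, E) (𝓘(ℝ, E).prod 𝓘(ℝ, F)) 2 (fun a : G => (a, o)) a :=
      contMDiffAt_id.prodMk contMDiffAt_const
    exact ContMDiffAt.comp a (g := fun p : G × (G ⧸ H) => chartAction F o p.1 p.2)
      (contMDiffAt_chartAction ha) h1
  have h1o : (1 : G) • o ∈ (extChartAt 𝓘(ℝ, F) o).source := by rwa [one_smul]
  -- The function `P(ab)` links both kinds of fields: differentiating in `b` at `1` gives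
  -- left-invariant fields on `G`, differentiating in `a` at `1` gives action fields. Exchanging the
  -- derivatives reverses the order of the two fields, which produces the sign.
  let Φ : G → G → F := fun a b => P (a * b)
  have hΦ : ContMDiffAt (𝓘(ℝ, E).prod 𝓘(ℝ, E)) 𝓘(ℝ, F) 2
      (fun p : G × G => Φ p.1 p.2) ((1 : G), (1 : G)) := by
    refine ContMDiffAt.comp (g := P) ((1 : G), (1 : G)) ?_
      (contMDiffAt_fst.mul (contMDiffAt_snd (n := 2)))
    exact hP (by simp [o])
  have hsnd (V : GroupLieAlgebra 𝓘(ℝ, E) G) :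
      (fun a => partialSnd (F := E) Φ 1 a V) =ᶠ[𝓝 1]
        fun a => mvfderiv 𝓘(ℝ, E) P a (mulInvariantVectorField V a) := by
    filter_upwards [eventually_smul_mem_source (F := F) E o] with a ha
    have hc := mvfderiv_comp_apply' (g := P) (f := fun b : G => a * b) (1 : G)
      (by rw [mul_one]; exact (hP ha).mdifferentiableAt (by simp))
      ((contMDiff_mul_left (n := ∞) (a := a) _).mdifferentiableAt (by simp)) V
    have h1 (z : G) (hz : z = a) (v : E) :
      mvfderiv 𝓘(ℝ, E) P z v = mvfderiv 𝓘(ℝ, E) P a v := by rw [hz]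
    exact hc.trans (h1 _ (mul_one a) _)
  have hfst (V : GroupLieAlgebra 𝓘(ℝ, E) G) :
      (fun b => partialFst (E := E) Φ 1 b V) =ᶠ[𝓝 1]
        fun b => dChart F o (b • o) (actionField (F := F) V (b • o)) := by
    filter_upwards [eventually_smul_mem_source (F := F) E o] with b hb
    rw [← partialFst_chartAction hb]
    have : (fun a => Φ a b) = fun a => chartAction F o a (b • o) := by
      funext a
      simp only [Φ, P, chartAction, mul_smul]
    rw [partialFst, partialFst, this]
  have hfield (V : GroupLieAlgebra 𝓘(ℝ, E) G) : IsDiffFieldAt (actionField (F := F) V) o :=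
    (isSmoothField_actionField (H := H) V).isDiffFieldAt o
  have hsecond (U V : GroupLieAlgebra 𝓘(ℝ, E) G) :
      mvfderiv 𝓘(ℝ, E) (fun a => mvfderiv 𝓘(ℝ, E) P a (mulInvariantVectorField V a)) 1
        (mulInvariantVectorField U (1 : G)) =
      mvfderiv 𝓘(ℝ, F) (fun y => dChart F o y (actionField (F := F) U y)) o
        (actionField V o) := by
    have hU : (mulInvariantVectorField U (1 : G) : E) = U := by
      rw [mulInvariantVectorField]
      have h : (fun x : G => 1 * x) = id := funext one_mul
      rw [h]
      exact congrArg (fun L : E →L[ℝ] E => L U) mfderiv_id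
    rw [← mvfderiv_congr (hsnd V), ← mvfderiv_comp_orbit (mdifferentiableAt_dChart_field (hfield U)),
      ← mvfderiv_congr (hfst U)]
    exact (congrArg (mvfderiv 𝓘(ℝ, E) (fun a => partialSnd (F := E) Φ 1 a V) 1) hU).trans
      (mvfderiv_mvfderiv_comm hΦ U V)
  have hG := mvfderiv_mlieBracket (hP h1o) (isDiffFieldAt_mulInvariantVectorField X 1)
    (isDiffFieldAt_mulInvariantVectorField Y 1)
  have hM := mvfderiv_mlieBracket (f := extChartAt 𝓘(ℝ, F) o) (x := o) contMDiffAt_extChartAt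
    (hfield X) (hfield Y)
  rw [hsecond, hsecond] at hG
  have hPo := partialFst_chartAction ho ⁅X, Y⁆
  refine dChart_injective (F := F) o (hM.trans (Eq.trans ?_
    (map_neg (dChart F o o) (actionField (F := F) ⁅X, Y⁆ o : F)).symm))
  have hneg {a b c d : F} (h1 : c = a - b) (h2 : c = d) : b - a = -d := by
    rw [← h2, h1, neg_sub]
  exact hneg hG hPo

/-- Differentiate `(g a g⁻¹)(g x) = g(a x)` in `a` at `1`. -/
lemma actionField_Ad (g : G) (X : GroupLieAlgebra 𝓘(ℝ, E) G) (x : G ⧸ H) :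
    (actionField (F := F) (Ad g X) (g • x) : F) = dTranslate F g x (actionField (F := F) X x) := by
  have hconj : ContMDiff 𝓘(ℝ, E) 𝓘(ℝ, E) ∞ (fun a : G => g * a * g⁻¹) :=
    (contMDiff_const.mul contMDiff_id).mul contMDiff_const
  have h1 : g * 1 * g⁻¹ = 1 := by simp
  have hc := mfderiv_comp_apply (g := fun b : G => b • (g • x)) (1 : G)
    ((contMDiff_orbit (F := F) (g • x) _).mdifferentiableAt (by simp))
    ((hconj 1).mdifferentiableAt (by simp)) X
  have hc' := mfderiv_comp_apply (g := fun y : G ⧸ H => g • y) (f := fun a : G => a • x) (1 : G)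
    ((contMDiff_translate E g _).mdifferentiableAt (by simp))
    ((contMDiff_orbit (F := F) x _).mdifferentiableAt (by simp)) X
  have he : (fun b : G => b • (g • x)) ∘ (fun a : G => g * a * g⁻¹) =
      (fun y : G ⧸ H => g • y) ∘ fun a : G => a • x := by
    funext a
    simp [mul_smul]
  rw [he] at hc
  have t1 (b : G) (hb : b = 1) (v : E) :
      (mfderiv 𝓘(ℝ, E) 𝓘(ℝ, F) (fun b : G => b • (g • x)) b v : F) =
        mfderiv 𝓘(ℝ, E) 𝓘(ℝ, F) (fun b : G => b • (g • x)) 1 v := by rw [hb]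
  have t2 (y : G ⧸ H) (hy : y = x) (v : F) : dTranslate F g y v = dTranslate F g x v := by rw [hy]
  exact ((t1 _ h1 _).symm.trans hc.symm).trans (hc'.trans (t2 _ (one_smul G x) _))

lemma mpullback_actionField_Ad (g : G) (X : GroupLieAlgebra 𝓘(ℝ, E) G) :
    VectorField.mpullback 𝓘(ℝ, F) 𝓘(ℝ, F) (fun y : G ⧸ H => g • y) (actionField (Ad g X)) =
      actionField X := by
  funext x
  exact (isInvertible_dTranslate (F := F) E g x).inverse_apply_eq.mpr (actionField_Ad g X x)

end ActionFields

/-! ### The canonical connection at the base point -/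

section CanonicalConnection

variable {E : Type*} [NormedAddCommGroup E] [NormedSpace ℝ E] [FiniteDimensional ℝ E]
  {G : Type*} [TopologicalSpace G] [ChartedSpace E G] [Group G] [LieGroup 𝓘(ℝ, E) ∞ G]
  {F : Type*} [NormedAddCommGroup F] [NormedSpace ℝ F] [FiniteDimensional ℝ F]
  {H : Subgroup G} [ChartedSpace F (G ⧸ H)] [IsManifold 𝓘(ℝ, F) ∞ (G ⧸ H)]

/-- The pull-back of the vector field `Z` by `τ_g`. -/
def pullField (g : G) (Z : (x : G ⧸ H) → TangentSpace 𝓘(ℝ, F) x) (x : G ⧸ H) :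
    TangentSpace 𝓘(ℝ, F) x :=
  VectorField.mpullback 𝓘(ℝ, F) 𝓘(ℝ, F) (fun y : G ⧸ H => g • y) Z x

lemma pullField_smul (g : G) (f : G ⧸ H → ℝ) (Z : (x : G ⧸ H) → TangentSpace 𝓘(ℝ, F) x) :
    pullField g (f • Z) = (fun x => f (g • x)) • pullField g Z :=
  VectorField.mpullback_smul

lemma pullField_add (g : G) (Z Z' : (x : G ⧸ H) → TangentSpace 𝓘(ℝ, F) x) :
    pullField g (Z + Z') = pullField g Z + pullField g Z' :=
  VectorField.mpullback_add

lemma cov_smul_apply {M : Type*} [TopologicalSpace M] [ChartedSpace F M] [IsManifold 𝓘(ℝ, F) ∞ M]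
    (cov : CovariantDerivative 𝓘(ℝ, F) F (TangentSpace 𝓘(ℝ, F) : M → Type _))
    {Z : (x : M) → TangentSpace 𝓘(ℝ, F) x} {f : M → ℝ} {x : M} (hZ : IsDiffFieldAt Z x)
    (hf : MDifferentiableAt 𝓘(ℝ, F) 𝓘(ℝ, ℝ) f x) (u : TangentSpace 𝓘(ℝ, F) x) :
    cov (f • Z) x u = f x • cov Z x u + mvfderiv 𝓘(ℝ, F) f x u • Z x := by
  rw [cov.isCovariantDerivativeOn.leibniz hZ hf]
  rfl

lemma exists_actionField_basePoint (hq : IsPrincipalQuotient E F H)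
    (D : ReductiveDecomposition E H) (v : TangentSpace 𝓘(ℝ, F) (basePoint H)) :
    ∃ X ∈ D.𝔪, actionField X (basePoint H) = v := by
  obtain ⟨X, hX, h⟩ := D.exists_mem_dProj_eq hq v
  exact ⟨X, hX, (dProj_eq_actionField X).symm.trans h⟩

/-- Both `∇_V(fZ)` and `[V, fZ]` contain the term `(Vf)Z`, which cancels. The two operations can
thus be compared on a single field with the given value. -/
lemma tensorialAt_cov_sub_mlieBracket
    (cov : CovariantDerivative 𝓘(ℝ, F) F (TangentSpace 𝓘(ℝ, F) : G ⧸ H → Type _))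
    (V : (x : G ⧸ H) → TangentSpace 𝓘(ℝ, F) x) (x : G ⧸ H) :
    TensorialAt 𝓘(ℝ, F) F (fun Z : (x : G ⧸ H) → TangentSpace 𝓘(ℝ, F) x =>
      cov Z x (V x) - VectorField.mlieBracket 𝓘(ℝ, F) V Z x) x where
  smul hf hZ := by
    simp [cov.isCovariantDerivativeOn.leibniz hZ hf, VectorField.mlieBracket_smul_right hf hZ]
    module
  add hZ hZ' := by
    have : IsManifold 𝓘(ℝ, F) 2 (G ⧸ H) := .of_le (n := ∞) (by norm_cast)
    simp [cov.isCovariantDerivativeOn.add hZ hZ', VectorField.mlieBracket_add_right hZ hZ']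
    abel

variable [ContMDiffSMul 𝓘(ℝ, E) 𝓘(ℝ, F) ∞ G (G ⧸ H)]

/-- At the base point, the canonical connection is given by the Lie bracket with action fields
of elements of `𝔪`. -/
lemma IsCanonicalConnection.cov_basePoint (hq : IsPrincipalQuotient E F H)
    {D : ReductiveDecomposition E H}
    {cov : CovariantDerivative 𝓘(ℝ, F) F (TangentSpace 𝓘(ℝ, F) : G ⧸ H → Type _)}
    (h : IsCanonicalConnection D cov) {X : GroupLieAlgebra 𝓘(ℝ, E) G} (hX : X ∈ D.𝔪)
    {Z : (x : G ⧸ H) → TangentSpace 𝓘(ℝ, F) x} (hZ : IsDiffFieldAt Z (basePoint H)) :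
    cov Z (basePoint H) (actionField X (basePoint H)) =
      VectorField.mlieBracket 𝓘(ℝ, F) (actionField X) Z (basePoint H) := by
  -- By tensoriality `Z` may be replaced by `Y^#` with `Y ∈ 𝔪`. There the defining equation reads
  -- `∇⁰_{X^#} Y^# = -dπ[X, Y] = [X^#, Y^#]`.
  obtain ⟨Y, hY, hYZ⟩ := exists_actionField_basePoint hq D (Z (basePoint H))
  have h1 := (tensorialAt_cov_sub_mlieBracket cov (actionField X) (basePoint H)).pointwise hZ
    ((isSmoothField_actionField (H := H) Y).isDiffFieldAt _) hYZ.symm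
  refine sub_eq_zero.mp (h1.trans (sub_eq_zero.mpr ?_))
  have h2 := eq_neg_of_add_eq_zero_left (h.mul_eq_zero X hX Y hY)
  rw [D.dProj_bracket hq] at h2
  exact h2.trans ((congrArg (fun v : F => -v) (dProj_eq_actionField ⁅X, Y⁆)).trans
    (mlieBracket_actionField X Y).symm)

end CanonicalConnection

/-! ### The canonical connection as a Lie bracket at every point -/

section Invariance

variable {E : Type*} [NormedAddCommGroup E] [NormedSpace ℝ E] [FiniteDimensional ℝ E]
  {G : Type*} [TopologicalSpace G] [ChartedSpace E G] [Group G] [LieGroup 𝓘(ℝ, E) ∞ G]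
  {F : Type*} [NormedAddCommGroup F] [NormedSpace ℝ F] [FiniteDimensional ℝ F]
  {H : Subgroup G} [ChartedSpace F (G ⧸ H)] [IsManifold 𝓘(ℝ, F) ∞ (G ⧸ H)]

variable (E) in
lemma isDiffFieldAt_pullField [ContMDiffSMul 𝓘(ℝ, E) 𝓘(ℝ, F) ∞ G (G ⧸ H)]
    {Z : (x : G ⧸ H) → TangentSpace 𝓘(ℝ, F) x} {g : G} {x : G ⧸ H}
    (hZ : IsDiffFieldAt Z (g • x)) : IsDiffFieldAt (pullField g Z) x :=
  MDifferentiableAt.mpullback_vectorField (n := ∞) hZ (contMDiff_translate E g x)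
    (isInvertible_dTranslate (F := F) E g x) (by norm_cast)

variable (E) in
lemma dTranslate_pullField [ContMDiffSMul 𝓘(ℝ, E) 𝓘(ℝ, F) ∞ G (G ⧸ H)]
    (Z : (x : G ⧸ H) → TangentSpace 𝓘(ℝ, F) x) (g : G) (x : G ⧸ H) :
    dTranslate F g x (pullField g Z x) = Z (g • x) :=
  dTranslate_pulled E Z x g

variable (E) in
lemma pullField_mlieBracket [ContMDiffSMul 𝓘(ℝ, E) 𝓘(ℝ, F) ∞ G (G ⧸ H)]
    {Y Z : (x : G ⧸ H) → TangentSpace 𝓘(ℝ, F) x} {g : G} {x : G ⧸ H}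
    (hY : IsDiffFieldAt Y (g • x)) (hZ : IsDiffFieldAt Z (g • x)) :
    pullField g (VectorField.mlieBracket 𝓘(ℝ, F) Y Z) x =
      VectorField.mlieBracket 𝓘(ℝ, F) (pullField g Y) (pullField g Z) x := by
  have : IsManifold 𝓘(ℝ, F) (minSmoothness ℝ 3) (G ⧸ H) :=
    .of_le (n := ∞) (by rw [minSmoothness_of_isRCLikeNormedField]; norm_cast)
  exact VectorField.mpullback_mlieBracket (n := ∞) hY hZ (contMDiff_translate E g x)
    (by rw [minSmoothness_of_isRCLikeNormedField]; norm_cast)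

variable [ContMDiffSMul 𝓘(ℝ, E) 𝓘(ℝ, F) ∞ G (G ⧸ H)]

/-- The action fields span every tangent space. -/
lemma exists_actionField (hq : IsPrincipalQuotient E F H) (D : ReductiveDecomposition E H)
    (x : G ⧸ H) (v : TangentSpace 𝓘(ℝ, F) x) :
    ∃ X : GroupLieAlgebra 𝓘(ℝ, E) G, actionField X x = v := by
  obtain ⟨g, rfl⟩ := exists_smul_basePoint x
  obtain ⟨X, -, hX⟩ := exists_actionField_basePoint hq D
    ((dTranslate F g (basePoint H)).inverse (v : F))
  refine ⟨Ad g X, (actionField_Ad g X _).trans ?_⟩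
  exact (congrArg (dTranslate F g (basePoint H)) hX).trans
    ((isInvertible_dTranslate (F := F) E g _).self_apply_inverse _)

/-- There are smooth vector fields with prescribed values. -/
lemma exists_isSmoothField (hq : IsPrincipalQuotient E F H) (D : ReductiveDecomposition E H)
    (x : G ⧸ H) (v : TangentSpace 𝓘(ℝ, F) x) :
    ∃ Z : (x : G ⧸ H) → TangentSpace 𝓘(ℝ, F) x, IsSmoothField Z ∧ Z x = v := by
  obtain ⟨X, hX⟩ := exists_actionField hq D x v
  exact ⟨_, isSmoothField_actionField X, hX⟩

/-- The invariance of a connection extends to all differentiable vector fields. -/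
lemma IsInvariantConnection.dTranslate_cov (hq : IsPrincipalQuotient E F H)
    (D : ReductiveDecomposition E H)
    {cov : CovariantDerivative 𝓘(ℝ, F) F (TangentSpace 𝓘(ℝ, F) : G ⧸ H → Type _)}
    (h : IsInvariantConnection cov) {Z : (x : G ⧸ H) → TangentSpace 𝓘(ℝ, F) x} {g : G}
    {x : G ⧸ H} (hZ : IsDiffFieldAt Z (g • x)) (u : F) :
    dTranslate F g x (cov (pullField g Z) x u) = cov Z (g • x) (dTranslate F g x u) := by
  have ht : MDifferentiableAt 𝓘(ℝ, F) 𝓘(ℝ, F) (fun y : G ⧸ H => g • y) x :=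
    (contMDiff_translate E g _).mdifferentiableAt (by simp)
  -- The invariance defect is tensorial because `d(f ∘ τ_g) = df ∘ dτ_g` makes the derivative terms
  -- cancel, so testing it on smooth fields suffices. The subtraction is performed in the model
  -- space `F`.
  have hten : TensorialAt 𝓘(ℝ, F) F (fun Z : (x : G ⧸ H) → TangentSpace 𝓘(ℝ, F) x =>
      Sub.sub (α := F) (dTranslate F g x (cov (pullField g Z) x u))
        (cov Z (g • x) (dTranslate F g x u))) (g • x) := by
    constructor
    · intro f Z hf hZ
      have hf' : MDifferentiableAt 𝓘(ℝ, F) 𝓘(ℝ, ℝ) (fun y : G ⧸ H => f (g • y)) x :=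
        MDifferentiableAt.comp x hf ht
      have e1 : cov (pullField g (f • Z)) x u =
          f (g • x) • cov (pullField g Z) x u +
            (mvfderiv 𝓘(ℝ, F) f (g • x) (dTranslate F g x u)) • pullField g Z x := by
        rw [pullField_smul]
        exact (cov_smul_apply cov (isDiffFieldAt_pullField E hZ) hf' u).trans
          (congrArg (fun a : ℝ => f (g • x) • (cov (pullField g Z) x u : F) +
            a • (pullField g Z x : F)) (mvfderiv_comp_apply' (g := f) x hf ht u))
      have e2 : cov (f • Z) (g • x) (dTranslate F g x u) =
          f (g • x) • cov Z (g • x) (dTranslate F g x u) +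
            (mvfderiv 𝓘(ℝ, F) f (g • x) (dTranslate F g x u)) • Z (g • x) := by
        rw [cov.isCovariantDerivativeOn.leibniz hZ hf]
        rfl
      have e3 (a b : ℝ) (v w : F) : dTranslate F g x (a • v + b • w) =
          a • dTranslate F g x v + b • dTranslate F g x w := by simp
      have e4 {a b : ℝ} {p q r s t z : F} (h1 : p = a • r + b • t) (h2 : q = a • s + b • z)
          (h3 : t = z) : p - q = a • (r - s) := by
        rw [h1, h2, h3, smul_sub]; abel
      exact e4 ((congrArg (dTranslate F g x) e1).trans (e3 _ _ _ _)) e2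
        (dTranslate_pullField E Z g x)
    · intro Z Z' hZ hZ'
      have e1 : cov (pullField g (Z + Z')) x u =
          cov (pullField g Z) x u + cov (pullField g Z') x u := by
        rw [pullField_add, cov.isCovariantDerivativeOn.add (isDiffFieldAt_pullField E hZ)
          (isDiffFieldAt_pullField E hZ')]
        rfl
      have e2 : cov (Z + Z') (g • x) (dTranslate F g x u) =
          cov Z (g • x) (dTranslate F g x u) + cov Z' (g • x) (dTranslate F g x u) := by
        rw [cov.isCovariantDerivativeOn.add hZ hZ']
        rfl
      have e4 {p q r s t z : F} (h1 : p = r + t) (h2 : q = s + z) :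
          p - q = (r - s) + (t - z) := by
        rw [h1, h2]; abel
      exact e4 ((congrArg (dTranslate F g x) e1).trans (map_add _ _ _)) e2
  obtain ⟨Z', hZ', hZZ'⟩ := exists_isSmoothField hq D (g • x) (Z (g • x))
  have h0 := hten.pointwise hZ (hZ'.isDiffFieldAt _) hZZ'.symm
  exact sub_eq_zero.mp (h0.trans (sub_eq_zero.mpr (h g Z' hZ' x u)))

/-- The canonical connection is given by the Lie bracket with suitable action fields. -/
lemma IsCanonicalConnection.exists_cov_eq_mlieBracket (hq : IsPrincipalQuotient E F H)
    {D : ReductiveDecomposition E H}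
    {cov : CovariantDerivative 𝓘(ℝ, F) F (TangentSpace 𝓘(ℝ, F) : G ⧸ H → Type _)}
    (h : IsCanonicalConnection D cov) (x : G ⧸ H) (u : TangentSpace 𝓘(ℝ, F) x) :
    ∃ X : GroupLieAlgebra 𝓘(ℝ, E) G, actionField X x = u ∧
      ∀ Z : (x : G ⧸ H) → TangentSpace 𝓘(ℝ, F) x, IsDiffFieldAt Z x →
        cov Z x u = VectorField.mlieBracket 𝓘(ℝ, F) (actionField X) Z x := by
  obtain ⟨g, rfl⟩ := exists_smul_basePoint x
  have hinv := isInvertible_dTranslate (F := F) E g (basePoint H)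
  obtain ⟨X, hXm, hX⟩ := exists_actionField_basePoint hq D
    ((dTranslate F g (basePoint H)).inverse (u : F))
  have hu : dTranslate F g (basePoint H) (actionField (F := F) X (basePoint H)) = u :=
    (congrArg (dTranslate F g (basePoint H)) hX).trans (hinv.self_apply_inverse _)
  -- The translation `τ_g` carries the base-point identity to `g • eH` and turns `X^#` into `(Ad g
  -- X)^#`.
  refine ⟨Ad g X, (actionField_Ad g X _).trans hu, fun Z hZ => ?_⟩
  have h1 := h.invariant.dTranslate_cov hq D hZ (actionField (F := F) X (basePoint H))
  have h2 := h.cov_basePoint hq hXm (isDiffFieldAt_pullField E hZ)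
  have h3 := pullField_mlieBracket E
    ((isSmoothField_actionField (F := F) (H := H) (Ad g X)).isDiffFieldAt (g • basePoint H)) hZ
  have h4 : pullField g (actionField (F := F) (H := H) (Ad g X)) = actionField X :=
    mpullback_actionField_Ad g X
  rw [h4] at h3
  have h5 := dTranslate_pullField E
    (VectorField.mlieBracket 𝓘(ℝ, F) (actionField (Ad g X)) Z) g (basePoint H)
  refine ((congrArg (fun v : F => (cov Z (g • basePoint H) v : F)) hu.symm).trans h1.symm).trans ?_
  exact (congrArg (dTranslate F g (basePoint H)) (h2.trans h3.symm)).trans h5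

end Invariance

/-! ### Product rule for a fixed bilinear map -/

section Bilinear

variable {E : Type*} [NormedAddCommGroup E] [NormedSpace ℝ E]
  {F : Type*} [NormedAddCommGroup F] [NormedSpace ℝ F] [FiniteDimensional ℝ F]
  {M : Type*} [TopologicalSpace M] [ChartedSpace E M] [IsManifold 𝓘(ℝ, E) ∞ M]
  {W : Type*} [NormedAddCommGroup W] [NormedSpace ℝ W]

lemma mvfderiv_bilinear (B : F →ₗ[ℝ] F →ₗ[ℝ] W) {p q : M → F} {x : M}
    (hp : MDifferentiableAt 𝓘(ℝ, E) 𝓘(ℝ, F) p x) (hq : MDifferentiableAt 𝓘(ℝ, E) 𝓘(ℝ, F) q x)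
    (u : TangentSpace 𝓘(ℝ, E) x) :
    mvfderiv 𝓘(ℝ, E) (fun a => B (p a) (q a)) x u =
      B (mvfderiv 𝓘(ℝ, E) p x u) (q x) + B (p x) (mvfderiv 𝓘(ℝ, E) q x u) := by
  let B' : F →L[ℝ] F →L[ℝ] W :=
    (LinearMap.toContinuousLinearMap.toLinearMap ∘ₗ B).toContinuousLinearMap
  have hB' (a b : F) : B a b = B' a b := rfl
  have hd : MDifferentiableAt 𝓘(ℝ, F) 𝓘(ℝ, F →L[ℝ] W) B' (p x) :=
    B'.differentiableAt.mdifferentiableAt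
  have hBp : MDifferentiableAt 𝓘(ℝ, E) 𝓘(ℝ, F →L[ℝ] W) (fun a => B' (p a)) x :=
    MDifferentiableAt.comp x hd hp
  have h1 := mvfderiv_clm_apply' hBp hq u
  have h2 : mvfderiv 𝓘(ℝ, E) (fun a => B' (p a)) x u = B' (mvfderiv 𝓘(ℝ, E) p x u) := by
    refine (mvfderiv_comp_apply' (g := B') x hd hp u).trans ?_
    have := B'.mfderiv_eq (x := p x)
    exact congrArg (fun L : F →L[ℝ] F →L[ℝ] W => L (mvfderiv 𝓘(ℝ, E) p x u)) this
  rw [h2] at h1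
  exact h1

end Bilinear

/-! ### Invariant tensors are parallel for the canonical connection -/

section InvariantTensors

variable {E : Type*} [NormedAddCommGroup E] [NormedSpace ℝ E] [FiniteDimensional ℝ E]
  {G : Type*} [TopologicalSpace G] [ChartedSpace E G] [Group G] [LieGroup 𝓘(ℝ, E) ∞ G]
  {F : Type*} [NormedAddCommGroup F] [NormedSpace ℝ F] [FiniteDimensional ℝ F]
  {H : Subgroup G} [ChartedSpace F (G ⧸ H)] [IsManifold 𝓘(ℝ, F) ∞ (G ⧸ H)]

/-- A twice-covariant tensor field on `G/H` is invariant under left translations. -/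
def IsInvariantForm
    (K : (x : G ⧸ H) → TangentSpace 𝓘(ℝ, F) x →ₗ[ℝ] TangentSpace 𝓘(ℝ, F) x →ₗ[ℝ] ℝ) : Prop :=
  ∀ (g : G) (x : G ⧸ H) (u v : F), K (g • x) (dTranslate F g x u) (dTranslate F g x v) = K x u v

/-- A field of multiplications on the tangent spaces of `G/H` is invariant under left
translations. -/
def IsInvariantMul
    (α : (x : G ⧸ H) → TangentSpace 𝓘(ℝ, F) x →ₗ[ℝ] TangentSpace 𝓘(ℝ, F) x →ₗ[ℝ]
      TangentSpace 𝓘(ℝ, F) x) : Prop :=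
  ∀ (g : G) (x : G ⧸ H) (u v : F),
    α (g • x) (dTranslate F g x u) (dTranslate F g x v) = dTranslate F g x (α x u v)

variable [ContMDiffSMul 𝓘(ℝ, E) 𝓘(ℝ, F) ∞ G (G ⧸ H)]

/-- Invariance gives `K(Y, Z)(g x) = K_x(pulled Y, pulled Z)`, which moves all dependence on `g`
into two curves of vectors in one tangent space. The Leibniz rule for the Lie derivative is then
that of the fixed bilinear map `K x`. -/
lemma IsInvariantForm.mvfderiv_actionField
    {K : (x : G ⧸ H) → TangentSpace 𝓘(ℝ, F) x →ₗ[ℝ] TangentSpace 𝓘(ℝ, F) x →ₗ[ℝ] ℝ}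
    (hK : IsInvariantForm K) {Y Z : (x : G ⧸ H) → TangentSpace 𝓘(ℝ, F) x} {x : G ⧸ H}
    (hY : IsDiffFieldAt Y x) (hZ : IsDiffFieldAt Z x)
    (hf : MDifferentiableAt 𝓘(ℝ, F) 𝓘(ℝ, ℝ) (fun y => K y (Y y) (Z y)) x)
    (X : GroupLieAlgebra 𝓘(ℝ, E) G) :
    mvfderiv 𝓘(ℝ, F) (fun y => K y (Y y) (Z y)) x (actionField X x) =
      K x (VectorField.mlieBracket 𝓘(ℝ, F) (actionField X) Y x) (Z x) +
        K x (Y x) (VectorField.mlieBracket 𝓘(ℝ, F) (actionField X) Z x) := by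
  have h1 : (fun g : G => K (g • x) (Y (g • x)) (Z (g • x))) =
      fun g => K x (pulled (F := F) Y x g) (pulled (F := F) Z x g) := by
    funext g
    have := hK g x (pulled (F := F) Y x g) (pulled (F := F) Z x g)
    rw [dTranslate_pulled E, dTranslate_pulled E] at this
    exact this
  have h2 := mvfderiv_comp_orbit hf X
  rw [h1] at h2
  have h3 := mvfderiv_bilinear (F := F) (K x) (mdifferentiableAt_pulled E hY)
    (mdifferentiableAt_pulled E hZ) X
  rw [mvfderiv_pulled hY, mvfderiv_pulled hZ, pulled_one, pulled_one] at h3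
  exact h2.symm.trans h3

lemma IsInvariantMul.mlieBracket_actionField
    {α : (x : G ⧸ H) → TangentSpace 𝓘(ℝ, F) x →ₗ[ℝ] TangentSpace 𝓘(ℝ, F) x →ₗ[ℝ]
      TangentSpace 𝓘(ℝ, F) x}
    (hα : IsInvariantMul α) {Y Z : (x : G ⧸ H) → TangentSpace 𝓘(ℝ, F) x} {x : G ⧸ H}
    (hY : IsDiffFieldAt Y x) (hZ : IsDiffFieldAt Z x)
    (hf : IsDiffFieldAt (fun y => α y (Y y) (Z y)) x) (X : GroupLieAlgebra 𝓘(ℝ, E) G) :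
    VectorField.mlieBracket 𝓘(ℝ, F) (actionField X) (fun y => α y (Y y) (Z y)) x =
      α x (VectorField.mlieBracket 𝓘(ℝ, F) (actionField X) Y x) (Z x) +
        α x (Y x) (VectorField.mlieBracket 𝓘(ℝ, F) (actionField X) Z x) := by
  have h1 : pulled (fun y => α y (Y y) (Z y)) x =
      fun g : G => (α x (pulled (F := F) Y x g) (pulled (F := F) Z x g) : F) := by
    funext g
    have := hα g x (pulled (F := F) Y x g) (pulled (F := F) Z x g)
    rw [dTranslate_pulled E, dTranslate_pulled E] at this
    exact (isInvertible_dTranslate (F := F) E g x).inverse_apply_eq.mpr this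
  have h2 := mvfderiv_pulled hf X
  rw [h1] at h2
  have h3 := mvfderiv_bilinear (F := F) (W := F) (α x) (mdifferentiableAt_pulled E hY)
    (mdifferentiableAt_pulled E hZ) X
  rw [mvfderiv_pulled hY, mvfderiv_pulled hZ, pulled_one, pulled_one] at h3
  exact h2.symm.trans h3

variable {D : ReductiveDecomposition E H}
  {cov : CovariantDerivative 𝓘(ℝ, F) F (TangentSpace 𝓘(ℝ, F) : G ⧸ H → Type _)}

/-- Invariant forms are parallel for the canonical connection. -/
lemma IsCanonicalConnection.mvfderiv_form (h : IsCanonicalConnection D cov)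
    (hq : IsPrincipalQuotient E F H)
    {K : (x : G ⧸ H) → TangentSpace 𝓘(ℝ, F) x →ₗ[ℝ] TangentSpace 𝓘(ℝ, F) x →ₗ[ℝ] ℝ}
    (hK : IsInvariantForm K) {Y Z : (x : G ⧸ H) → TangentSpace 𝓘(ℝ, F) x} {x : G ⧸ H}
    (hY : IsDiffFieldAt Y x) (hZ : IsDiffFieldAt Z x)
    (hf : MDifferentiableAt 𝓘(ℝ, F) 𝓘(ℝ, ℝ) (fun y => K y (Y y) (Z y)) x)
    (u : TangentSpace 𝓘(ℝ, F) x) :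
    mvfderiv 𝓘(ℝ, F) (fun y => K y (Y y) (Z y)) x u =
      K x (cov Y x u) (Z x) + K x (Y x) (cov Z x u) := by
  obtain ⟨X, rfl, hX⟩ := h.exists_cov_eq_mlieBracket hq x u
  rw [hX Y hY, hX Z hZ, hK.mvfderiv_actionField hY hZ hf]

/-- Invariant multiplications are parallel for the canonical connection. -/
lemma IsCanonicalConnection.cov_mul (h : IsCanonicalConnection D cov)
    (hq : IsPrincipalQuotient E F H)
    {α : (x : G ⧸ H) → TangentSpace 𝓘(ℝ, F) x →ₗ[ℝ] TangentSpace 𝓘(ℝ, F) x →ₗ[ℝ]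
      TangentSpace 𝓘(ℝ, F) x}
    (hα : IsInvariantMul α) {Y Z : (x : G ⧸ H) → TangentSpace 𝓘(ℝ, F) x} {x : G ⧸ H}
    (hY : IsDiffFieldAt Y x) (hZ : IsDiffFieldAt Z x)
    (hf : IsDiffFieldAt (fun y => α y (Y y) (Z y)) x) (u : TangentSpace 𝓘(ℝ, F) x) :
    cov (fun y => α y (Y y) (Z y)) x u = α x (cov Y x u) (Z x) + α x (Y x) (cov Z x u) := by
  obtain ⟨X, rfl, hX⟩ := h.exists_cov_eq_mlieBracket hq x u
  rw [hX Y hY, hX Z hZ, hX _ hf, hα.mlieBracket_actionField hY hZ hf]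

end InvariantTensors

/-! ### The difference tensor of two metric connections -/

section Difference

variable {F : Type*} [NormedAddCommGroup F] [NormedSpace ℝ F] [FiniteDimensional ℝ F]
  {M : Type*} [TopologicalSpace M] [ChartedSpace F M] [IsManifold 𝓘(ℝ, F) ∞ M]
  (cov cov0 : CovariantDerivative 𝓘(ℝ, F) F (TangentSpace 𝓘(ℝ, F) : M → Type _))

/-- The difference tensor `(u, v) ↦ ∇_u v - ∇⁰_u v` of two connections. -/
def differenceMul (x : M) : TangentSpace 𝓘(ℝ, F) x →ₗ[ℝ] TangentSpace 𝓘(ℝ, F) x →ₗ[ℝ]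
    TangentSpace 𝓘(ℝ, F) x :=
  LinearMap.mk₂ ℝ (fun u v => cov.difference cov0 x v u) (fun _ _ _ => map_add _ _ _)
    (fun _ _ _ => map_smul _ _ _) (fun _ _ _ => by rw [map_add]; rfl)
    (fun _ _ _ => by rw [map_smul]; rfl)

variable {cov cov0}

lemma differenceMul_apply {x : M} {Z : (x : M) → TangentSpace 𝓘(ℝ, F) x} (hZ : IsDiffFieldAt Z x)
    (u : TangentSpace 𝓘(ℝ, F) x) :
    differenceMul cov cov0 x u (Z x) = cov Z x u - cov0 Z x u := by
  have h := IsCovariantDerivativeOn.difference_apply cov.isCovariantDerivativeOnUniv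
    cov0.isCovariantDerivativeOnUniv (x := x) (hx := Set.mem_univ x) hZ
  exact congrArg (fun L : F →L[ℝ] F => L u) h

variable (F) in
lemma exists_isDiffFieldAt (x : M) (v : TangentSpace 𝓘(ℝ, F) x) :
    ∃ Z : (x : M) → TangentSpace 𝓘(ℝ, F) x, IsDiffFieldAt Z x ∧ Z x = v :=
  ⟨FiberBundle.extend F v, FiberBundle.mdifferentiableAt_extend .., by simp⟩

lemma differenceMul_sub_swap (h : cov.torsion = 0) (x : M) (u v : TangentSpace 𝓘(ℝ, F) x) :
    differenceMul cov cov0 x u v - differenceMul cov cov0 x v u = -cov0.torsion x u v := by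
  have : IsManifold 𝓘(ℝ, F) 2 M := .of_le (n := ∞) (by norm_cast)
  obtain ⟨U, hU, rfl⟩ := exists_isDiffFieldAt F x u
  obtain ⟨V, hV, rfl⟩ := exists_isDiffFieldAt F x v
  rw [differenceMul_apply hV, differenceMul_apply hU, cov0.torsion_apply hU hV,
    ← cov.torsion_eq_zero_iff.mp h hU hV]
  abel

variable [RiemannianBundle (fun x : M => TangentSpace 𝓘(ℝ, F) x)]
  [IsContMDiffRiemannianBundle 𝓘(ℝ, F) ∞ F (fun x : M => TangentSpace 𝓘(ℝ, F) x)]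

omit [IsContMDiffRiemannianBundle 𝓘(ℝ, F) ∞ F (fun x : M => TangentSpace 𝓘(ℝ, F) x)] in
lemma inner_differenceMul
    (h : ∀ (x : M) (Y Z : (x : M) → TangentSpace 𝓘(ℝ, F) x), IsDiffFieldAt Y x →
      IsDiffFieldAt Z x → ∀ u : TangentSpace 𝓘(ℝ, F) x,
      mvfderiv 𝓘(ℝ, F) (fun y => (inner ℝ (Y y) (Z y) : ℝ)) x u =
        inner ℝ (cov Y x u) (Z x) + inner ℝ (Y x) (cov Z x u))
    (h0 : ∀ (x : M) (Y Z : (x : M) → TangentSpace 𝓘(ℝ, F) x), IsDiffFieldAt Y x →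
      IsDiffFieldAt Z x → ∀ u : TangentSpace 𝓘(ℝ, F) x,
      mvfderiv 𝓘(ℝ, F) (fun y => (inner ℝ (Y y) (Z y) : ℝ)) x u =
        inner ℝ (cov0 Y x u) (Z x) + inner ℝ (Y x) (cov0 Z x u))
    (x : M) (u v w : TangentSpace 𝓘(ℝ, F) x) :
    inner ℝ (differenceMul cov cov0 x u v) w = -inner ℝ v (differenceMul cov cov0 x u w) := by
  obtain ⟨V, hV, rfl⟩ := exists_isDiffFieldAt F x v
  obtain ⟨W, hW, rfl⟩ := exists_isDiffFieldAt F x w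
  rw [differenceMul_apply hV, differenceMul_apply hW, inner_sub_left, inner_sub_right]
  linarith [h x V W hV hW u, h0 x V W hV hW u]

lemma mdifferentiableAt_inner {x : M} {Y Z : (x : M) → TangentSpace 𝓘(ℝ, F) x}
    (hY : IsDiffFieldAt Y x) (hZ : IsDiffFieldAt Z x) :
    MDifferentiableAt 𝓘(ℝ, F) 𝓘(ℝ, ℝ) (fun y => (inner ℝ (Y y) (Z y) : ℝ)) x :=
  have : IsContMDiffRiemannianBundle 𝓘(ℝ, F) 1 F (fun x : M => TangentSpace 𝓘(ℝ, F) x) :=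
    .of_le (n := ∞) (by norm_cast)
  MDifferentiableAt.inner_bundle (F := F) hY hZ

/-- `IsLeviCivita` tests compatibility on globally smooth fields only; tensoriality of the defect
extends it to fields differentiable at one point. -/
lemma tensorialAt_metric_defect {x : M} {Z : (x : M) → TangentSpace 𝓘(ℝ, F) x}
    (hZ : IsDiffFieldAt Z x) (u : TangentSpace 𝓘(ℝ, F) x) :
    TensorialAt 𝓘(ℝ, F) F (fun Y : (x : M) → TangentSpace 𝓘(ℝ, F) x =>
      mvfderiv 𝓘(ℝ, F) (fun y => (inner ℝ (Y y) (Z y) : ℝ)) x u -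
        (inner ℝ (cov Y x u) (Z x) + inner ℝ (Y x) (cov Z x u))) x where
  smul {f Y} hf hY := by
    have h1 : (fun y => (inner ℝ ((f • Y) y) (Z y) : ℝ)) = fun y => f y * inner ℝ (Y y) (Z y) :=
      funext fun y => real_inner_smul_left (Y y) (Z y) (f y)
    have h2 := congrArg (fun L : F →L[ℝ] ℝ => L u)
      (mvfderiv_fun_mul hf (mdifferentiableAt_inner hY hZ))
    have h3 := cov_smul_apply cov hY hf u
    have h4 : (inner ℝ ((f • Y) x) (cov Z x u) : ℝ) = f x * inner ℝ (Y x) (cov Z x u) :=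
      real_inner_smul_left (Y x) _ (f x)
    rw [h1, h3, h4, inner_add_left, real_inner_smul_left, real_inner_smul_left]
    have h5 {p q r s t a b : ℝ} (h : p = a * q + r * b) :
        p - (a * s + b * r + a * t) = a • (q - (s + t)) := by
      rw [h, smul_eq_mul]; ring
    exact h5 h2
  add {Y Y'} hY hY' := by
    have h1 : (fun y => (inner ℝ ((Y + Y') y) (Z y) : ℝ)) =
        fun y => inner ℝ (Y y) (Z y) + inner ℝ (Y' y) (Z y) :=
      funext fun y => inner_add_left (Y y) (Y' y) (Z y)
    have h2 := congrArg (fun L : F →L[ℝ] ℝ => L u)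
      (mvfderiv_fun_add (mdifferentiableAt_inner hY hZ) (mdifferentiableAt_inner hY' hZ))
    have h3 : cov (Y + Y') x u = cov Y x u + cov Y' x u :=
      congrArg (fun L : F →L[ℝ] F => L u) (cov.isCovariantDerivativeOn.add hY hY')
    have h4 : (inner ℝ ((Y + Y') x) (cov Z x u) : ℝ) =
        inner ℝ (Y x) (cov Z x u) + inner ℝ (Y' x) (cov Z x u) :=
      inner_add_left (Y x) (Y' x) _
    rw [h1, h3, h4, inner_add_left]
    have h5 {p q r s t s' t' : ℝ} (h : p = q + r) :
        p - (s + s' + (t + t')) = q - (s + t) + (r - (s' + t')) := by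
      rw [h]; ring
    exact h5 h2

/-- The compatibility of the Levi-Civita connection with the metric extends to differentiable
vector fields. -/
lemma IsLeviCivita.mvfderiv_inner (h : IsLeviCivita cov)
    (hsmooth : ∀ (x : M) (v : TangentSpace 𝓘(ℝ, F) x),
      ∃ Z : (x : M) → TangentSpace 𝓘(ℝ, F) x, IsSmoothField Z ∧ Z x = v)
    (x : M) (Y Z : (x : M) → TangentSpace 𝓘(ℝ, F) x) (hY : IsDiffFieldAt Y x)
    (hZ : IsDiffFieldAt Z x) (u : TangentSpace 𝓘(ℝ, F) x) :
    mvfderiv 𝓘(ℝ, F) (fun y => (inner ℝ (Y y) (Z y) : ℝ)) x u =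
      inner ℝ (cov Y x u) (Z x) + inner ℝ (Y x) (cov Z x u) := by
  obtain ⟨X, hX, rfl⟩ := hsmooth x u
  obtain ⟨Y', hY', hYY'⟩ := hsmooth x (Y x)
  obtain ⟨Z', hZ', hZZ'⟩ := hsmooth x (Z x)
  have h1 := (tensorialAt_metric_defect (cov := cov) hZ (X x)).pointwise hY
    (hY'.isDiffFieldAt x) hYY'.symm
  have h2 := (tensorialAt_metric_defect (cov := cov) (hY'.isDiffFieldAt x) (X x)).pointwise hZ
    (hZ'.isDiffFieldAt x) hZZ'.symm
  have h3 := h.metric X Z' Y' hX hZ' hY' x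
  have h4 : (fun y => (inner ℝ (Z y) (Y' y) : ℝ)) = fun y => inner ℝ (Y' y) (Z y) :=
    funext fun y => real_inner_comm _ _
  rw [h3, sub_self, h4, real_inner_comm, real_inner_comm _ (Z x), add_comm] at h2
  exact sub_eq_zero.mp (h1.trans h2)

end Difference

/-! ### The difference of two curvature tensors -/

section DifferenceCurvature

/-- The algebraic curvature `[α_u, α_v] - α_{α_u v - α_v u}` of a multiplication. -/
def mulCurvature {V : Type*} [AddCommGroup V] [Module ℝ V] (α : V →ₗ[ℝ] V →ₗ[ℝ] V) :
    V →ₗ[ℝ] V →ₗ[ℝ] V →ₗ[ℝ] V :=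
  LinearMap.mk₂ ℝ (fun u v => α u ∘ₗ α v - α v ∘ₗ α u - α (α u v - α v u))
    (fun u u' v => by ext w; simp; abel)
    (fun c u v => by ext w; simp [smul_sub])
    (fun u v v' => by ext w; simp; abel)
    (fun c u v => by ext w; simp [smul_sub])

lemma mulCurvature_apply {V : Type*} [AddCommGroup V] [Module ℝ V] (α : V →ₗ[ℝ] V →ₗ[ℝ] V)
    (u v w : V) :
    mulCurvature α u v w = α u (α v w) - α v (α u w) - α (α u v - α v u) w := rfl

variable {F : Type*} [NormedAddCommGroup F] [NormedSpace ℝ F] [FiniteDimensional ℝ F]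
  {M : Type*} [TopologicalSpace M] [ChartedSpace F M] [IsManifold 𝓘(ℝ, F) ∞ M]
  {cov cov0 : CovariantDerivative 𝓘(ℝ, F) F (TangentSpace 𝓘(ℝ, F) : M → Type _)}

/-- The curvature tensor is defined through extensions that are smooth only near `x`. A bump
function, for which the Hausdorff hypothesis is used, makes them global without changing germs. -/
lemma exists_isSmoothField_eq_extend [T2Space M] (x : M) (v : TangentSpace 𝓘(ℝ, F) x) :
    ∃ Z : (x : M) → TangentSpace 𝓘(ℝ, F) x, IsSmoothField Z ∧
      ∀ᶠ y in 𝓝 x, (FiberBundle.extend F v : (x : M) → TangentSpace 𝓘(ℝ, F) x) y = Z y := by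
  obtain ⟨s, hs, hsmooth⟩ := FiberBundle.exists_contMDiffOn_extend (k := ∞) 𝓘(ℝ, F) F v
  obtain ⟨u, hus, hu, hxu⟩ := mem_nhds_iff.mp hs
  obtain ⟨f, -, hf⟩ := (SmoothBumpFunction.nhds_basis_tsupport (I := 𝓘(ℝ, F)) x).mem_iff.mp
    (hu.mem_nhds hxu)
  refine ⟨(f : M → ℝ) • (FiberBundle.extend F v : (x : M) → TangentSpace 𝓘(ℝ, F) x),
    ContMDiffOn.smul_section_of_tsupport f.contMDiff.contMDiffOn hu hf (hsmooth.mono hus), ?_⟩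
  filter_upwards [f.eventuallyEq_one] with y hy
  simp [hy]

lemma isSmoothField_cov [cov.ContMDiffCovariantDerivative ∞]
    {Y Z : (x : M) → TangentSpace 𝓘(ℝ, F) x} (hY : IsSmoothField Y) (hZ : IsSmoothField Z) :
    IsSmoothField (fun y => cov Z y (Y y)) := by
  have h1 := (CovariantDerivative.ContMDiffCovariantDerivative.contMDiff (cov := cov) (k := ∞)).contMDiff
    (σ := Z) (hZ.contMDiffOn)
  rw [contMDiffOn_univ] at h1
  exact ContMDiff.clm_bundle_apply h1 hY

lemma curvatureField_congr [cov.ContMDiffCovariantDerivative ∞] {x : M}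
    {X Y Z X' Y' Z' : (x : M) → TangentSpace 𝓘(ℝ, F) x}
    (hX' : IsSmoothField X') (hY' : IsSmoothField Y') (hZ' : IsSmoothField Z')
    (hX : ∀ᶠ y in 𝓝 x, X y = X' y) (hY : ∀ᶠ y in 𝓝 x, Y y = Y' y)
    (hZ : ∀ᶠ y in 𝓝 x, Z y = Z' y) :
    curvatureField cov X Y Z x = curvatureField cov X' Y' Z' x := by
  have hdiff {U U' : (x : M) → TangentSpace 𝓘(ℝ, F) x} {y : M} (hU' : IsSmoothField U')
      (h : ∀ᶠ z in 𝓝 y, U z = U' z) : IsDiffFieldAt U y :=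
    (hU'.isDiffFieldAt y).congr_of_eventuallyEq (h.mono fun z hz => by simp only [hz])
  have hcov {U U' : (x : M) → TangentSpace 𝓘(ℝ, F) x} {y : M} (hU' : IsSmoothField U')
      (h : ∀ᶠ z in 𝓝 y, U z = U' z) : cov U y = cov U' y :=
    cov.isCovariantDerivativeOnUniv.congr_of_eventuallyEq (hdiff hU' h) (hU'.isDiffFieldAt y)
      Filter.univ_mem h
  have hcov2 {U U' : (x : M) → TangentSpace 𝓘(ℝ, F) x} (hU' : IsSmoothField U')
      (h : ∀ᶠ z in 𝓝 x, U z = U' z) :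
      cov (fun y => cov Z y (U y)) x = cov (fun y => cov Z' y (U' y)) x := by
    refine hcov (isSmoothField_cov hU' hZ') ?_
    filter_upwards [h, hZ.eventually_nhds] with y hy hzy
    rw [hy, hcov hZ' hzy]
  rw [curvatureField, curvatureField, hcov2 hX' hX, hcov2 hY' hY, hcov hZ' hZ, hX.self_of_nhds,
    hY.self_of_nhds, Filter.EventuallyEq.mlieBracket_vectorField_eq hX hY]

/-- The difference of the curvature tensors of a torsionfree connection and a connection for which
the difference tensor is parallel. -/
lemma curvatureField_sub [cov.ContMDiffCovariantDerivative ∞] [cov0.ContMDiffCovariantDerivative ∞]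
    (htor : cov.torsion = 0)
    (hpar : ∀ (Y Z : (x : M) → TangentSpace 𝓘(ℝ, F) x), IsSmoothField Y → IsSmoothField Z →
      ∀ (x : M) (u : TangentSpace 𝓘(ℝ, F) x),
      cov0 (fun y => differenceMul cov cov0 y (Y y) (Z y)) x u =
        differenceMul cov cov0 x (cov0 Y x u) (Z x) + differenceMul cov cov0 x (Y x) (cov0 Z x u))
    {X Y Z : (x : M) → TangentSpace 𝓘(ℝ, F) x} (hX : IsSmoothField X) (hY : IsSmoothField Y)
    (hZ : IsSmoothField Z) (x : M) :
    curvatureField cov X Y Z x - curvatureField cov0 X Y Z x =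
      mulCurvature (differenceMul cov cov0 x) (X x) (Y x) (Z x) := by
  have : IsManifold 𝓘(ℝ, F) 2 M := .of_le (n := ∞) (by norm_cast)
  set α := differenceMul cov cov0 with hα
  have hdiff {U : (x : M) → TangentSpace 𝓘(ℝ, F) x} (hU : IsSmoothField U) (y : M)
      (u : TangentSpace 𝓘(ℝ, F) y) : cov U y u = cov0 U y u + α y u (U y) := by
    rw [hα, differenceMul_apply (hU.isDiffFieldAt y)]
    abel
  have hmul {U V : (x : M) → TangentSpace 𝓘(ℝ, F) x} (hU : IsSmoothField U)
      (hV : IsSmoothField V) : IsSmoothField (fun y => α y (U y) (V y)) := by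
    have h : (fun y => α y (U y) (V y)) = fun y => cov V y (U y) - cov0 V y (U y) :=
      funext fun y => differenceMul_apply (hV.isDiffFieldAt y) _
    rw [h]
    exact ContMDiff.sub_section (isSmoothField_cov hU hV) (isSmoothField_cov hU hV)
  have hsecond {U V : (x : M) → TangentSpace 𝓘(ℝ, F) x} (hU : IsSmoothField U)
      (hV : IsSmoothField V) : cov (fun y => cov Z y (V y)) x (U x) =
        cov0 (fun y => cov0 Z y (V y)) x (U x) + (α x (cov0 V x (U x)) (Z x) +
          α x (V x) (cov0 Z x (U x))) + (α x (U x) (cov0 Z x (V x)) +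
          α x (U x) (α x (V x) (Z x))) := by
    have h1 : (fun y => cov Z y (V y)) =
        (fun y => cov0 Z y (V y)) + fun y => α y (V y) (Z y) :=
      funext fun y => hdiff hZ y _
    have h2 : cov0 ((fun y => cov0 Z y (V y)) + fun y => α y (V y) (Z y)) x (U x) =
        cov0 (fun y => cov0 Z y (V y)) x (U x) + cov0 (fun y => α y (V y) (Z y)) x (U x) :=
      congrArg (fun L : F →L[ℝ] F => L (U x)) (cov0.isCovariantDerivativeOn.add
        ((isSmoothField_cov hV hZ).isDiffFieldAt x) ((hmul hV hZ).isDiffFieldAt x))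
    rw [hdiff (isSmoothField_cov hV hZ), hdiff hZ, map_add, h1, h2, hpar V Z hV hZ]
  -- Torsionfreeness gives `[X, Y] = ∇⁰_X Y - ∇⁰_Y X + α_X Y - α_Y X`. The first two terms, inserted
  -- in `α_{[X,Y]} Z`, cancel those that come from differentiating `α`; the last two leave the
  -- torsion term.
  have hbr := cov.torsion_eq_zero_iff.mp htor (hX.isDiffFieldAt x) (hY.isDiffFieldAt x)
  rw [hdiff hX, hdiff hY] at hbr
  rw [curvatureField, curvatureField, hsecond hX hY, hsecond hY hX, hdiff hZ, ← hbr,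
    mulCurvature_apply]
  simp only [map_add, map_sub, LinearMap.add_apply, LinearMap.sub_apply]
  abel

lemma curvature_sub [T2Space M] [cov.ContMDiffCovariantDerivative ∞]
    [cov0.ContMDiffCovariantDerivative ∞] (htor : cov.torsion = 0)
    (hpar : ∀ (Y Z : (x : M) → TangentSpace 𝓘(ℝ, F) x), IsSmoothField Y → IsSmoothField Z →
      ∀ (x : M) (u : TangentSpace 𝓘(ℝ, F) x),
      cov0 (fun y => differenceMul cov cov0 y (Y y) (Z y)) x u =
        differenceMul cov cov0 x (cov0 Y x u) (Z x) + differenceMul cov cov0 x (Y x) (cov0 Z x u))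
    (x : M) : curvature cov x - curvature cov0 x = mulCurvature (differenceMul cov cov0 x) := by
  let b := finBasis ℝ (TangentSpace 𝓘(ℝ, F) x)
  have hb (cov : CovariantDerivative 𝓘(ℝ, F) F (TangentSpace 𝓘(ℝ, F) : M → Type _)) (i j k) :
      curvature cov x (b i) (b j) (b k) = curvatureField cov (FiberBundle.extend F (b i))
        (FiberBundle.extend F (b j)) (FiberBundle.extend F (b k)) x := by
    simp only [curvature, b, Basis.constr_basis]
  refine b.ext fun i => b.ext fun j => b.ext fun k => ?_
  obtain ⟨X, hX, hbX⟩ := exists_isSmoothField_eq_extend x (b i)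
  obtain ⟨Y, hY, hbY⟩ := exists_isSmoothField_eq_extend x (b j)
  obtain ⟨Z, hZ, hbZ⟩ := exists_isSmoothField_eq_extend x (b k)
  have h := curvatureField_sub htor hpar hX hY hZ x
  rw [← curvatureField_congr hX hY hZ hbX hbY hbZ, ← curvatureField_congr hX hY hZ hbX hbY hbZ,
    ← hb, ← hb, ← hbX.self_of_nhds, ← hbY.self_of_nhds, ← hbZ.self_of_nhds,
    FiberBundle.extend_apply_self, FiberBundle.extend_apply_self,
    FiberBundle.extend_apply_self] at h
  exact h

end DifferenceCurvature

/-! ### Naturality of algebraic curvature; multiplications determined by torsion -/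

section Algebra

lemma ricciOf_sub {V : Type*} [AddCommGroup V] [Module ℝ V] (R R' : V →ₗ[ℝ] V →ₗ[ℝ] V →ₗ[ℝ] V) :
    ricciOf R - ricciOf R' = ricciOf (R - R') := by
  ext v w
  simp only [LinearMap.sub_apply, ricciOf_apply, ← map_sub]
  rfl

lemma ricciOf_mulCurvature_map {V V' : Type*} [AddCommGroup V] [Module ℝ V] [AddCommGroup V']
    [Module ℝ V'] (L : V ≃ₗ[ℝ] V') {α : V →ₗ[ℝ] V →ₗ[ℝ] V} {α' : V' →ₗ[ℝ] V' →ₗ[ℝ] V'}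
    (h : ∀ u v, α' (L u) (L v) = L (α u v)) (v w : V) :
    ricciOf (mulCurvature α') (L v) (L w) = ricciOf (mulCurvature α) v w := by
  rw [ricciOf_apply, ricciOf_apply, ← LinearMap.trace_conj' _ L]
  congr 1
  ext u
  obtain ⟨u, rfl⟩ := L.surjective u
  simp [mulCurvature_apply, h, LinearEquiv.conj_apply, ← map_sub]

/-- Skew-symmetric multiplications on Euclidean spaces are determined by their torsion. -/
lemma map_mul_of_torsion {V V' : Type*} [NormedAddCommGroup V] [InnerProductSpace ℝ V]
    [NormedAddCommGroup V'] [InnerProductSpace ℝ V'] (L : V → V') (hL : Function.Surjective L)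
    (hinner : ∀ u v, (inner ℝ (L u) (L v) : ℝ) = inner ℝ u v)
    {α : V →ₗ[ℝ] V →ₗ[ℝ] V} {α' : V' →ₗ[ℝ] V' →ₗ[ℝ] V'}
    (hα : ∀ u v w, (inner ℝ (α u v) w : ℝ) = -inner ℝ v (α u w))
    (hα' : ∀ u v w, (inner ℝ (α' u v) w : ℝ) = -inner ℝ v (α' u w))
    (h : ∀ u v, α' (L u) (L v) - α' (L v) (L u) = L (α u v - α v u)) (u v : V) :
    α' (L u) (L v) = L (α u v) := by
  set t : V → V → V → ℝ := fun u v w => inner ℝ (α' (L u) (L v)) (L w) - inner ℝ (α u v) w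
  have h1 (u v w) : t u v w = -t u w v := by
    simp only [t]
    rw [hα', hα, real_inner_comm _ (L v), real_inner_comm _ v]
    ring
  have h2 (u v w) : t u v w = t v u w := by
    have := congrArg (fun z => (inner ℝ z (L w) : ℝ)) (h u v)
    simp only [inner_sub_left, hinner] at this
    simp only [t]
    linarith
  -- The defect `t` is symmetric in its first two arguments and skew in its last two; alternating
  -- these moves six times returns `t u v w` with the opposite sign.
  have h3 (u v w) : t u v w = 0 := by
    linarith [h1 u v w, h2 u w v, h1 w u v, h2 w v u, h1 v w u, h2 v u w]
  refine ext_inner_right ℝ fun w => ?_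
  obtain ⟨w, rfl⟩ := hL w
  rw [hinner]
  exact sub_eq_zero.mp (h3 u v w)

end Algebra

/-! ### Invariance of the difference tensors and the Codazzi equation at a point -/

section Invariance

variable {E : Type*} [NormedAddCommGroup E] [NormedSpace ℝ E] [FiniteDimensional ℝ E]
  {G : Type*} [TopologicalSpace G] [ChartedSpace E G] [Group G] [LieGroup 𝓘(ℝ, E) ∞ G]
  {F : Type*} [NormedAddCommGroup F] [NormedSpace ℝ F] [FiniteDimensional ℝ F]
  {H : Subgroup G} [ChartedSpace F (G ⧸ H)] [IsManifold 𝓘(ℝ, F) ∞ (G ⧸ H)]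
  [ContMDiffSMul 𝓘(ℝ, E) 𝓘(ℝ, F) ∞ G (G ⧸ H)]
  {D : ReductiveDecomposition E H}
  {cov cov0 : CovariantDerivative 𝓘(ℝ, F) F (TangentSpace 𝓘(ℝ, F) : G ⧸ H → Type _)}

lemma IsInvariantConnection.torsion_dTranslate (hq : IsPrincipalQuotient E F H)
    (D : ReductiveDecomposition E H) (h : IsInvariantConnection cov) (g : G) (x : G ⧸ H)
    (u v : F) :
    cov.torsion (g • x) (dTranslate F g x u) (dTranslate F g x v) =
      dTranslate F g x (cov.torsion x u v) := by
  have : IsManifold 𝓘(ℝ, F) 2 (G ⧸ H) := .of_le (n := ∞) (by norm_cast)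
  obtain ⟨U, hU, hUu⟩ := exists_isDiffFieldAt F (g • x) (dTranslate F g x u)
  obtain ⟨V, hV, hVv⟩ := exists_isDiffFieldAt F (g • x) (dTranslate F g x v)
  have hinj := (isInvertible_dTranslate (F := F) E g x).injective
  have hu : pullField g U x = u := hinj ((dTranslate_pullField E U g x).trans hUu)
  have hv : pullField g V x = v := hinj ((dTranslate_pullField E V g x).trans hVv)
  have h1 := cov.torsion_apply hU hV
  have h2 := cov.torsion_apply (isDiffFieldAt_pullField E hU) (isDiffFieldAt_pullField E hV)
  rw [hUu, hVv] at h1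
  rw [hu, hv, ← pullField_mlieBracket E hU hV] at h2
  have h3 (a b c : F) : dTranslate F g x (a - b - c) =
      dTranslate F g x a - dTranslate F g x b - dTranslate F g x c := by simp
  have h4 := h.dTranslate_cov hq D hV u
  have h5 := h.dTranslate_cov hq D hU v
  have h6 := dTranslate_pullField E (VectorField.mlieBracket 𝓘(ℝ, F) U V) g x
  have h7 {p q a b c : F} {a' b' c' : F} (e1 : p = a' - b' - c') (e2 : q = a - b - c)
      (ha : dTranslate F g x a = a') (hb : dTranslate F g x b = b')
      (hc : dTranslate F g x c = c') : p = dTranslate F g x q := by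
    rw [e1, e2, h3, ha, hb, hc]
  exact h7 h1 h2 h4 h5 h6

variable [RiemannianBundle (fun x : G ⧸ H => TangentSpace 𝓘(ℝ, F) x)]
  [IsContMDiffRiemannianBundle 𝓘(ℝ, F) ∞ F (fun x : G ⧸ H => TangentSpace 𝓘(ℝ, F) x)]

lemma IsCanonicalConnection.mvfderiv_inner (h : IsCanonicalConnection D cov0)
    (hq : IsPrincipalQuotient E F H) (hmetric : IsInvariantMetric F H) (x : G ⧸ H)
    (Y Z : (x : G ⧸ H) → TangentSpace 𝓘(ℝ, F) x) (hY : IsDiffFieldAt Y x)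
    (hZ : IsDiffFieldAt Z x) (u : TangentSpace 𝓘(ℝ, F) x) :
    mvfderiv 𝓘(ℝ, F) (fun y => (inner ℝ (Y y) (Z y) : ℝ)) x u =
      inner ℝ (cov0 Y x u) (Z x) + inner ℝ (Y x) (cov0 Z x u) :=
  h.mvfderiv_form hq (K := fun x => innerₗ (TangentSpace 𝓘(ℝ, F) x))
    (fun g x u v => hmetric g x u v) hY hZ (mdifferentiableAt_inner hY hZ) u

/-- Invariance of `∇` itself is not needed: `dτ_g` is an isometry preserving the torsion of `∇⁰`,
and this torsion determines the skew tensor `α`. -/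
lemma isInvariantMul_differenceMul (h0 : IsCanonicalConnection D cov0)
    (hq : IsPrincipalQuotient E F H) (hmetric : IsInvariantMetric F H) (h : IsLeviCivita cov) :
    IsInvariantMul (differenceMul cov cov0) := by
  intro g x u v
  have hskew := inner_differenceMul (h.mvfderiv_inner (exists_isSmoothField hq D))
    (h0.mvfderiv_inner hq hmetric)
  refine map_mul_of_torsion (V := TangentSpace 𝓘(ℝ, F) x) (V' := TangentSpace 𝓘(ℝ, F) (g • x))
    (dTranslate F g x) (isInvertible_dTranslate (F := F) E g x).surjective
    (fun u v => hmetric g x u v) (hskew x) (hskew (g • x)) (fun u v => ?_) u v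
  refine (differenceMul_sub_swap h.torsion_eq_zero (g • x) _ _).trans ?_
  rw [differenceMul_sub_swap h.torsion_eq_zero x u v]
  exact (congrArg (fun w : F => -w) (h0.invariant.torsion_dTranslate hq D g x u v)).trans
    (map_neg (dTranslate F g x) _).symm

variable [cov.ContMDiffCovariantDerivative ∞] [cov0.ContMDiffCovariantDerivative ∞]

lemma curvature_sub_canonical [T2Space (G ⧸ H)] (h0 : IsCanonicalConnection D cov0)
    (hq : IsPrincipalQuotient E F H) (hmetric : IsInvariantMetric F H) (h : IsLeviCivita cov)
    (x : G ⧸ H) : curvature cov x - curvature cov0 x = mulCurvature (differenceMul cov cov0 x) := by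
  refine curvature_sub h.torsion_eq_zero (fun Y Z hY hZ x u => ?_) x
  refine h0.cov_mul hq (isInvariantMul_differenceMul h0 hq hmetric h) (hY.isDiffFieldAt x)
    (hZ.isDiffFieldAt x) ?_ u
  have h1 : (fun y => differenceMul cov cov0 y (Y y) (Z y)) =
      fun y => cov Z y (Y y) - cov0 Z y (Y y) :=
    funext fun y => differenceMul_apply (hZ.isDiffFieldAt y) _
  rw [h1]
  exact IsSmoothField.isDiffFieldAt (ContMDiff.sub_section (isSmoothField_cov (cov := cov) hY hZ)
    (isSmoothField_cov (cov := cov0) hY hZ)) x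

lemma differenceRicci_eq [T2Space (G ⧸ H)] (h0 : IsCanonicalConnection D cov0)
    (hq : IsPrincipalQuotient E F H) (hmetric : IsInvariantMetric F H) (h : IsLeviCivita cov)
    (x : G ⧸ H) :
    differenceRicci cov cov0 x = ricciOf (mulCurvature (differenceMul cov cov0 x)) := by
  rw [differenceRicci, ricciOf_sub, curvature_sub_canonical h0 hq hmetric h]

/-- The difference Ricci form is built algebraically from `α`, and the trace is invariant under
conjugation by `dτ_g`. -/
lemma isInvariantForm_differenceRicci [T2Space (G ⧸ H)] (h0 : IsCanonicalConnection D cov0)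
    (hq : IsPrincipalQuotient E F H) (hmetric : IsInvariantMetric F H) (h : IsLeviCivita cov) :
    IsInvariantForm (differenceRicci cov cov0) := by
  intro g x u v
  rw [differenceRicci_eq h0 hq hmetric h, differenceRicci_eq h0 hq hmetric h]
  obtain ⟨e, he⟩ := isInvertible_dTranslate (F := F) E g x
  have hα := isInvariantMul_differenceMul h0 hq hmetric h g x
  rw [← he] at hα ⊢
  exact ricciOf_mulCurvature_map (V := F) (V' := F) e.toLinearEquiv
    (α := differenceMul cov cov0 x) (α' := differenceMul cov cov0 (g • x)) hα u v

/-- The invariant form is `∇⁰`-parallel, so only `α = ∇ - ∇⁰` contributes. Of the Codazzi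
hypothesis, only its smoothness part enters here. -/
lemma covDeriv_differenceRicci [T2Space (G ⧸ H)] (h0 : IsCanonicalConnection D cov0)
    (hq : IsPrincipalQuotient E F H) (hmetric : IsInvariantMetric F H) (h : IsLeviCivita cov)
    (hcod : IsCodazzi cov (differenceRicci cov cov0))
    {X Y Z : (x : G ⧸ H) → TangentSpace 𝓘(ℝ, F) x} (hY : IsSmoothField Y) (hZ : IsSmoothField Z)
    (x : G ⧸ H) :
    covDeriv cov (differenceRicci cov cov0) X Y Z x =
      -(differenceRicci cov cov0 x (differenceMul cov cov0 x (X x) (Y x)) (Z x) +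
        differenceRicci cov cov0 x (Y x) (differenceMul cov cov0 x (X x) (Z x))) := by
  have h1 := h0.mvfderiv_form hq (isInvariantForm_differenceRicci h0 hq hmetric h)
    (hY.isDiffFieldAt x) (hZ.isDiffFieldAt x)
    ((hcod.smooth Y Z hY hZ x).mdifferentiableAt (by simp)) (X x)
  rw [covDeriv, h1, differenceMul_apply (hY.isDiffFieldAt x),
    differenceMul_apply (hZ.isDiffFieldAt x), map_sub, map_sub, LinearMap.sub_apply]
  ring

lemma isCodazziPair_differenceRicci [T2Space (G ⧸ H)] (h0 : IsCanonicalConnection D cov0)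
    (hq : IsPrincipalQuotient E F H) (hmetric : IsInvariantMetric F H) (h : IsLeviCivita cov)
    (hcod : IsCodazzi cov (differenceRicci cov cov0)) (x : G ⧸ H) :
    IsCodazziPair (differenceMul cov cov0 x) (differenceRicci cov cov0 x) where
  skew := inner_differenceMul (h.mvfderiv_inner (exists_isSmoothField hq D))
    (h0.mvfderiv_inner hq hmetric) x
  symm := hcod.symm x
  codazzi u v w := by
    obtain ⟨X, hX, rfl⟩ := exists_isSmoothField hq D x u
    obtain ⟨Y, hY, rfl⟩ := exists_isSmoothField hq D x v
    obtain ⟨Z, hZ, rfl⟩ := exists_isSmoothField hq D x w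
    have := hcod.codazzi X Y Z hX hY hZ x
    rw [covDeriv_differenceRicci h0 hq hmetric h hcod hY hZ,
      covDeriv_differenceRicci h0 hq hmetric h hcod hX hZ] at this
    exact neg_injective this

lemma isParallel_of_basePoint [T2Space (G ⧸ H)] (h0 : IsCanonicalConnection D cov0)
    (hq : IsPrincipalQuotient E F H) (hmetric : IsInvariantMetric F H) (h : IsLeviCivita cov)
    (hcod : IsCodazzi cov (differenceRicci cov cov0))
    (hzero : differenceRicci cov cov0 (basePoint H) = 0) :
    IsParallel cov (differenceRicci cov cov0) := by
  have hall (x : G ⧸ H) (u v : TangentSpace 𝓘(ℝ, F) x) : differenceRicci cov cov0 x u v = 0 := by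
    obtain ⟨g, rfl⟩ := exists_smul_basePoint x
    have hs := (isInvertible_dTranslate (F := F) E g (basePoint H)).surjective
    obtain ⟨u', hu⟩ := hs u
    obtain ⟨v', hv⟩ := hs v
    have := isInvariantForm_differenceRicci h0 hq hmetric h g (basePoint H) u' v'
    rw [hu, hv, hzero] at this
    exact this
  intro X Y Z _ hY hZ x
  rw [covDeriv_differenceRicci h0 hq hmetric h hcod hY hZ, hall, hall, add_zero, neg_zero]

/-- At `eH` the torsion of `∇⁰` on action fields is `[X^#, Y^#] + [X^#, Y^#] - [X^#, Y^#]`, which is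
`-dπ[X, Y]`. The abelian condition on an eigenspace thereby becomes symmetry of `α`. -/
lemma differenceMul_sub_swap_dProj (h0 : IsCanonicalConnection D cov0)
    (hq : IsPrincipalQuotient E F H) (h : IsLeviCivita cov) {X Y : GroupLieAlgebra 𝓘(ℝ, E) G}
    (hX : X ∈ D.𝔪) (hY : Y ∈ D.𝔪) :
    differenceMul cov cov0 (basePoint H) (dProj E F H X) (dProj E F H Y) -
      differenceMul cov cov0 (basePoint H) (dProj E F H Y) (dProj E F H X) =
      dProj E F H (D.bracket X Y) := by
  have : IsManifold 𝓘(ℝ, F) 2 (G ⧸ H) := .of_le (n := ∞) (by norm_cast)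
  have hfX := (isSmoothField_actionField (F := F) (H := H) X).isDiffFieldAt (basePoint H)
  have hfY := (isSmoothField_actionField (F := F) (H := H) Y).isDiffFieldAt (basePoint H)
  have hdX : dProj E F H X = actionField X (basePoint H) := dProj_eq_actionField X
  have hdY : dProj E F H Y = actionField Y (basePoint H) := dProj_eq_actionField Y
  have hd : actionField ⁅X, Y⁆ (basePoint H) = dProj E F H ⁅X, Y⁆ :=
    (dProj_eq_actionField ⁅X, Y⁆).symm
  have hbr : VectorField.mlieBracket 𝓘(ℝ, F) (actionField X) (actionField Y) (basePoint H) =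
      -(actionField ⁅X, Y⁆ (basePoint H) : TangentSpace 𝓘(ℝ, F) (basePoint H)) :=
    mlieBracket_actionField X Y
  rw [differenceMul_sub_swap h.torsion_eq_zero, hdX, hdY, cov0.torsion_apply hfX hfY,
    h0.cov_basePoint hq hX hfY, h0.cov_basePoint hq hY hfX,
    VectorField.mlieBracket_swap_apply (V := actionField Y), hbr, D.dProj_bracket hq, ← hd]
  abel

end Invariance

end ReductiveHomogeneous

end

/-! ### The theorem -/

open ReductiveHomogeneous in
theorem corollary3p4
    {E : Type*} [NormedAddCommGroup E] [NormedSpace ℝ E] [FiniteDimensional ℝ E]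
    {G : Type*} [TopologicalSpace G] [ChartedSpace E G] [Group G] [LieGroup 𝓘(ℝ, E) ∞ G]
    (H : Subgroup G) (hH : IsClosed (H : Set G))
    -- the homogeneous space `G/H` with its smooth structure
    {F : Type*} [NormedAddCommGroup F] [NormedSpace ℝ F] [FiniteDimensional ℝ F]
    [ChartedSpace F (G ⧸ H)] [IsManifold 𝓘(ℝ, F) ∞ (G ⧸ H)]
    (hquot : IsPrincipalQuotient E F H)
    (D : ReductiveDecomposition E H)
    -- the `G`-invariant Riemannian metric
    [RiemannianBundle (fun x : G ⧸ H => TangentSpace 𝓘(ℝ, F) x)]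
    [IsContMDiffRiemannianBundle 𝓘(ℝ, F) ∞ F (fun x : G ⧸ H => TangentSpace 𝓘(ℝ, F) x)]
    (hmetric : IsInvariantMetric F H)
    -- the Levi-Civita connection `∇` and the canonical connection of second kind `∇⁰`
    (nabla nabla0 : CovariantDerivative 𝓘(ℝ, F) F (TangentSpace 𝓘(ℝ, F) : G ⧸ H → Type _))
    [nabla.ContMDiffCovariantDerivative ∞] [nabla0.ContMDiffCovariantDerivative ∞]
    (hLC : IsLeviCivita nabla) (hcan : IsCanonicalConnection D nabla0)
    -- the difference Ricci tensor is a Codazzi tensor field and is not parallel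
    (hcod : IsCodazzi nabla (differenceRicci nabla nabla0))
    (hpar : ¬ IsParallel nabla (differenceRicci nabla nabla0))
    -- `lam 0 < ... < lam (r - 1)` are the eigenvalues of the difference Ricci tensor at `eH`
    (r : ℕ) (hr : 0 < r) (lam : Fin r → ℝ) (hlam : StrictMono lam)
    (hspec : ∀ c : ℝ, c ∈ Set.range lam ↔
      ricciEigenspace nabla nabla0 c ≠ ⊥) :
    ((∀ i : Fin r, (i : ℕ) + 1 < r →
        0 ≤ leafScalar nabla nabla0 (lam i)) →
      leafScalar nabla nabla0 (lam ⟨r - 1, by omega⟩) ≠ 0) ∧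
    ¬ ∀ i : Fin r, ∀ X ∈ ricciEigenspaceIn D nabla nabla0 (lam i),
        ∀ Y ∈ ricciEigenspaceIn D nabla nabla0 (lam i), D.bracket X Y = 0 := by
  have hsm : ContMDiffSMul 𝓘(ℝ, E) 𝓘(ℝ, F) ∞ G (G ⧸ H) := hquot.contMDiffSMul
  have : IsTopologicalGroup G := topologicalGroup_of_lieGroup 𝓘(ℝ, E) ∞
  have : IsClosed (H : Set G) := hH
  -- Closedness of `H` makes the quotient Hausdorff, as the cut-off of local extensions requires.
  have : T2Space (G ⧸ H) := inferInstance
  set α := differenceMul nabla nabla0 ((1 : G) : G ⧸ H) with hα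
  set R := curvature nabla ((1 : G) : G ⧸ H) - curvature nabla0 ((1 : G) : G ⧸ H) with hRdef
  have hRic : differenceRicci nabla nabla0 ((1 : G) : G ⧸ H) = ricciOf R := by
    rw [differenceRicci, ricciOf_sub]
  have hR : IsCurvatureOf R α := by
    rw [hRdef, curvature_sub_canonical hcan hquot hmetric hLC]
    exact fun _ _ _ => rfl
  have hpair : IsCodazziPair α (differenceRicci nabla nabla0 ((1 : G) : G ⧸ H)) :=
    isCodazziPair_differenceRicci hcan hquot hmetric hLC hcod _
  have hfirst : (∀ i : Fin r, (i : ℕ) + 1 < r → 0 ≤ leafScalar nabla nabla0 (lam i)) →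
      leafScalar nabla nabla0 (lam ⟨r - 1, by omega⟩) ≠ 0 := by
    intro hs hlast
    refine hpar (isParallel_of_basePoint hcan hquot hmetric hLC hcod (hRic.trans ?_))
    simp only [leafScalar, ricciEigenspace, hRic] at hs hlast hspec
    rw [hRic] at hpair
    refine ricciOf_eq_zero_of_scalarOn hpair hR hlam hspec (fun i => ?_)
      (fun i => Fin.mk_le_mk.2 (by omega)) hlast
    -- The sign hypothesis covers all indices but the last; there nonnegativity comes from the
    -- assumed vanishing.
    rcases Nat.lt_or_ge ((i : ℕ) + 1) r with hi | hi
    · exact hs i hi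
    · have : i = ⟨r - 1, by omega⟩ := Fin.ext (by have := i.2; simp only; omega)
      rw [this]
      exact hlast.ge
  refine ⟨hfirst, fun habel => ?_⟩
  have hzero : ∀ i, leafScalar nabla nabla0 (lam i) = 0 := by
    intro i
    refine scalarOn_eq_zero_of_torsion hpair hR fun u hu v hv => ?_
    obtain ⟨X, hX, rfl⟩ := D.exists_mem_dProj_eq hquot u
    obtain ⟨Y, hY, rfl⟩ := D.exists_mem_dProj_eq hquot v
    have h0 := differenceMul_sub_swap_dProj hcan hquot hLC hX hY
    rw [habel i X ⟨hX, hu⟩ Y ⟨hY, hv⟩, map_zero] at h0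
    exact sub_eq_zero.1 h0
  exact hfirst (fun i _ => (hzero i).ge) (hzero _)
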